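/- **Setting.** Arms are indexed by a countably infinite set $\mathcal A=\{1,2,\dots\}$. Let $\mu$ be a probability distribution on $\mathbb R$ whose support is $[0,1]$, and let $\theta=(\theta_a)_{a\in\mathcal A}$ be i.i.d. with law $\mu$. Conditionally on $\theta$, the outcome vectors $Y_t=(Y_{t,a})_{a\in\mathcal A}$, $t\in\mathbb N_0\cup\{\infty\}$, are i.i.d.; the conditional law of $Y_{t,a}$ depends on $\theta$ only through $\theta_a$. Outcomes take values in a standard Borel space, $R$ is a measurable reward function, $R_{t,a}=R(Y_{t,a})\in[0,1]$ almost surely, and $\mathbf E[R_{t,a}\mid\theta]=\theta_a$. Put $R^*=\sup_a\mathbf E[R(Y_{\infty,a})\mid\theta]$. An action process $(A_t)_{t\ge0}$ has history $\mathcal F_t=(A_0,Y_{0,A_0},\dots,A_{t-1},Y_{t-1,A_{t-1}})$; $\mathbf E_t$, $\mathbf P_t$ denote conditioning on $\mathcal F_t$. Let $\xi$ be a random variable in a standard Borel space, independent of $(\theta,(Y_t)_{t\in\mathbb N_0\cup\{\infty\}})$. **Satisficing Thompson sampling (STS)** with tolerance $\epsilon$: at each time $t$, draw $\hat\theta_t$,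 a measurable function of $(\mathcal F_t,\xi)$, whose conditional law given $\mathcal F_t$ is $\mathbf P(\theta\in\cdot\mid\mathcal F_t)$. If some $k<t$ satisfies $\mathbf E[R_{t,A_k}\mid\theta=\hat\theta_t]+\epsilon\ge\sup_a\mathbf E[R_{t,a}\mid\theta=\hat\theta_t]$, set $A_t=A_k$ for the smallest such $k$; otherwise let $A_t$ be a new, previously unplayed arm. New arms are played in an order (an injective sequence of arms) that is determined by $\xi$. For an $\mathcal A$-valued random variable $\tilde A$ and $\tilde R=R(Y_{\infty,\tilde A})$, let $$\Gamma\big(\tilde A,\{A_t\}\big)=(1-\alpha^2)\sum_{t=0}^\infty\alpha^{2t}\,\mathbf E\left[\frac{\mathbf E_t[\tilde R-R_{t,A_t}]^2}{\mathbf I_t(\tilde A;Y_{t,A_t}\mid\xi)}\right],\qquad \tfrac00:=0,$$ where $\mathbf I_t(\cdot\,;\cdot\mid\xi)$ is mutual information conditional on $\xi$ computed under the posterior $\mathbf P_t$, and let $\mathbf H(\tilde A\mid\xi)$ be conditional Shannon entropy (natural logarithms). **Theorem.** Let $\epsilon\in(0,1)$, $\alpha\in[0,1)$, $\delta=\mu((1-\epsilon,\infty))=\mathbf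 P(\theta_a>1-\epsilon)$, and let $(A_t)$ be generated by STS with tolerance $\epsilon$. Then almost surely there is $t\in\mathbb N_0$ with $\theta_{A_t}\ge1-\epsilon$. With $\tau=\min\{t:\theta_{A_t}\ge1-\epsilon\}$ and $\tilde A=A_\tau$, $$\mathbf H(\tilde A\mid\xi)\le1+\log(1/\delta),\qquad \Gamma\big(\tilde A,\{A_t\}\big)\le6+\frac4\delta+\frac2\delta\log\Big(\frac1{1-\alpha^2}\Big).$$ Moreover the discounted regret series converges almost surely, its sum is integrable, and $$\mathbf E\Big[\sum_{t=0}^\infty\alpha^t(R^*-R_{t,A_t})\Big]\le\frac{\epsilon}{1-\alpha}+\sqrt{\frac{\big(6+\frac4\delta+\frac2\delta\log\frac1{1-\alpha^2}\big)\big(1+\log(1/\delta)\big)}{1-\alpha^2}}=\tilde O\left(\frac{\epsilon}{1-\alpha}+\sqrt{\frac{1/\delta}{1-\alpha^2}}\right),$$ where $f=\tilde O(g)$ means that there are a constant $C$ and an integer $k\ge 0$ such that $|f|\le C\,g\,(1+|\log g|)^k$ for all $\epsilon\in(0,1)$, $\delta\in(0,1]$, $\alpha\in[0,1)$. -/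

import Mathlib

open MeasureTheory ProbabilityTheory
open scoped ENNReal

noncomputable section

namespace STSBandit

/-! ### Information-theoretic quantities (natural logarithms) -/

section Information

variable {Ω α β γ ζ : Type*} [MeasurableSpace Ω] [MeasurableSpace α] [MeasurableSpace β]
  [MeasurableSpace γ] [MeasurableSpace ζ]

/-- Conditional entropy `H(X | Z)` of an `ℕ`-valued random variable: the average over `Z` of the
Shannon entropy of the conditional law of `X` given `Z`. -/
def condEntropy (P : Measure Ω) [IsFiniteMeasure P] (X : Ω → ℕ) (Z : Ω → ζ) : ℝ≥0∞ :=
  ∫⁻ z, ∑' a : ℕ, ENNReal.ofReal (Real.negMulLog ((condDistrib X Z P z).real {a})) ∂(P.map Z)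

/-- Mutual information of the two coordinates under the joint law `ρ`. -/
def mutualInfo (ρ : Measure (α × β)) : ℝ≥0∞ :=
  InformationTheory.klDiv ρ ((ρ.map Prod.fst).prod (ρ.map Prod.snd))

/-- Conditional mutual information `I(X ; Y | Z)` computed under the posterior law of everything
given `F = h`: the average, over the law of `Z` given `F = h`, of the mutual information of the
law of `(X, Y)` given `F = h` and `Z = z`. -/
def posteriorCondMutualInfo [StandardBorelSpace α] [Nonempty α] [StandardBorelSpace β] [Nonempty β]
    [StandardBorelSpace ζ] [Nonempty ζ] (P : Measure Ω) [IsFiniteMeasure P]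
    (F : Ω → γ) (X : Ω → α) (Y : Ω → β) (Z : Ω → ζ) (h : γ) : ℝ≥0∞ :=
  ∫⁻ z, mutualInfo
      (condDistrib (fun ω => (X ω, Y ω)) (fun ω => (F ω, Z ω)) P (h, z))
    ∂(condDistrib Z F P h)

end Information

/-! ### The bandit -/

section Bandit

variable {Ω 𝒴 Ξ : Type*} [MeasurableSpace Ω] [MeasurableSpace 𝒴] [MeasurableSpace Ξ]

/-- The mean reward `E[R(Y_{t,a}) | θ = x]` of arm `a`, where `K x` is the law of an outcome
vector given `θ = x`. -/
def meanReward (K : Kernel (ℕ → ℝ) (ℕ → 𝒴)) (R : 𝒴 → ℝ) (x : ℕ → ℝ) (a : ℕ) : ℝ :=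
  ∫ y, R (y a) ∂(K x)

/-- The optimal mean reward `R*` as a function of the parameter. -/
def optReward (K : Kernel (ℕ → ℝ) (ℕ → 𝒴)) (R : 𝒴 → ℝ) (x : ℕ → ℝ) : ℝ :=
  ⨆ a : ℕ, meanReward K R x a

/-- The infinitely-armed bandit with noisy observations. Arms are indexed by `ℕ`; `Y t ω a` is the
outcome of arm `a` at time `t`, and `Y ⊤` is the additional independent copy `Y_∞`. -/
structure IsNoisyBandit (P : Measure Ω) (μ : Measure ℝ) (K : Kernel (ℕ → ℝ) (ℕ → 𝒴))
    (R : 𝒴 → ℝ) (θ : Ω → ℕ → ℝ) (Y : ℕ∞ → Ω → ℕ → 𝒴) : Prop where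
  measurable_reward : Measurable R
  measurable_param : Measurable θ
  measurable_outcome : ∀ t, Measurable (Y t)
  /-- the `θ_a` are independent with common law `μ` -/
  param_iid : P.map θ = Measure.infinitePi (fun _ : ℕ => μ)
  /-- the support of the prior is the unit interval -/
  support_prior : μ.support = Set.Icc 0 1
  /-- conditionally on `θ`, the outcome vectors are i.i.d. with law `K θ` -/
  outcome_cond_iid : ∀ (s : Finset ℕ∞) (B : Set (ℕ → ℝ)) (S : ℕ∞ → Set (ℕ → 𝒴)),
    MeasurableSet B → (∀ t, MeasurableSet (S t)) →
      P (θ ⁻¹' B ∩ ⋂ t ∈ s, Y t ⁻¹' S t) = ∫⁻ x in B, ∏ t ∈ s, K x (S t) ∂(P.map θ)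
  /-- the law of the outcome of arm `a` depends on `θ` only through `θ_a` -/
  outcome_local : ∃ q : ℕ → Kernel ℝ 𝒴, ∀ a, ∀ᵐ x ∂(P.map θ),
    (K x).map (fun y => y a) = q a (x a)
  /-- `E[R_{t,a} | θ] = θ_a` -/
  mean_eq : ∀ a, ∀ᵐ x ∂(P.map θ), meanReward K R x a = x a
  /-- rewards lie in `[0,1]` almost surely -/
  reward_mem : ∀ t a, ∀ᵐ ω ∂P, R (Y t ω a) ∈ Set.Icc (0 : ℝ) 1

/-- The outcome `Y_{t, A_t}` observed at time `t`. -/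
def observed (Y : ℕ∞ → Ω → ℕ → 𝒴) (A : ℕ → Ω → ℕ) (t : ℕ) (ω : Ω) : 𝒴 :=
  Y (t : ℕ∞) ω (A t ω)

/-- The history `(A_0, Y_{0,A_0}, …, A_{t-1}, Y_{t-1,A_{t-1}})` available before time `t`. -/
def history (Y : ℕ∞ → Ω → ℕ → 𝒴) (A : ℕ → Ω → ℕ) (t : ℕ) (ω : Ω) : Fin t → ℕ × 𝒴 :=
  fun i => (A i ω, observed Y A i ω)

/-- The set of arms played strictly before time `t`. -/
def sampledArms (A : ℕ → Ω → ℕ) (t : ℕ) (ω : Ω) : Finset ℕ :=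
  (Finset.range t).image (fun s => A s ω)

/-- `A` is the action process of satisficing Thompson sampling with tolerance `ε`, driven by the
exogenous random variable `ξ`. At time `t` the parameter `θ̂_t = g t (F_t, ξ)` is a draw from the
posterior of `θ` given the history `F_t`. The earliest previously played arm that is `ε`-optimal
under `θ̂_t` is played; if there is none, a new arm is played, namely the next one in the
exploration order `σ ξ`. -/
structure IsSTS (P : Measure Ω) (K : Kernel (ℕ → ℝ) (ℕ → 𝒴)) (R : 𝒴 → ℝ) (θ : Ω → ℕ → ℝ)
    (Y : ℕ∞ → Ω → ℕ → 𝒴) (ξ : Ω → Ξ) (ε : ℝ) (σ : Ξ → ℕ → ℕ)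
    (g : (t : ℕ) → (Fin t → ℕ × 𝒴) × Ξ → ℕ → ℝ) (A : ℕ → Ω → ℕ) : Prop where
  measurable_exo : Measurable ξ
  /-- `ξ` is independent of `θ` and of all outcomes -/
  indep_exo : IndepFun ξ (fun ω => (θ ω, fun t => Y t ω)) P
  measurable_order : Measurable σ
  injective_order : ∀ x, Function.Injective (σ x)
  measurable_sample : ∀ t, Measurable (g t)
  /-- given `F_t`, the draw `θ̂_t` has the same conditional law as `θ` -/
  posterior_sample : ∀ t,
    P.map (fun ω => (history Y A t ω, g t (history Y A t ω, ξ ω))) =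
      P.map (fun ω => (history Y A t ω, θ ω))
  /-- exploitation of the earliest arm that is `ε`-optimal under the draw -/
  play_satisficing : ∀ t ω, ∀ k < t,
    (optReward K R (g t (history Y A t ω, ξ ω)) ≤
        meanReward K R (g t (history Y A t ω, ξ ω)) (A k ω) + ε) →
    (∀ j < k, ¬ (optReward K R (g t (history Y A t ω, ξ ω)) ≤
        meanReward K R (g t (history Y A t ω, ξ ω)) (A j ω) + ε)) →
    A t ω = A k ω
  /-- exploration of the next new arm otherwise -/
  play_new : ∀ t ω,
    (∀ k < t, ¬ (optReward K R (g t (history Y A t ω, ξ ω)) ≤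
        meanReward K R (g t (history Y A t ω, ξ ω)) (A k ω) + ε)) →
    A t ω = σ (ξ ω) (sampledArms A t ω).card

/-- The first time `τ` at which an arm with `θ_{A_t} ≥ 1 - ε` is played (`0` if this never
happens). -/
def satisficingTime (θ : Ω → ℕ → ℝ) (A : ℕ → Ω → ℕ) (ε : ℝ) (ω : Ω) : ℕ :=
  sInf {t : ℕ | 1 - ε ≤ θ ω (A t ω)}

/-- The benchmark action `Ã = A_τ`. -/
def satisficingArm (θ : Ω → ℕ → ℝ) (A : ℕ → Ω → ℕ) (ε : ℝ) (ω : Ω) : ℕ :=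
  A (satisficingTime θ A ε ω) ω

/-- The posterior expected shortfall `E_t[R̃ - R_{t,A_t}]`, with `R̃ = R(Y_{∞,Ã})`. -/
def posteriorShortfall (P : Measure Ω) (R : 𝒴 → ℝ) (Y : ℕ∞ → Ω → ℕ → 𝒴) (A : ℕ → Ω → ℕ)
    (Atil : Ω → ℕ) (t : ℕ) : Ω → ℝ :=
  P[fun ω => R (Y ⊤ ω (Atil ω)) - R (observed Y A t ω) |
    MeasurableSpace.comap (history Y A t) inferInstance]

/-- The information ratio `Γ(Ã, {A_t})`. Division in `ℝ≥0∞` has `0 / 0 = 0` and `x / 0 = ∞` for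
`x ≠ 0`. -/
def informationRatio [StandardBorelSpace 𝒴] [Nonempty 𝒴] [StandardBorelSpace Ξ] [Nonempty Ξ]
    (P : Measure Ω) [IsFiniteMeasure P] (R : 𝒴 → ℝ) (Y : ℕ∞ → Ω → ℕ → 𝒴) (ξ : Ω → Ξ)
    (α : ℝ) (Atil : Ω → ℕ) (A : ℕ → Ω → ℕ) : ℝ≥0∞ :=
  ENNReal.ofReal (1 - α ^ 2) * ∑' t : ℕ, ENNReal.ofReal (α ^ (2 * t)) *
    ∫⁻ ω, ENNReal.ofReal (posteriorShortfall P R Y A Atil t ω ^ 2) /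
      posteriorCondMutualInfo P (history Y A t) Atil (observed Y A t) ξ (history Y A t ω) ∂P

/-- The discounted regret terms `α^t (R* - R_{t,A_t})`. -/
def discountedGap (K : Kernel (ℕ → ℝ) (ℕ → 𝒴)) (R : 𝒴 → ℝ) (θ : Ω → ℕ → ℝ)
    (Y : ℕ∞ → Ω → ℕ → 𝒴) (α : ℝ) (A : ℕ → Ω → ℕ) (ω : Ω) (t : ℕ) : ℝ :=
  α ^ t * (optReward K R (θ ω) - R (observed Y A t ω))

end Bandit

/-! ### The bounds -/

/-- `6 + 4/δ + (2/δ) log (1/(1-α²))`. -/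
def ratioBound (δ α : ℝ) : ℝ :=
  6 + 4 / δ + 2 / δ * Real.log (1 / (1 - α ^ 2))

/-- The explicit bound on expected discounted regret. -/
def regretBound (ε δ α : ℝ) : ℝ :=
  ε / (1 - α) + Real.sqrt (ratioBound δ α * (1 + Real.log (1 / δ)) / (1 - α ^ 2))

/-- `f = Õ(g)` uniformly on `S`: `f` is bounded by a constant times `g` times a power of
`1 + |log g|`. -/
def IsSoftO {ι : Type*} (S : Set ι) (f g : ι → ℝ) : Prop :=
  ∃ (C : ℝ) (k : ℕ), ∀ p ∈ S, |f p| ≤ C * (|g p| * (1 + |Real.log (g p)|) ^ k)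

end STSBandit

end

set_option linter.unusedSectionVars false

noncomputable section

namespace STSBandit

/-! ### Variational lower bounds for relative entropy and entropy. -/

section RealAnalysis

/-! Since the prior charges every neighbourhood of 1, the optimal mean reward is 1 almost surely
(`ae_map_param_reward`), and the rule reads: draw a parameter from the posterior, play the earliest
played arm where the draw is at least `1 - ε`, otherwise a fresh arm. Write `p = μ [1-ε, ∞)`, so
that `p ≥ δ`.

Benchmark. The exogenous variable and the parameter are conditionally independent given the history
(`exists_posterior`), and a fresh arm has a parameter with law `μ`, independent of the past
(`setLIntegral_new_mul`). Fresh arms are taken in the order fixed by `ξ`, so the benchmark arm is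
the first arm of that order whose parameter reaches `1 - ε` (`exists_satisficingArm_eq_order`).
Given `ξ` its position is geometric with success probability `p`, whence the entropy bound.

Exploration. Let `x t` be the probability that no good arm has been played before time `t`. Given
the history, "the parameter is bad at every played arm" and "the draw is bad at every played arm"
are independent with the same probability, so by Jensen both occur with probability at least `x t ^
2`; then a fresh arm is played and is good with probability `p`. Hence `x (t+1) ≤ x t - p * x t ^ 2`
and `x t ≤ 1 / (1 + p t)`. The expected number of arms played before `t` is `∑ s < t, x s`, and
discounting it gives the logarithm (`tsum_lintegral_card_le`).

Information. Given history and `ξ`, the mutual information between the benchmark arm and the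
observation is at least the squared covariance of the reward with the event that the played arm is
the benchmark, divided by the probability of that event (`sq_cov_div_le_mutualInfo`). Given the
history alone, the played arm and the benchmark assign the same probability to each old arm, because
the draw has the posterior law. The shortfall is therefore a sum of these covariances over old arms
plus one term for a fresh arm, and a weighted Cauchy–Schwarz inequality bounds its square by (number
of played arms + `1 / p`) times the averaged information bound (`sq_shortfall_le`). This gives the
information ratio.

Regret. The same covariance quantity, `historyGain`, also bounds from below the drop of the
conditional entropy of the benchmark in one step (`lintegral_stepGain_add_condEntropy_le`), so its
expectations sum to at most the initial entropy. Combining this with the discounted count of arms by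
a weighted AM–GM inequality yields the square root (`tsum_shortfall_le`); the benchmark itself loses
at most `ε` per step. The regret bound thus goes through `historyGain` directly, with no chain rule
for mutual information. -/

open InformationTheory in
theorem sq_sqrt_sub_one_le_klFun {r : ℝ} (hr : 0 ≤ r) : (√r - 1) ^ 2 ≤ klFun r := by
  rcases hr.eq_or_lt with rfl | hr
  · simp [klFun_zero]
  have hs : 0 < √r := Real.sqrt_pos.2 hr
  -- Multiplied by `2 r`, this gives `r log r ≥ 2 r - 2 √r`; adding `1 - r` turns the right side
  -- into `(√r - 1) ^ 2`.
  have h1 : 1 - (√r)⁻¹ ≤ Real.log √r := Real.one_sub_inv_le_log_of_pos hs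
  have h2 : Real.log r = 2 * Real.log √r := by rw [Real.log_sqrt hr.le]; ring
  have h3 : √r * √r = r := Real.mul_self_sqrt hr.le
  rw [klFun_apply, h2]
  have h4 : r * (√r)⁻¹ = √r := by
    nth_rewrite 1 [← h3]
    rw [mul_assoc, mul_inv_cancel₀ hs.ne', mul_one]
  have h5 := mul_le_mul_of_nonneg_left h1 hr.le
  nlinarith

/-- A linear-in-`r` minorant of `klFun r`, for a test value `g` with `|g| ≤ 1 / 2`. -/
theorem le_klFun_of_abs_le_half {r g : ℝ} (hr : 0 ≤ r) (hg : |g| ≤ 1 / 2) (l : ℝ) :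
    l * g * (r - 1) - l ^ 2 * (r + 1) / 8 ≤ InformationTheory.klFun r := by
  refine le_trans ?_ (sq_sqrt_sub_one_le_klFun hr)
  have h3 : √r * √r = r := Real.mul_self_sqrt hr
  set s := √r
  have hg2 : g ^ 2 ≤ 1 / 4 := by
    have := sq_le_sq' (by linarith [abs_nonneg g] : -(1 / 2) ≤ |g|) hg
    rw [sq_abs] at this; linarith
  -- Expanding the square gives `(s - 1)² ≥ l g (s² - 1) - l² g² (s + 1)² / 4`. The constant 8 then
  -- comes from `g² ≤ 1 / 4` and `(s + 1)² ≤ 2 (s² + 1)`.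
  have e1 := sq_nonneg ((s - 1) - l * g * (s + 1) / 2)
  have e2 : l ^ 2 * (g ^ 2 * (s + 1) ^ 2) ≤ l ^ 2 * (1 / 4 * (2 * (r + 1))) := by
    apply mul_le_mul_of_nonneg_left _ (sq_nonneg l)
    apply mul_le_mul hg2 _ (sq_nonneg _) (by norm_num)
    nlinarith [sq_nonneg (s - 1)]
  rw [← h3] at e2 ⊢
  nlinarith

theorem abs_sub_half_le {x : ℝ} (hx : x ∈ Set.Icc (0 : ℝ) 1) : |x - 1 / 2| ≤ 1 / 2 := by
  rw [abs_le]; constructor <;> linarith [hx.1, hx.2]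

/-- Quantitative Jensen inequality for the entropy function. -/
theorem sq_cov_div_add_integral_negMulLog_le {β : Type*} [MeasurableSpace β] (m : Measure β)
    [IsProbabilityMeasure m] {v f : β → ℝ} (hv : Measurable v) (hf : Measurable f)
    (hv01 : ∀ y, v y ∈ Set.Icc (0 : ℝ) 1) (hf01 : ∀ y, f y ∈ Set.Icc (0 : ℝ) 1) :
    ((∫ y, v y * f y ∂m) - (∫ y, v y ∂m) * ∫ y, f y ∂m) ^ 2 / (∫ y, v y ∂m)
      + ∫ y, Real.negMulLog (v y) ∂m ≤ Real.negMulLog (∫ y, v y ∂m) := by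
  have hb : ∀ {w : β → ℝ}, Measurable w → (∀ y, w y ∈ Set.Icc (0 : ℝ) 1) → Integrable w m :=
    fun hw h => Integrable.of_mem_Icc 0 1 hw.aemeasurable (Filter.Eventually.of_forall h)
  have iv := hb hv hv01
  have iF := hb hf hf01
  have ivf : Integrable (fun y => v y * f y) m := hb (hv.mul hf) fun y =>
    ⟨mul_nonneg (hv01 y).1 (hf01 y).1, mul_le_one₀ (hv01 y).2 (hf01 y).1 (hf01 y).2⟩
  have hV0 : 0 ≤ ∫ y, v y ∂m := integral_nonneg fun y => (hv01 y).1
  rcases hV0.eq_or_lt with hV | hV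
  · have : v =ᵐ[m] 0 := (integral_eq_zero_iff_of_nonneg (fun y => (hv01 y).1) iv).1 hV.symm
    have h0 : ∫ y, Real.negMulLog (v y) ∂m = 0 := by
      rw [integral_congr_ae (g := fun _ => (0 : ℝ))]
      · simp
      · filter_upwards [this] with y hy
        simp [hy]
    rw [h0, ← hV]; simp
  set V := ∫ y, v y ∂m with hVdef
  set U := ∫ y, v y * f y ∂m with hUdef
  set W := ∫ y, f y ∂m with hWdef
  -- The minorant, taken at `r = v y / V` with test value `f y - 1 / 2` and scaled by `V`,
  -- integrates to `l (U - V W) - l² V / 4`. This `l` is the maximizer, and the maximum is `(U - V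
  -- W)² / V`. Shifting `f` by `1 / 2` costs nothing because `v / V - 1` has mean zero.
  set l := 2 * (U - V * W) / V with hl
  have key : ∀ y, Real.negMulLog (v y) ≤
      v y * (-Real.log V - 1 + l / 2 + l ^ 2 / 8) + -l * (v y * f y) + l * V * f y
        + (V - l * V / 2 + l ^ 2 * V / 8) := by
    intro y
    have hr : 0 ≤ v y / V := div_nonneg (hv01 y).1 hV.le
    have h1 := le_klFun_of_abs_le_half hr (abs_sub_half_le (hf01 y)) l
    -- The terms linear in `v` integrate to `negMulLog V`, so integrating this expression gives
    -- exactly the Jensen gap of `negMulLog`.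
    have h2 : V * InformationTheory.klFun (v y / V)
        = -Real.negMulLog (v y) - v y * Real.log V + V - v y := by
      rw [InformationTheory.klFun_apply, Real.negMulLog]
      rcases (hv01 y).1.eq_or_lt with h | h
      · rw [← h]; simp
      · rw [Real.log_div h.ne' hV.ne']; field_simp
    have h3 := mul_le_mul_of_nonneg_left h1 hV.le
    have h4 : V * (v y / V) = v y := by field_simp
    have h5 : V * (l * (f y - 1 / 2) * (v y / V - 1) - l ^ 2 * (v y / V + 1) / 8)
        = l * (f y - 1 / 2) * (V * (v y / V) - V) - l ^ 2 * (V * (v y / V) + V) / 8 := by ring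
    rw [h5, h4, h2] at h3
    linarith
  have hInt : ∫ y, Real.negMulLog (v y) ∂m ≤
      V * (-Real.log V - 1 + l / 2 + l ^ 2 / 8) + -l * U + l * V * W
        + (V - l * V / 2 + l ^ 2 * V / 8) := by
    have i1 := iv.mul_const (-Real.log V - 1 + l / 2 + l ^ 2 / 8)
    have i2 := ivf.const_mul (-l)
    have i3 := iF.const_mul (l * V)
    have := integral_mono_of_nonneg (Filter.Eventually.of_forall fun y =>
      Real.negMulLog_nonneg (hv01 y).1 (hv01 y).2)
      (((i1.add i2).add i3).add (integrable_const (V - l * V / 2 + l ^ 2 * V / 8)))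
      (Filter.Eventually.of_forall key)
    refine this.trans_eq ?_
    rw [integral_add' ((i1.add i2).add i3) (integrable_const _), integral_add' (i1.add i2) i3,
      integral_add' i1 i2, integral_mul_const, integral_const_mul, integral_const_mul]
    simp [hVdef, hUdef, hWdef]
  have hfin : V * (-Real.log V - 1 + l / 2 + l ^ 2 / 8) + -l * U + l * V * W
        + (V - l * V / 2 + l ^ 2 * V / 8) = Real.negMulLog V - (U - V * W) ^ 2 / V := by
    rw [Real.negMulLog, hl]; field_simp; ring
  linarith

/-- The information that a bounded statistic of the second coordinate carries about the event that
the first coordinate is `a`. -/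
theorem sq_cov_div_le_mutualInfo {β : Type*} [MeasurableSpace β] (ρ : Measure (ℕ × β))
    [IsProbabilityMeasure ρ] {f : β → ℝ} (hf : Measurable f)
    (hf01 : ∀ y, f y ∈ Set.Icc (0 : ℝ) 1) (a : ℕ) :
    ENNReal.ofReal (((∫ x in Prod.fst ⁻¹' {a}, f x.2 ∂ρ)
      - ρ.real (Prod.fst ⁻¹' {a}) * ∫ x, f x.2 ∂ρ) ^ 2 / ρ.real (Prod.fst ⁻¹' {a}))
      ≤ mutualInfo ρ := by
  unfold mutualInfo
  set ν := (ρ.map Prod.fst).prod (ρ.map Prod.snd) with hν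
  have : IsProbabilityMeasure (ρ.map Prod.fst) := Measure.isProbabilityMeasure_map (by fun_prop)
  have : IsProbabilityMeasure (ρ.map Prod.snd) := Measure.isProbabilityMeasure_map (by fun_prop)
  have : IsProbabilityMeasure ν := by rw [hν]; infer_instance
  by_cases hac : ρ ≪ ν
  swap
  · rw [InformationTheory.klDiv_of_not_ac hac]; exact le_top
  set S : Set (ℕ × β) := Prod.fst ⁻¹' {a} with hS
  have hSm : MeasurableSet S := measurable_fst (measurableSet_singleton a)
  set V := ρ.real S with hV
  set U := ∫ x in S, f x.2 ∂ρ with hU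
  set W := ∫ x, f x.2 ∂ρ with hW
  rcases (show 0 ≤ V from measureReal_nonneg).eq_or_lt with hV0 | hV0
  · rw [← hV0]; simp
  rw [InformationTheory.klDiv_eq_lintegral_klFun_of_ac hac]
  -- The same maximizer as in the Jensen estimate: on the slice `S` the density `r` and the constant
  -- 1 both have `ν`-mass `V`.
  set l := 2 * (U - V * W) / V with hl
  set r : ℕ × β → ℝ := fun x => (ρ.rnDeriv ν x).toReal with hr
  have ir : Integrable r ν := Measure.integrable_toReal_rnDeriv
  have hb : ∀ (m : Measure (ℕ × β)) [IsProbabilityMeasure m] (c : ℝ),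
      Integrable (fun x : ℕ × β => S.indicator (fun x => f x.2 - c) x) m := by
    intro m _ c
    refine Integrable.indicator ?_ hSm
    refine (Integrable.of_mem_Icc 0 1 (by fun_prop) ?_).sub (integrable_const c)
    exact Filter.Eventually.of_forall fun x => hf01 x.2
  -- Only the slice `S` is tested. Off `S` the minorant is replaced by 0, which is allowed since
  -- `klFun` is nonnegative.
  set G : ℕ × β → ℝ := S.indicator (fun x => f x.2 - 1 / 2) with hG
  have iG := hb ν (1 / 2)
  have irG : Integrable (fun x => r x * G x) ν := by
    refine ir.mul_bdd (c := 1 / 2) (iG.aestronglyMeasurable) ?_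
    refine Filter.Eventually.of_forall fun x => ?_
    rw [hG]
    by_cases hx : x ∈ S
    · rw [Set.indicator_of_mem hx]; exact abs_sub_half_le (hf01 x.2)
    · rw [Set.indicator_of_notMem hx]; simp
  have irS : Integrable (S.indicator r) ν := ir.indicator hSm
  have i1S : Integrable (S.indicator fun _ => (1 : ℝ)) ν := (integrable_const _).indicator hSm
  have e1 : ∫ x, r x * G x ∂ν = U - V / 2 := by
    have := integral_rnDeriv_smul (E := ℝ) hac (f := G)
    simp only [smul_eq_mul] at this
    rw [hr, this, hG, integral_indicator hSm, integral_sub, ← hU]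
    · simp [hV]; ring
    · exact (Integrable.of_mem_Icc 0 1 (by fun_prop)
        (Filter.Eventually.of_forall fun x => hf01 x.2))
    · exact integrable_const _
  have e2 : ∫ x, S.indicator r x ∂ν = V := by
    rw [integral_indicator hSm, hr, Measure.setIntegral_toReal_rnDeriv hac]
  have hνS : ν.real S = V := by
    have : S = {a} ×ˢ Set.univ := by ext ⟨x, y⟩; simp [hS]
    rw [measureReal_def, this, hν, Measure.prod_prod, Measure.map_apply measurable_fst
      (measurableSet_singleton a)]
    simp [hV, hS, measureReal_def]
  have e3 : ∫ x, S.indicator (fun _ => (1 : ℝ)) x ∂ν = V := by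
    rw [integral_indicator hSm]; simp [hνS]
  have e4 : ∫ x, G x ∂ν = V * W - V / 2 := by
    have hGp : G = fun x => (({a} : Set ℕ).indicator (fun _ => (1 : ℝ)) x.1) * (f x.2 - 1 / 2) := by
      funext x
      by_cases hx : x.1 = a <;> simp [hG, hS, hx]
    rw [hGp, hν, integral_prod_mul (f := ({a} : Set ℕ).indicator fun _ => (1 : ℝ))
      (g := fun y => f y - 1 / 2)]
    rw [integral_indicator (measurableSet_singleton a), integral_map (by fun_prop)
      (by fun_prop), integral_sub]
    · simp only [integral_const, MeasurableSet.univ, measureReal_restrict_apply, Set.univ_inter,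
        smul_eq_mul, mul_one, probReal_univ, one_mul]
      rw [map_measureReal_apply measurable_fst (measurableSet_singleton a)]
      rw [← hS, ← hV, ← hW]; ring
    · exact (Integrable.of_mem_Icc 0 1 (by fun_prop)
        (Filter.Eventually.of_forall fun x => hf01 x.2))
    · exact integrable_const _
  set T : ℕ × β → ℝ := fun x => l * (r x * G x) - l * G x - l ^ 2 / 8 * S.indicator r x
    - l ^ 2 / 8 * S.indicator (fun _ => (1 : ℝ)) x with hT
  have iT : Integrable T ν :=
    (((irG.const_mul l).sub (iG.const_mul l)).sub (irS.const_mul _)).sub (i1S.const_mul _)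
  have eT : ∫ x, T x ∂ν = (U - V * W) ^ 2 / V := by
    have j1 : Integrable (fun x => l * (r x * G x) - l * G x) ν :=
      (irG.const_mul l).sub (iG.const_mul l)
    have j2 : Integrable (fun x => l * (r x * G x) - l * G x - l ^ 2 / 8 * S.indicator r x) ν :=
      j1.sub (irS.const_mul _)
    rw [hT, integral_sub j2 (i1S.const_mul _), integral_sub j1 (irS.const_mul _),
      integral_sub (irG.const_mul l) (iG.const_mul l)]
    simp only [integral_const_mul]
    rw [e1, e2, e3, e4, hl]; field_simp; ring
  rw [← eT]
  have hle : ∀ x, T x ≤ InformationTheory.klFun (r x) := by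
    intro x
    have hr0 : 0 ≤ r x := ENNReal.toReal_nonneg
    by_cases hx : x ∈ S
    · have h1 := le_klFun_of_abs_le_half hr0 (abs_sub_half_le (hf01 x.2)) l
      simp only [hT, hG, Set.indicator_of_mem hx]
      linarith
    · simp only [hT, hG, Set.indicator_of_notMem hx]
      simpa using InformationTheory.klFun_nonneg hr0
  -- `T` may be negative, so its positive part is inserted before passing to the lower integral that
  -- defines the divergence.
  calc ENNReal.ofReal (∫ x, T x ∂ν) ≤ ENNReal.ofReal (∫ x, max (T x) 0 ∂ν) := by
        apply ENNReal.ofReal_le_ofReal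
        exact integral_mono iT iT.pos_part fun x => le_max_left _ _
    _ = ∫⁻ x, ENNReal.ofReal (max (T x) 0) ∂ν :=
        ofReal_integral_eq_lintegral_ofReal iT.pos_part
          (Filter.Eventually.of_forall fun x => le_max_right _ _)
    _ ≤ ∫⁻ x, ENNReal.ofReal (InformationTheory.klFun (r x)) ∂ν := by
        refine lintegral_mono fun x => ENNReal.ofReal_le_ofReal (max_le (hle x) ?_)
        exact InformationTheory.klFun_nonneg ENNReal.toReal_nonneg

end RealAnalysis

/-! ### Geometric entropy, harmonic decay, discounted sums and the soft-O estimate. -/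

section Bounds

/-- The entropy of a geometric distribution. -/
theorem tsum_negMulLog_geometric_le {p : ℝ} (hp0 : 0 < p) (hp1 : p ≤ 1) :
    ∑' n : ℕ, ENNReal.ofReal (Real.negMulLog (p * (1 - p) ^ n))
      ≤ ENNReal.ofReal (1 + Real.log (1 / p)) := by
  set s := 1 - p with hs
  have hs0 : 0 ≤ s := by linarith
  have hs1 : s < 1 := by linarith
  have hterm : ∀ n : ℕ, Real.negMulLog (p * s ^ n)
      = (-p * Real.log p) * s ^ n + (-p * Real.log s) * (n * s ^ n) := by
    intro n
    rcases hs0.eq_or_lt with h | h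
    · rw [← h]
      rcases n with _ | n <;> simp [Real.negMulLog]
    · rw [Real.negMulLog, Real.log_mul hp0.ne' (pow_pos h n).ne', Real.log_pow]; ring
  have h1 := (hasSum_geometric_of_lt_one hs0 hs1).mul_left (-p * Real.log p)
  have h2 := (hasSum_coe_mul_geometric_of_norm_lt_one (𝕜 := ℝ) (r := s)
    (by rw [Real.norm_of_nonneg hs0]; exact hs1)).mul_left (-p * Real.log s)
  have hsum := h1.add h2
  simp_rw [← hterm] at hsum
  have hnn : ∀ n : ℕ, 0 ≤ Real.negMulLog (p * s ^ n) := fun n =>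
    Real.negMulLog_nonneg (mul_nonneg hp0.le (pow_nonneg hs0 n))
      (mul_le_one₀ hp1 (pow_nonneg hs0 n) (pow_le_one₀ hs0 hs1.le))
  rw [← ENNReal.ofReal_tsum_of_nonneg hnn hsum.summable, hsum.tsum_eq]
  apply ENNReal.ofReal_le_ofReal
  have hsp : 1 - s = p := by linarith
  rw [hsp, one_div, Real.log_inv]
  have e1 : -p * Real.log p * p⁻¹ = -Real.log p := by field_simp
  -- The entropy equals `-log p - s log s / p`, and `log s ≥ 1 - 1 / s` gives `-s log s ≤ 1 - s =
  -- p`.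
  have e2 : -p * Real.log s * (s / p ^ 2) ≤ 1 := by
    rcases hs0.eq_or_lt with h | h
    · rw [← h]; simp
    have := Real.one_sub_inv_le_log_of_pos h
    have h3 : -p * Real.log s * (s / p ^ 2) = -(s * Real.log s) / p := by field_simp
    rw [h3, div_le_one hp0]
    have h4 := mul_le_mul_of_nonneg_left this hs0
    rw [mul_sub, mul_inv_cancel₀ h.ne'] at h4
    linarith
  linarith

/-- A sequence with quadratic decrements decays harmonically. -/
theorem le_one_div_of_sq_decrement {x : ℕ → ℝ} {p : ℝ} (hp0 : 0 ≤ p) (hx0 : x 0 ≤ 1)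
    (hx : ∀ t, 0 ≤ x t) (hstep : ∀ t, x (t + 1) ≤ x t - p * x t ^ 2) (t : ℕ) :
    x t ≤ 1 / (1 + p * t) := by
  induction t with
  | zero => simpa using hx0
  | succ t ih =>
    have ht : (0 : ℝ) ≤ t := Nat.cast_nonneg t
    have hd : 0 < 1 + p * t := by positivity
    rw [le_div_iff₀ (by positivity)]
    rw [le_div_iff₀ hd] at ih
    push_cast
    have h1 := hstep t
    have h2 : 0 ≤ 1 + p * (t + 1) := by positivity
    have h3 := mul_le_mul_of_nonneg_right h1 h2
    have hp : 0 ≤ p * x t := mul_nonneg hp0 (hx t)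
    -- With `u = p * x t`, the factorization and the induction hypothesis bound the product by `(1 -
    -- u)(1 + u) ≤ 1` when `u ≤ 1`. When `u > 1` the first factor is negative and the second is not.
    have h4 : (x t - p * x t ^ 2) * (1 + p * (t + 1)) ≤ 1 := by
      have e : (x t - p * x t ^ 2) * (1 + p * (t + 1))
        = (1 - p * x t) * (x t * (1 + p * t) + p * x t) := by ring
      rw [e]
      rcases le_total (p * x t) 1 with h | h
      · nlinarith
      · have : 0 ≤ x t * (1 + p * t) + p * x t := by have := hx t; positivity
        nlinarith
    linarith

/-- Abel summation for geometrically weighted partial sums. -/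
theorem tsum_pow_mul_sum_range_eq {b : ℝ} (hb0 : 0 ≤ b) (hb1 : b < 1) (y : ℕ → ℝ≥0∞) :
    ENNReal.ofReal (1 - b) * ∑' t : ℕ, ENNReal.ofReal (b ^ t) * ∑ s ∈ Finset.range t, y s
      = ∑' s : ℕ, ENNReal.ofReal (b ^ (s + 1)) * y s := by
  have h1 : ∀ t : ℕ, ENNReal.ofReal (b ^ t) * ∑ s ∈ Finset.range t, y s
      = ∑' s : ℕ, if s < t then ENNReal.ofReal (b ^ t) * y s else 0 := by
    intro t
    rw [tsum_eq_sum (s := Finset.range t) (by intro s hs; simp at hs; simp [hs]), Finset.mul_sum]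
    exact Finset.sum_congr rfl fun s hs => by simp [Finset.mem_range.1 hs]
  simp_rw [h1]
  -- After the exchange, `y s` is weighted by the tail over `t ≥ s + 1`, which is `b ^ (s + 1) / (1
  -- - b)`; the prefactor cancels the denominator.
  rw [ENNReal.tsum_comm, ← ENNReal.tsum_mul_left]
  congr 1 with s
  have h2 : ∑' t : ℕ, (if s < t then ENNReal.ofReal (b ^ t) * y s else 0)
      = ∑' n : ℕ, ENNReal.ofReal (b ^ (n + (s + 1))) * y s := by
    rw [← Summable.sum_add_tsum_nat_add' (k := s + 1) ENNReal.summable]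
    rw [Finset.sum_eq_zero, zero_add]
    · congr 1 with n
      rw [if_pos (by omega)]
    · intro t ht
      rw [if_neg]; have := Finset.mem_range.1 ht; omega
  rw [h2, ENNReal.tsum_mul_right, ← mul_assoc]
  congr 1
  simp_rw [pow_add b _ (s + 1), ENNReal.ofReal_mul (pow_nonneg hb0 _)]
  rw [ENNReal.tsum_mul_right, ← ENNReal.ofReal_tsum_of_nonneg (fun n => pow_nonneg hb0 n)
    (summable_geometric_of_lt_one hb0 hb1), tsum_geometric_of_lt_one hb0 hb1, ← mul_assoc,
    ← ENNReal.ofReal_mul (by linarith), mul_inv_cancel₀ (by linarith), ENNReal.ofReal_one, one_mul]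

/-- The series `∑ b ^ (s + 1) / (s + 1)` is the expansion of `-log (1 - b)`. This is the source of
the logarithm in the bound on the information ratio. -/
theorem tsum_pow_mul_harmonic_le {b δ : ℝ} (hb0 : 0 ≤ b) (hb1 : b < 1) (hδ : 0 < δ)
    {y : ℕ → ℝ≥0∞} (hy : ∀ s : ℕ, y s ≤ ENNReal.ofReal (1 / (δ * (s + 1)))) :
    ∑' s : ℕ, ENNReal.ofReal (b ^ (s + 1)) * y s
      ≤ ENNReal.ofReal (1 / δ * Real.log (1 / (1 - b))) := by
  have hlog := (Real.hasSum_pow_div_log_of_abs_lt_one (x := b)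
    (by rw [abs_of_nonneg hb0]; exact hb1)).mul_left (1 / δ)
  have hnn : ∀ s : ℕ, 0 ≤ 1 / δ * (b ^ (s + 1) / ((s : ℝ) + 1)) := fun s => by positivity
  calc ∑' s : ℕ, ENNReal.ofReal (b ^ (s + 1)) * y s
      ≤ ∑' s : ℕ, ENNReal.ofReal (1 / δ * (b ^ (s + 1) / ((s : ℝ) + 1))) := by
        refine ENNReal.tsum_le_tsum fun s => ?_
        refine (mul_le_mul_right (hy s) _).trans_eq ?_
        rw [← ENNReal.ofReal_mul (by positivity)]
        congr 1; field_simp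
    _ = ENNReal.ofReal (1 / δ * Real.log (1 / (1 - b))) := by
        rw [← ENNReal.ofReal_tsum_of_nonneg hnn hlog.summable, hlog.tsum_eq, one_div (1 - b),
          Real.log_inv]

/-- Since `δ ≤ 1` and `δ ≤ p`, one has `δ (s + 1) ≤ 1 + p s`. It puts the decay with rate `p` into
the harmonic form in `δ`. -/
theorem one_div_one_add_mul_le {δ p : ℝ} (hδ : 0 < δ) (hδ1 : δ ≤ 1) (hp : δ ≤ p) (s : ℕ) :
    1 / (1 + p * s) ≤ 1 / (δ * (s + 1)) := by
  have hs : (0 : ℝ) ≤ s := Nat.cast_nonneg s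
  apply one_div_le_one_div_of_le (by positivity)
  nlinarith

theorem ratioBound_le {B l : ℝ} (hB : 1 ≤ B) (hl : 0 ≤ l) :
    6 + 4 * B + 2 * B * l ≤ 10 * B * (1 + l) := by nlinarith

/-- Put `B = 1 / δ`, `L = 1 / (1 - α²)` and `y = √(B L) ≥ 1`. The ratio bound is at most `10 B (1 +
log L)`, and `(1 + log L)(1 + log B) ≤ (1 + 2 log y)²` because `log B + log L = 2 log y`; so the
square root is at most `4 y (1 + 2 log y)`. Since `1 ≤ y ≤ g` for the comparison function `g`, the
total is at most `5 g + 8 g log g`, which the constant 9 with first power of the logarithm covers.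
-/
theorem isSoftO_regretBound : IsSoftO
      {p : ℝ × ℝ × ℝ | p.1 ∈ Set.Ioo (0 : ℝ) 1 ∧ p.2.1 ∈ Set.Ioc (0 : ℝ) 1 ∧
        p.2.2 ∈ Set.Ico (0 : ℝ) 1}
      (fun p => regretBound p.1 p.2.1 p.2.2)
      (fun p => p.1 / (1 - p.2.2) + Real.sqrt ((1 / p.2.1) / (1 - p.2.2 ^ 2))) := by
  refine ⟨9, 1, ?_⟩
  rintro ⟨ε, δ, α⟩ ⟨hε, hδ, hα⟩
  simp only at hε hδ hα ⊢
  have h1α : 0 < 1 - α := by linarith [hα.2]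
  have h1α2 : 0 < 1 - α ^ 2 := by nlinarith [hα.1, hα.2]
  set B := 1 / δ with hB
  set L := 1 / (1 - α ^ 2) with hL
  have hB1 : 1 ≤ B := by rw [hB, le_div_iff₀ hδ.1]; linarith [hδ.2]
  have hL1 : 1 ≤ L := by rw [hL, le_div_iff₀ h1α2]; nlinarith [hα.1]
  have hlB : 0 ≤ Real.log B := Real.log_nonneg hB1
  have hlL : 0 ≤ Real.log L := Real.log_nonneg hL1
  set e := ε / (1 - α) with he
  have he0 : 0 ≤ e := div_nonneg hε.1.le h1α.le
  have hBL : B / (1 - α ^ 2) = B * L := by rw [hL]; ring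
  rw [hBL]
  set y := √(B * L) with hy
  have hBL1 : 1 ≤ B * L := one_le_mul_of_one_le_of_one_le hB1 hL1
  have hy1 : 1 ≤ y := Real.one_le_sqrt.2 hBL1
  have hgy : y ≤ e + y := by linarith
  have hlogy : Real.log (B * L) = 2 * Real.log y := by
    rw [hy, Real.log_sqrt (by linarith)]; ring
  have hlogg : Real.log y ≤ Real.log (e + y) := Real.log_le_log (by linarith) hgy
  have hly : 0 ≤ Real.log y := Real.log_nonneg hy1
  have hlogBL : Real.log B + Real.log L = 2 * Real.log y := by
    rw [← hlogy, Real.log_mul (by linarith) (by linarith)]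
  have hreg : regretBound ε δ α = e + √((6 + 4 * B + 2 * B * Real.log L) * (1 + Real.log B) * L) := by
    rw [regretBound, ratioBound, hL, hB]
    congr 2; ring
  have hsq : √((6 + 4 * B + 2 * B * Real.log L) * (1 + Real.log B) * L)
      ≤ 4 * y * (1 + 2 * Real.log y) := by
    rw [Real.sqrt_le_left (by positivity)]
    have hyy : y ^ 2 = B * L := Real.sq_sqrt (by linarith)
    have h1 : (6 + 4 * B + 2 * B * Real.log L) * (1 + Real.log B) * L
        ≤ (10 * B * (1 + Real.log L)) * (1 + Real.log B) * L := by
      gcongr; exact ratioBound_le hB1 hlL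
    have h2 : (1 + Real.log L) * (1 + Real.log B) ≤ (1 + 2 * Real.log y) ^ 2 := by
      rw [← hlogBL]; nlinarith [mul_nonneg hlB hlL]
    calc _ ≤ (10 * B * (1 + Real.log L)) * (1 + Real.log B) * L := h1
      _ = 10 * (B * L) * ((1 + Real.log L) * (1 + Real.log B)) := by ring
      _ ≤ 16 * (B * L) * (1 + 2 * Real.log y) ^ 2 := by gcongr; norm_num
      _ = (4 * y * (1 + 2 * Real.log y)) ^ 2 := by rw [← hyy]; ring
  have hlg : 0 ≤ Real.log (e + y) := hly.trans hlogg
  rw [hreg, abs_of_nonneg (add_nonneg he0 (Real.sqrt_nonneg _)), abs_of_nonneg (by linarith),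
    abs_of_nonneg hlg, pow_one]
  calc e + √((6 + 4 * B + 2 * B * Real.log L) * (1 + Real.log B) * L)
      ≤ (e + y) + 4 * (e + y) * (1 + 2 * Real.log (e + y)) := by
        refine add_le_add (by linarith) (hsq.trans ?_)
        gcongr
    _ ≤ 9 * ((e + y) * (1 + Real.log (e + y))) := by
        have : 0 ≤ (e + y) * Real.log (e + y) := mul_nonneg (by linarith) hlg
        nlinarith

end Bounds

/-! ### Uniqueness and disintegration tools for conditional laws. -/

section Measurability

theorem measurable_eval_nat {E : Type*} [MeasurableSpace E] :
    Measurable fun q : (ℕ → E) × ℕ => q.1 q.2 :=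
  measurable_from_prod_countable_left fun n => measurable_pi_apply n

theorem _root_.Measurable.eval_nat {Ω E : Type*} [MeasurableSpace Ω] [MeasurableSpace E]
    {x : Ω → ℕ → E} {n : Ω → ℕ} (hx : Measurable x) (hn : Measurable n) :
    Measurable fun ω => x ω (n ω) :=
  measurable_eval_nat.comp (hx.prodMk hn)

/-- Two weights that agree on rectangles agree on all functions of a pair. -/
theorem lintegral_mul_eq_of_rectangles {Ω E F : Type*} [MeasurableSpace Ω] [MeasurableSpace E]
    [MeasurableSpace F] {P : Measure Ω} {U : Ω → E} {Z : Ω → F} (hU : Measurable U)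
    (hZ : Measurable Z) {w₁ w₂ : Ω → ℝ≥0∞} (hw₁ : Measurable w₁) (hw₂ : Measurable w₂)
    (hfin : ∫⁻ ω, w₁ ω ∂P ≠ ∞)
    (h : ∀ D T, MeasurableSet D → MeasurableSet T →
      ∫⁻ ω in U ⁻¹' D ∩ Z ⁻¹' T, w₁ ω ∂P = ∫⁻ ω in U ⁻¹' D ∩ Z ⁻¹' T, w₂ ω ∂P)
    {f : E × F → ℝ≥0∞} (hf : Measurable f) :
    ∫⁻ ω, f (U ω, Z ω) * w₁ ω ∂P = ∫⁻ ω, f (U ω, Z ω) * w₂ ω ∂P := by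
  have hUZ : Measurable fun ω => (U ω, Z ω) := hU.prodMk hZ
  have hfin' : IsFiniteMeasure ((P.withDensity w₁).map fun ω => (U ω, Z ω)) := by
    have : IsFiniteMeasure (P.withDensity w₁) := isFiniteMeasure_withDensity hfin
    infer_instance
  have key : (P.withDensity w₁).map (fun ω => (U ω, Z ω))
      = (P.withDensity w₂).map fun ω => (U ω, Z ω) := by
    refine Measure.ext_prod fun {D T} hD hT => ?_
    have hpre : (fun ω => (U ω, Z ω)) ⁻¹' (D ×ˢ T) = U ⁻¹' D ∩ Z ⁻¹' T := rfl
    rw [Measure.map_apply hUZ (hD.prod hT), Measure.map_apply hUZ (hD.prod hT), hpre,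
      withDensity_apply _ ((hU hD).inter (hZ hT)), withDensity_apply _ ((hU hD).inter (hZ hT)),
      h D T hD hT]
  have e : ∀ {w : Ω → ℝ≥0∞}, Measurable w → ∫⁻ ω, f (U ω, Z ω) * w ω ∂P
      = ∫⁻ q, f q ∂((P.withDensity w).map fun ω => (U ω, Z ω)) := by
    intro w hw
    rw [lintegral_map hf hUZ]
    refine Eq.trans ?_ (lintegral_withDensity_eq_lintegral_mul _ hw (hf.comp hUZ)).symm
    simp [mul_comm]
  rw [e hw₁, e hw₂, key]

theorem lintegral_condDistrib {Ω E F : Type*} [MeasurableSpace Ω] [MeasurableSpace E]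
    [MeasurableSpace F] [StandardBorelSpace F] [Nonempty F] {P : Measure Ω} [IsFiniteMeasure P]
    {U : Ω → E} {Z : Ω → F} (hU : Measurable U) (hZ : Measurable Z) {f : E × F → ℝ≥0∞}
    (hf : Measurable f) :
    ∫⁻ ω, f (U ω, Z ω) ∂P = ∫⁻ ω, ∫⁻ z, f (U ω, z) ∂(condDistrib Z U P (U ω)) ∂P := by
  rw [← lintegral_map hf (hU.prodMk hZ), ← compProd_map_condDistrib hZ.aemeasurable,
    Measure.lintegral_compProd hf, lintegral_map hf.lintegral_kernel_prod_right' hU]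

/-- Identification of an integral against a conditional distribution. -/
theorem ae_map_lintegral_condDistrib_eq {Ω E F : Type*} [MeasurableSpace Ω] [MeasurableSpace E]
    [MeasurableSpace F] [StandardBorelSpace F] [Nonempty F] {P : Measure Ω} [IsFiniteMeasure P]
    {U : Ω → E} {Z : Ω → F} (hU : Measurable U) (hZ : Measurable Z) {f : E × F → ℝ≥0∞}
    (hf : Measurable f) {w : E → ℝ≥0∞} (hw : Measurable w)
    (h : ∀ D, MeasurableSet D →
      ∫⁻ ω in U ⁻¹' D, f (U ω, Z ω) ∂P = ∫⁻ ω in U ⁻¹' D, w (U ω) ∂P) :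
    ∀ᵐ u ∂(P.map U), ∫⁻ z, f (u, z) ∂(condDistrib Z U P u) = w u := by
  have hm : Measurable fun u => ∫⁻ z, f (u, z) ∂(condDistrib Z U P u) :=
    hf.lintegral_kernel_prod_right'
  refine ae_eq_of_forall_setLIntegral_eq_of_sigmaFinite (μ := P.map U) hm hw fun D hD _ => ?_
  rw [setLIntegral_map hD hm hU, setLIntegral_map hD hw hU, ← h D hD]
  have := lintegral_condDistrib (P := P) hU hZ
    (f := fun q => D.indicator (fun _ => (1 : ℝ≥0∞)) q.1 * f q)
    (((measurable_const.indicator hD).comp measurable_fst).mul hf)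
  rw [← lintegral_indicator (hU hD), ← lintegral_indicator (hU hD)]
  refine Eq.trans (lintegral_congr fun ω => ?_)
    (this.symm.trans (lintegral_congr fun ω => ?_))
  · by_cases hω : U ω ∈ D <;> simp [hω]
  · by_cases hω : U ω ∈ D <;> simp [hω]

theorem ae_lintegral_condDistrib_eq {Ω E F : Type*} [MeasurableSpace Ω] [MeasurableSpace E]
    [MeasurableSpace F] [StandardBorelSpace F] [Nonempty F] {P : Measure Ω} [IsFiniteMeasure P]
    {U : Ω → E} {Z : Ω → F} (hU : Measurable U) (hZ : Measurable Z) {f : E × F → ℝ≥0∞}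
    (hf : Measurable f) {w : E → ℝ≥0∞} (hw : Measurable w)
    (h : ∀ D, MeasurableSet D →
      ∫⁻ ω in U ⁻¹' D, f (U ω, Z ω) ∂P = ∫⁻ ω in U ⁻¹' D, w (U ω) ∂P) :
    ∀ᵐ ω ∂P, ∫⁻ z, f (U ω, z) ∂(condDistrib Z U P (U ω)) = w (U ω) :=
  ae_of_ae_map hU.aemeasurable (ae_map_lintegral_condDistrib_eq hU hZ hf hw h)

end Measurability

/-! ### Events on parameters attached to a history. -/

section Histories

variable {𝒴 : Type*} {t : ℕ}

/-- The arms occurring in a history. -/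
def arms (h : Fin t → ℕ × 𝒴) : Finset ℕ := Finset.univ.image fun i => (h i).1

/-- The parameters under which no arm of the history reaches the level `c`. -/
def allBad (c : ℝ) (h : Fin t → ℕ × 𝒴) : Set (ℕ → ℝ) := {x | ∀ i, x (h i).1 < c}

/-- The parameters under which `a` is the earliest arm of the history that reaches the
level `c`. -/
def firstGood (c : ℝ) (h : Fin t → ℕ × 𝒴) (a : ℕ) : Set (ℕ → ℝ) :=
  {x | ∃ i, (h i).1 = a ∧ c ≤ x (h i).1 ∧ ∀ j < i, x (h j).1 < c}

theorem mem_arms {h : Fin t → ℕ × 𝒴} {a : ℕ} : a ∈ arms h ↔ ∃ i, (h i).1 = a := by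
  simp [arms]

theorem mem_arms_of_mem_firstGood {c : ℝ} {h : Fin t → ℕ × 𝒴} {a : ℕ} {x : ℕ → ℝ}
    (hx : x ∈ firstGood c h a) : a ∈ arms h := by
  obtain ⟨i, hi, -⟩ := hx
  exact mem_arms.2 ⟨i, hi⟩

theorem notMem_allBad_of_mem_firstGood {c : ℝ} {h : Fin t → ℕ × 𝒴} {a : ℕ} {x : ℕ → ℝ}
    (hx : x ∈ firstGood c h a) : x ∉ allBad c h := by
  obtain ⟨i, -, hi, -⟩ := hx
  exact fun hb => absurd (hb i) (not_lt.2 hi)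

theorem eq_of_mem_firstGood {c : ℝ} {h : Fin t → ℕ × 𝒴} {a b : ℕ} {x : ℕ → ℝ}
    (ha : x ∈ firstGood c h a) (hb : x ∈ firstGood c h b) : a = b := by
  obtain ⟨i, hia, hi, hi'⟩ := ha
  obtain ⟨j, hjb, hj, hj'⟩ := hb
  rcases lt_trichotomy i j with hij | rfl | hij
  · exact absurd (hj' i hij) (not_lt.2 hi)
  · exact hia.symm.trans hjb
  · exact absurd (hi' j hij) (not_lt.2 hj)

theorem exists_mem_firstGood {c : ℝ} {h : Fin t → ℕ × 𝒴} {x : ℕ → ℝ} (hx : x ∉ allBad c h) :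
    ∃ a, x ∈ firstGood c h a := by
  have hex : ∃ i, c ≤ x (h i).1 := by simpa [allBad] using hx
  obtain ⟨i, hi, hmin⟩ := WellFounded.has_min (wellFounded_lt (α := Fin t))
    {i | c ≤ x (h i).1} hex
  exact ⟨(h i).1, i, rfl, hi, fun j hj => not_le.1 fun hc => hmin j hc hj⟩

variable [MeasurableSpace 𝒴]

theorem measurable_arms : Measurable (fun h : Fin t → ℕ × 𝒴 => fun i => (h i).1) := by
  fun_prop

theorem measurable_of_arms {E : Type*} [MeasurableSpace E] (φ : Finset ℕ → E) :
    Measurable fun h : Fin t → ℕ × 𝒴 => φ (arms h) := by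
  have : Measurable fun v : Fin t → ℕ => φ (Finset.univ.image v) := measurable_of_countable _
  exact this.comp measurable_arms

theorem measurableSet_mem_arms (a : ℕ) : MeasurableSet {h : Fin t → ℕ × 𝒴 | a ∈ arms h} :=
  measurableSet_setOfPred.2 (measurable_of_arms fun s => a ∈ s)

theorem measurable_param_arm (i : Fin t) :
    Measurable fun q : (Fin t → ℕ × 𝒴) × (ℕ → ℝ) => q.2 (q.1 i).1 :=
  Measurable.eval_nat (by fun_prop) (by fun_prop)

theorem measurableSet_allBad (c : ℝ) :
    MeasurableSet {q : (Fin t → ℕ × 𝒴) × (ℕ → ℝ) | q.2 ∈ allBad c q.1} := by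
  have : {q : (Fin t → ℕ × 𝒴) × (ℕ → ℝ) | q.2 ∈ allBad c q.1}
      = ⋂ i, {q | q.2 (q.1 i).1 < c} := by ext; simp [allBad]
  rw [this]
  exact MeasurableSet.iInter fun i => measurableSet_lt (measurable_param_arm i) measurable_const

theorem measurableSet_firstGood (c : ℝ) (a : ℕ) :
    MeasurableSet {q : (Fin t → ℕ × 𝒴) × (ℕ → ℝ) | q.2 ∈ firstGood c q.1 a} := by
  have : {q : (Fin t → ℕ × 𝒴) × (ℕ → ℝ) | q.2 ∈ firstGood c q.1 a}
      = ⋃ i, {q | (q.1 i).1 = a} ∩ ({q | c ≤ q.2 (q.1 i).1} ∩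
        ⋂ j, ⋂ _ : j < i, {q | q.2 (q.1 j).1 < c}) := by ext; simp [firstGood]
  rw [this]
  refine MeasurableSet.iUnion fun i => MeasurableSet.inter ?_ (MeasurableSet.inter ?_ ?_)
  · exact measurableSet_eq_fun (by fun_prop) measurable_const
  · exact measurableSet_le measurable_const (measurable_param_arm i)
  · exact MeasurableSet.iInter fun j => MeasurableSet.iInter fun _ =>
      measurableSet_lt (measurable_param_arm j) measurable_const

theorem arms_snoc (h : Fin t → ℕ × 𝒴) (a : ℕ) (y : 𝒴) :
    arms (Fin.snoc (α := fun _ => ℕ × 𝒴) h (a, y)) = insert a (arms h) := by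
  ext b
  simp only [mem_arms, Finset.mem_insert]
  constructor
  · rintro ⟨i, hi⟩
    induction i using Fin.lastCases with
    | last => left; simpa using hi.symm
    | cast i => right; exact ⟨i, by simpa using hi⟩
  · rintro (rfl | ⟨i, hi⟩)
    · exact ⟨Fin.last t, by simp⟩
    · exact ⟨i.castSucc, by simpa using hi⟩

theorem mem_allBad_snoc {c : ℝ} {h : Fin t → ℕ × 𝒴} {a : ℕ} {y : 𝒴} {x : ℕ → ℝ} :
    x ∈ allBad c (Fin.snoc (α := fun _ => ℕ × 𝒴) h (a, y)) ↔ x ∈ allBad c h ∧ x a < c := by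
  constructor
  · intro hx
    exact ⟨fun i => by simpa using hx i.castSucc, by simpa using hx (Fin.last t)⟩
  · rintro ⟨h1, h2⟩ i
    induction i using Fin.lastCases with
    | last => simpa using h2
    | cast i => simpa using h1 i

theorem measurable_snoc :
    Measurable fun q : (Fin t → ℕ × 𝒴) × (ℕ × 𝒴) =>
      (Fin.snoc (α := fun _ => ℕ × 𝒴) q.1 q.2 : Fin (t + 1) → ℕ × 𝒴) := by
  refine measurable_pi_lambda _ fun i => ?_
  induction i using Fin.lastCases with
  | last => simpa using measurable_snd
  | cast i => simpa using (by fun_prop : Measurable fun q : (Fin t → ℕ × 𝒴) × (ℕ × 𝒴) => q.1 i)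

end Histories

/-! ### Measurability of the process and independence of future outcomes from the past. -/

section Dynamics

variable {Ω 𝒴 Ξ : Type*} [MeasurableSpace Ω] [MeasurableSpace 𝒴] [MeasurableSpace Ξ]
  {P : Measure Ω} {μ : Measure ℝ} {K : Kernel (ℕ → ℝ) (ℕ → 𝒴)} {R : 𝒴 → ℝ} {θ : Ω → ℕ → ℝ}
  {Y : ℕ∞ → Ω → ℕ → 𝒴} {ξ : Ω → Ξ} {ε : ℝ} {σ : Ξ → ℕ → ℕ}
  {g : (t : ℕ) → (Fin t → ℕ × 𝒴) × Ξ → ℕ → ℝ} {A : ℕ → Ω → ℕ}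

theorem sampledArms_eq (t : ℕ) (ω : Ω) : sampledArms A t ω = arms (history Y A t ω) := by
  ext a
  simp only [sampledArms, mem_arms, history, Finset.mem_image, Finset.mem_range]
  constructor
  · rintro ⟨s, hs, rfl⟩
    exact ⟨⟨s, hs⟩, rfl⟩
  · rintro ⟨i, rfl⟩
    exact ⟨i, i.2, rfl⟩

theorem history_succ (t : ℕ) (ω : Ω) :
    history Y A (t + 1) ω
      = Fin.snoc (α := fun _ => ℕ × 𝒴) (history Y A t ω) (A t ω, observed Y A t ω) := by
  funext i
  induction i using Fin.lastCases with
  | last => simp [history]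
  | cast i => simp [history]

theorem measurable_meanReward [IsSFiniteKernel K] (hR : Measurable R) (a : ℕ) :
    Measurable fun x => meanReward K R x a := by
  have : StronglyMeasurable fun q : (ℕ → ℝ) × (ℕ → 𝒴) => R (q.2 a) :=
    (hR.comp ((measurable_pi_apply a).comp measurable_snd)).stronglyMeasurable
  exact this.integral_kernel_prod_right'.measurable

theorem measurable_optReward [IsSFiniteKernel K] (hR : Measurable R) :
    Measurable fun x => optReward K R x :=
  Measurable.iSup fun a => measurable_meanReward hR a

/-- The played arm is a measurable function of the history and of the exogenous variable. -/
theorem exists_policy [IsSFiniteKernel K] (hR : Measurable R)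
    (hA : IsSTS P K R θ Y ξ ε σ g A) (t : ℕ) :
    ∃ π : (Fin t → ℕ × 𝒴) × Ξ → ℕ, Measurable π ∧
      ∀ ω, A t ω = π (history Y A t ω, ξ ω) := by
  set sat : (Fin t → ℕ × 𝒴) × Ξ → Fin t → Prop := fun q i =>
    optReward K R (g t q) ≤ meanReward K R (g t q) (q.1 i).1 + ε with hsat
  -- The rule is expressed as a relation with exactly one solution `a` for each `q`. A choice
  -- function then has the sets `{q | Q q a}` as fibres, and measurability can be checked on the
  -- relation.
  set Q : (Fin t → ℕ × 𝒴) × Ξ → ℕ → Prop := fun q a =>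
    (∃ i, sat q i ∧ (∀ j < i, ¬ sat q j) ∧ (q.1 i).1 = a) ∨
      ((∀ i, ¬ sat q i) ∧ σ q.2 (arms q.1).card = a) with hQ
  have hex : ∀ q, ∃ a, Q q a := by
    intro q
    by_cases h : ∃ i, sat q i
    · obtain ⟨i, hi, hmin⟩ := WellFounded.has_min (wellFounded_lt (α := Fin t)) {i | sat q i} h
      exact ⟨_, Or.inl ⟨i, hi, fun j hj hc => hmin j hc hj, rfl⟩⟩
    · push Not at h
      exact ⟨_, Or.inr ⟨h, rfl⟩⟩
  have huniq : ∀ q a b, Q q a → Q q b → a = b := by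
    rintro q a b (⟨i, hi, hi', hia⟩ | ⟨h, ha⟩) (⟨j, hj, hj', hjb⟩ | ⟨h', hb⟩)
    · rcases lt_trichotomy i j with hij | rfl | hij
      · exact absurd hi (hj' i hij)
      · exact hia.symm.trans hjb
      · exact absurd hj (hi' j hij)
    · exact absurd hi (h' i)
    · exact absurd hj (h j)
    · exact ha.symm.trans hb
  choose π hπ using hex
  refine ⟨π, ?_, ?_⟩
  · have hm : ∀ i, MeasurableSet {q : (Fin t → ℕ × 𝒴) × Ξ | sat q i} := by
      intro i
      have h1 : Measurable fun q : (Fin t → ℕ × 𝒴) × Ξ =>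
          meanReward K R (g t q) (q.1 i).1 :=
        (measurable_from_prod_countable_left (f := fun p : (ℕ → ℝ) × ℕ => meanReward K R p.1 p.2)
          fun n => measurable_meanReward hR n).comp
          ((hA.measurable_sample t).prodMk (by fun_prop))
      exact measurableSet_le ((measurable_optReward hR).comp (hA.measurable_sample t))
        (h1.add_const ε)
    refine measurable_to_countable' fun a => ?_
    have heq : π ⁻¹' {a} = {q | Q q a} := by
      ext q
      exact ⟨fun h => by rw [← (h : π q = a)]; exact hπ q, fun h => huniq q _ _ (hπ q) h⟩
    rw [heq]
    simp only [hQ, Set.ofPred_or, Set.ofPred_exists, Set.ofPred_and, Set.ofPred_forall]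
    refine MeasurableSet.union (MeasurableSet.iUnion fun i => ?_) (MeasurableSet.inter ?_ ?_)
    · refine (hm i).inter (MeasurableSet.inter ?_ ?_)
      · exact MeasurableSet.iInter fun j => MeasurableSet.iInter fun _ => (hm j).compl
      · exact measurableSet_eq_fun (by fun_prop) measurable_const
    · exact MeasurableSet.iInter fun j => (hm j).compl
    · refine measurableSet_eq_fun (Measurable.eval_nat ?_ ?_) measurable_const
      · exact hA.measurable_order.comp measurable_snd
      · exact (measurable_of_arms Finset.card).comp measurable_fst
  · intro ω
    refine huniq (history Y A t ω, ξ ω) _ _ ?_ (hπ _)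
    by_cases h : ∃ i, sat (history Y A t ω, ξ ω) i
    · obtain ⟨i, hi, hmin⟩ := WellFounded.has_min (wellFounded_lt (α := Fin t))
        {i | sat (history Y A t ω, ξ ω) i} h
      refine Or.inl ⟨i, hi, fun j hj hc => hmin j hc hj, ?_⟩
      exact (hA.play_satisficing t ω i i.2 hi
        fun j hj hc => hmin ⟨j, hj.trans i.2⟩ hc hj).symm
    · push Not at h
      refine Or.inr ⟨h, ?_⟩
      rw [← sampledArms_eq]
      exact (hA.play_new t ω fun k hk => h ⟨k, hk⟩).symm

theorem measurable_observed (hY : ∀ t, Measurable (Y t)) {t : ℕ} (h : Measurable (A t)) :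
    Measurable (observed Y A t) :=
  (hY t).eval_nat h

theorem measurable_history_of (hY : ∀ t, Measurable (Y t)) {t : ℕ}
    (h : ∀ s < t, Measurable (A s)) : Measurable (history Y A t) :=
  measurable_pi_lambda _ fun i => (h i i.2).prodMk (measurable_observed hY (h i i.2))

/-- Actions and histories refer to each other, hence strong induction: the action at time `t` is a
fixed measurable function of `ξ` and of a history that contains only earlier actions. -/
theorem measurable_action [IsSFiniteKernel K] (hB : IsNoisyBandit P μ K R θ Y)
    (hA : IsSTS P K R θ Y ξ ε σ g A) (t : ℕ) : Measurable (A t) := by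
  induction t using Nat.strong_induction_on with
  | _ t ih =>
    obtain ⟨π, hπ, hAπ⟩ := exists_policy hB.measurable_reward hA t
    have : A t = fun ω => π (history Y A t ω, ξ ω) := funext hAπ
    rw [this]
    exact hπ.comp ((measurable_history_of hB.measurable_outcome ih).prodMk hA.measurable_exo)

theorem measurable_history [IsSFiniteKernel K] (hB : IsNoisyBandit P μ K R θ Y)
    (hA : IsSTS P K R θ Y ξ ε σ g A) (t : ℕ) : Measurable (history Y A t) :=
  measurable_history_of hB.measurable_outcome fun s _ => measurable_action hB hA s

/-- The history, the exogenous variable and the parameter. -/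
def fullState (Y : ℕ∞ → Ω → ℕ → 𝒴) (A : ℕ → Ω → ℕ) (ξ : Ω → Ξ) (θ : Ω → ℕ → ℝ) (t : ℕ) (ω : Ω) :
    ((Fin t → ℕ × 𝒴) × Ξ) × (ℕ → ℝ) :=
  ((history Y A t ω, ξ ω), θ ω)

theorem measurable_fullState [IsSFiniteKernel K] (hB : IsNoisyBandit P μ K R θ Y)
    (hA : IsSTS P K R θ Y ξ ε σ g A) (t : ℕ) : Measurable (fullState Y A ξ θ t) :=
  ((measurable_history hB hA t).prodMk hA.measurable_exo).prodMk hB.measurable_param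

theorem measurable_prod_kernel (s : Finset ℕ∞) {S : ℕ∞ → Set (ℕ → 𝒴)}
    (hS : ∀ r, MeasurableSet (S r)) : Measurable fun x => ∏ r ∈ s, K x (S r) :=
  Finset.measurable_prod _ fun r _ => K.measurable_coe (hS r)

theorem measurable_prod_indicator (hY : ∀ r, Measurable (Y r)) (s : Finset ℕ∞)
    {S : ℕ∞ → Set (ℕ → 𝒴)} (hS : ∀ r, MeasurableSet (S r)) :
    Measurable fun ω => ∏ r ∈ s, (S r).indicator (fun _ => (1 : ℝ≥0∞)) (Y r ω) :=
  Finset.measurable_prod _ fun r _ => (measurable_const.indicator (hS r)).comp (hY r)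

theorem prod_indicator_eq (s : Finset ℕ∞) (S : ℕ∞ → Set (ℕ → 𝒴)) (ω : Ω) :
    ∏ r ∈ s, (S r).indicator (fun _ => (1 : ℝ≥0∞)) (Y r ω)
      = (⋂ r ∈ s, Y r ⁻¹' S r).indicator (fun _ => 1) ω := by
  by_cases h : ω ∈ ⋂ r ∈ s, Y r ⁻¹' S r
  · rw [Set.indicator_of_mem h]
    refine Finset.prod_eq_one fun r hr => Set.indicator_of_mem ?_ _
    simp only [Set.mem_iInter] at h
    exact h r hr
  · rw [Set.indicator_of_notMem h]
    simp only [Set.mem_iInter, not_forall] at h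
    obtain ⟨r, hr, hn⟩ := h
    exact Finset.prod_eq_zero hr (Set.indicator_of_notMem (show Y r ω ∉ S r from hn) _)

theorem lintegral_prod_indicator_le_one [IsProbabilityMeasure P] (s : Finset ℕ∞)
    (S : ℕ∞ → Set (ℕ → 𝒴)) :
    ∫⁻ ω, ∏ r ∈ s, (S r).indicator (fun _ => (1 : ℝ≥0∞)) (Y r ω) ∂P ≠ ∞ := by
  refine ((lintegral_mono (g := fun _ => 1) fun ω => ?_).trans_lt (by simp)).ne
  rw [prod_indicator_eq]
  exact Set.indicator_le_self' (fun _ _ => zero_le) ω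

/-- Conditionally on the parameter, outcomes from time `t` on are independent of the history and
of the exogenous variable. -/
theorem lintegral_fullState_mul_prod_indicator [IsProbabilityMeasure P] [IsMarkovKernel K]
    (hB : IsNoisyBandit P μ K R θ Y) (hA : IsSTS P K R θ Y ξ ε σ g A) (t : ℕ) :
    ∀ (s : Finset ℕ∞), (∀ r ∈ s, (t : ℕ∞) ≤ r) → ∀ (S : ℕ∞ → Set (ℕ → 𝒴)),
      (∀ r, MeasurableSet (S r)) → ∀ f : ((Fin t → ℕ × 𝒴) × Ξ) × (ℕ → ℝ) → ℝ≥0∞, Measurable f →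
      ∫⁻ ω, f (fullState Y A ξ θ t ω) * ∏ r ∈ s, (S r).indicator (fun _ => 1) (Y r ω) ∂P
        = ∫⁻ ω, f (fullState Y A ξ θ t ω) * ∏ r ∈ s, K (θ ω) (S r) ∂P := by
  have hKm : ∀ (s : Finset ℕ∞) {S : ℕ∞ → Set (ℕ → 𝒴)}, (∀ r, MeasurableSet (S r)) →
      Measurable fun ω => ∏ r ∈ s, K (θ ω) (S r) := fun s S hS =>
    (measurable_prod_kernel s hS).comp hB.measurable_param
  induction t with
  | zero =>
    intro s _ S hS f hf
    -- At time 0 the history is trivial, and the claim combines the independence of `ξ` from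
    -- parameter and outcomes with the conditional i.i.d. hypothesis.
    set h0 : Fin 0 → ℕ × 𝒴 := fun i => i.elim0
    have hf' : Measurable fun q : Ξ × (ℕ → ℝ) => f ((h0, q.1), q.2) := by fun_prop
    have hstate : ∀ ω, fullState Y A ξ θ 0 ω = ((h0, ξ ω), θ ω) := fun ω => by
      have : history Y A 0 ω = h0 := Subsingleton.elim _ _
      rw [fullState, this]
    simp_rw [hstate]
    refine lintegral_mul_eq_of_rectangles (f := fun q : Ξ × (ℕ → ℝ) => f ((h0, q.1), q.2))
      hA.measurable_exo hB.measurable_param (measurable_prod_indicator hB.measurable_outcome s hS)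
      (hKm s hS) (lintegral_prod_indicator_le_one s S) ?_ hf'
    intro D T hD hT
    have hE : MeasurableSet (⋂ r ∈ s, Y r ⁻¹' S r) :=
      MeasurableSet.biInter (Finset.countable_toSet s) fun r _ => hB.measurable_outcome r (hS r)
    have h1 : P (ξ ⁻¹' D ∩ (θ ⁻¹' T ∩ ⋂ r ∈ s, Y r ⁻¹' S r))
        = P (ξ ⁻¹' D) * P (θ ⁻¹' T ∩ ⋂ r ∈ s, Y r ⁻¹' S r) := by
      have hm : MeasurableSet {q : (ℕ → ℝ) × (ℕ∞ → ℕ → 𝒴) | q.1 ∈ T ∧ ∀ r ∈ s, q.2 r ∈ S r} := by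
        refine (measurable_fst hT).inter ?_
        have : {q : (ℕ → ℝ) × (ℕ∞ → ℕ → 𝒴) | ∀ r ∈ s, q.2 r ∈ S r}
            = ⋂ r ∈ s, {q | q.2 r ∈ S r} := by ext; simp
        change MeasurableSet {q : (ℕ → ℝ) × (ℕ∞ → ℕ → 𝒴) | ∀ r ∈ s, q.2 r ∈ S r}
        rw [this]
        exact MeasurableSet.biInter (Finset.countable_toSet s) fun r _ =>
          ((measurable_pi_apply r).comp measurable_snd) (hS r)
      have := hA.indep_exo.measure_inter_preimage_eq_mul D _ hD hm
      convert this using 2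
      · congr 1; ext ω; simp
      · congr 1; ext ω; simp
    have h2 : ∀ w : (ℕ → ℝ) → ℝ≥0∞, Measurable w → ∫⁻ ω in ξ ⁻¹' D ∩ θ ⁻¹' T, w (θ ω) ∂P
        = P (ξ ⁻¹' D) * ∫⁻ ω in θ ⁻¹' T, w (θ ω) ∂P := by
      intro w hw
      have hind : IndepFun ξ θ P := hA.indep_exo.comp measurable_id measurable_fst
      have := lintegral_mul_eq_lintegral_mul_lintegral_of_indepFun''
        (f := fun ω => D.indicator (fun _ => (1 : ℝ≥0∞)) (ξ ω))
        (g := fun ω => T.indicator w (θ ω)) (μ := P)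
        ((measurable_const.indicator hD).comp hA.measurable_exo).aemeasurable
        ((hw.indicator hT).comp hB.measurable_param).aemeasurable
        (hind.comp (measurable_const.indicator hD) (hw.indicator hT))
      rw [← lintegral_indicator ((hA.measurable_exo hD).inter (hB.measurable_param hT)),
        ← lintegral_indicator (hB.measurable_param hT)]
      have e1 : ∫⁻ ω, D.indicator (fun _ => (1 : ℝ≥0∞)) (ξ ω) ∂P = P (ξ ⁻¹' D) := by
        rw [← lintegral_indicator_one (hA.measurable_exo hD)]; rfl
      rw [e1] at this
      refine Eq.trans (lintegral_congr fun ω => ?_) this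
      by_cases h1 : ξ ω ∈ D <;> by_cases h2 : θ ω ∈ T <;> simp [h1, h2]
    simp_rw [prod_indicator_eq]
    rw [lintegral_indicator_const hE, one_mul, Measure.restrict_apply hE,
      h2 _ (measurable_prod_kernel s hS), Set.inter_comm, Set.inter_assoc, h1,
      hB.outcome_cond_iid s T S hT hS,
      setLIntegral_map hT (measurable_prod_kernel s hS) hB.measurable_param]
  | succ t ih =>
    intro s hs S hS f hf
    obtain ⟨π, hπ, hAπ⟩ := exists_policy hB.measurable_reward hA t
    have hs' : ∀ r ∈ s, (t : ℕ∞) ≤ r := fun r hr =>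
      le_trans (by exact_mod_cast Nat.le_succ t) (hs r hr)
    have hts : (t : ℕ∞) ∉ s := fun h => by
      have := hs _ h
      norm_cast at this
      omega
    -- The state at `t + 1` is a function of the state at `t` and of the outcome vector `Y t`, so it
    -- suffices to test on rectangles in these two.
    set F : (((Fin t → ℕ × 𝒴) × Ξ) × (ℕ → ℝ)) × (ℕ → 𝒴) → ℝ≥0∞ := fun q =>
      f ((Fin.snoc (α := fun _ => ℕ × 𝒴) q.1.1.1 (π q.1.1, q.2 (π q.1.1)), q.1.1.2), q.1.2) with hF
    have hFm : Measurable F := by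
      refine hf.comp (Measurable.prodMk (Measurable.prodMk (measurable_snoc.comp
        (Measurable.prodMk (by fun_prop) (Measurable.prodMk (by fun_prop) ?_))) (by fun_prop))
        (by fun_prop))
      exact Measurable.eval_nat measurable_snd (by fun_prop)
    have hstate : ∀ ω, f (fullState Y A ξ θ (t + 1) ω) = F (fullState Y A ξ θ t ω, Y t ω) := by
      intro ω
      simp only [hF, fullState, history_succ, observed, hAπ]
    simp_rw [hstate]
    refine lintegral_mul_eq_of_rectangles (measurable_fullState hB hA t) (hB.measurable_outcome t)
      (measurable_prod_indicator hB.measurable_outcome s hS) (hKm s hS)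
      (lintegral_prod_indicator_le_one s S) ?_ hFm
    intro D T hD hT
    have hDm := measurable_fullState hB hA t hD
    have hTm := hB.measurable_outcome t hT
    set S' : ℕ∞ → Set (ℕ → 𝒴) := fun r => if r = (t : ℕ∞) then T else S r with hS'
    have hS'm : ∀ r, MeasurableSet (S' r) := fun r => by
      simp only [hS']; split_ifs; exacts [hT, hS r]
    have hS't : S' t = T := by simp [hS']
    have hS'r : ∀ r ∈ s, S' r = S r := fun r hr => by
      simp only [hS']; rw [if_neg]; rintro rfl; exact hts hr
    -- The induction hypothesis is used twice: with `t` added to the later times it replaces all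
    -- indicators by kernels, and with `{t}` alone, read backwards, it restores the indicator of `Y
    -- t`. This is why the statement is proved for arbitrary finite sets of later times.
    have a1 := ih (insert (t : ℕ∞) s) (by
      intro r hr
      rcases Finset.mem_insert.1 hr with rfl | hr
      exacts [le_rfl, hs' r hr]) S' hS'm (D.indicator fun _ => 1) (measurable_const.indicator hD)
    have a2 := ih {(t : ℕ∞)} (by simp) S' hS'm
      (D.indicator fun q => ∏ r ∈ s, K q.2 (S r))
      (((measurable_prod_kernel s hS).comp measurable_snd).indicator hD)
    simp only [Finset.prod_insert hts, Finset.prod_singleton, hS't] at a1 a2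
    rw [← lintegral_indicator (hDm.inter hTm), ← lintegral_indicator (hDm.inter hTm)]
    calc ∫⁻ ω, (fullState Y A ξ θ t ⁻¹' D ∩ Y t ⁻¹' T).indicator
          (fun ω => ∏ r ∈ s, (S r).indicator (fun _ => 1) (Y r ω)) ω ∂P
        = ∫⁻ ω, D.indicator (fun _ => 1) (fullState Y A ξ θ t ω)
          * (T.indicator (fun _ => 1) (Y t ω)
            * ∏ r ∈ s, (S' r).indicator (fun _ => 1) (Y r ω)) ∂P := by
          refine lintegral_congr fun ω => ?_
          rw [Finset.prod_congr rfl fun r hr => by rw [hS'r r hr]]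
          by_cases h1 : fullState Y A ξ θ t ω ∈ D <;> by_cases h2 : Y t ω ∈ T <;> simp [h1, h2]
      _ = ∫⁻ ω, D.indicator (fun q => ∏ r ∈ s, K q.2 (S r)) (fullState Y A ξ θ t ω)
          * K (θ ω) T ∂P := by
          rw [a1]
          refine lintegral_congr fun ω => ?_
          rw [Finset.prod_congr rfl fun r hr => by rw [hS'r r hr]]
          by_cases h1 : fullState Y A ξ θ t ω ∈ D
          · simp only [h1, Set.indicator_of_mem, one_mul]
            rw [mul_comm]; rfl
          · simp [h1]
      _ = ∫⁻ ω, D.indicator (fun q => ∏ r ∈ s, K q.2 (S r)) (fullState Y A ξ θ t ω)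
          * T.indicator (fun _ => 1) (Y t ω) ∂P := a2.symm
      _ = _ := by
          refine lintegral_congr fun ω => ?_
          have e : (fullState Y A ξ θ t ω).2 = θ ω := rfl
          by_cases h1 : fullState Y A ξ θ t ω ∈ D <;> by_cases h2 : Y t ω ∈ T <;>
            simp [h1, h2, e]

end Dynamics

/-! ### Integrating out one outcome given the state. -/

section Outcomes

variable {Ω 𝒴 Ξ : Type*} [MeasurableSpace Ω] [MeasurableSpace 𝒴] [MeasurableSpace Ξ]
  {P : Measure Ω} {μ : Measure ℝ} {K : Kernel (ℕ → ℝ) (ℕ → 𝒴)} {R : 𝒴 → ℝ} {θ : Ω → ℕ → ℝ}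
  {Y : ℕ∞ → Ω → ℕ → 𝒴} {ξ : Ω → Ξ} {ε : ℝ} {σ : Ξ → ℕ → ℕ}
  {g : (t : ℕ) → (Fin t → ℕ × 𝒴) × Ξ → ℕ → ℝ} {A : ℕ → Ω → ℕ}

/-- Integration of a function of the current state and of a later outcome vector. -/
theorem lintegral_fullState_outcome [IsProbabilityMeasure P] [IsMarkovKernel K]
    (hB : IsNoisyBandit P μ K R θ Y) (hA : IsSTS P K R θ Y ξ ε σ g A) {t : ℕ} {r : ℕ∞}
    (hr : (t : ℕ∞) ≤ r) {f : (((Fin t → ℕ × 𝒴) × Ξ) × (ℕ → ℝ)) × (ℕ → 𝒴) → ℝ≥0∞}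
    (hf : Measurable f) :
    ∫⁻ ω, f (fullState Y A ξ θ t ω, Y r ω) ∂P
      = ∫⁻ ω, ∫⁻ y, f (fullState Y A ξ θ t ω, y) ∂(K (θ ω)) ∂P := by
  have hX := measurable_fullState hB hA t
  have hXY : Measurable fun ω => (fullState Y A ξ θ t ω, Y r ω) :=
    hX.prodMk (hB.measurable_outcome r)
  set K' : Kernel (((Fin t → ℕ × 𝒴) × Ξ) × (ℕ → ℝ)) (ℕ → 𝒴) := K.comap Prod.snd measurable_snd
  have : IsProbabilityMeasure (P.map (fullState Y A ξ θ t)) :=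
    Measure.isProbabilityMeasure_map hX.aemeasurable
  have : IsProbabilityMeasure (P.map fun ω => (fullState Y A ξ θ t ω, Y r ω)) :=
    Measure.isProbabilityMeasure_map hXY.aemeasurable
  have key : P.map (fun ω => (fullState Y A ξ θ t ω, Y r ω))
      = (P.map (fullState Y A ξ θ t)) ⊗ₘ K' := by
    refine Measure.ext_prod fun {D T} hD hT => ?_
    have h := lintegral_fullState_mul_prod_indicator hB hA t {r} (by simpa using hr)
      (fun _ => T) (fun _ => hT) (D.indicator fun _ => 1) (measurable_const.indicator hD)
    simp only [Finset.prod_singleton] at h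
    rw [Measure.map_apply hXY (hD.prod hT), Measure.compProd_apply_prod hD hT,
      setLIntegral_map hD (K'.measurable_coe hT) hX, ← lintegral_indicator (hX hD)]
    have hpre : (fun ω => (fullState Y A ξ θ t ω, Y r ω)) ⁻¹' (D ×ˢ T)
      = fullState Y A ξ θ t ⁻¹' D ∩ Y r ⁻¹' T := rfl
    rw [hpre, ← lintegral_indicator_one ((hX hD).inter (hB.measurable_outcome r hT))]
    refine (Eq.trans (lintegral_congr fun ω => ?_) h).trans (lintegral_congr fun ω => ?_)
    · by_cases h1 : fullState Y A ξ θ t ω ∈ D <;> by_cases h2 : Y r ω ∈ T <;> simp [h1, h2]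
    · have e : K' (fullState Y A ξ θ t ω) = K (θ ω) := rfl
      by_cases h1 : fullState Y A ξ θ t ω ∈ D <;> simp [h1, e]
  rw [← lintegral_map hf hXY, key, Measure.lintegral_compProd hf,
    lintegral_map hf.lintegral_kernel_prod_right' hX]
  rfl

/-- The bounds on rewards are assumed under `P`; the conditional law of the outcome at time 0
transfers them to the kernel at almost every parameter. -/
theorem ae_reward_mem_kernel [IsProbabilityMeasure P] [IsMarkovKernel K]
    (hB : IsNoisyBandit P μ K R θ Y) (a : ℕ) :
    ∀ᵐ ω ∂P, ∀ᵐ y ∂(K (θ ω)), R (y a) ∈ Set.Icc (0 : ℝ) 1 := by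
  set T : Set (ℕ → 𝒴) := {y | R (y a) ∈ (Set.Icc (0 : ℝ) 1)ᶜ}
  have hT : MeasurableSet T :=
    (hB.measurable_reward.comp (measurable_pi_apply a)) measurableSet_Icc.compl
  have h0 : P (Y 0 ⁻¹' T) = 0 := hB.reward_mem 0 a
  have h1 := hB.outcome_cond_iid {0} Set.univ (fun _ => T) MeasurableSet.univ fun _ => hT
  simp only [Set.preimage_univ, Finset.mem_singleton, Set.iInter_iInter_eq_left, Set.univ_inter,
    Finset.prod_singleton, Measure.restrict_univ] at h1
  rw [h0, lintegral_map (K.measurable_coe hT) hB.measurable_param, eq_comm,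
    lintegral_eq_zero_iff (show Measurable fun ω => K (θ ω) T from
      (K.measurable_coe hT).comp hB.measurable_param)] at h1
  filter_upwards [h1] with ω hω
  exact hω

theorem ae_lintegral_reward [IsProbabilityMeasure P] [IsMarkovKernel K]
    (hB : IsNoisyBandit P μ K R θ Y) :
    ∀ᵐ ω ∂P, ∀ a, ∫⁻ y, ENNReal.ofReal (R (y a)) ∂(K (θ ω)) = ENNReal.ofReal (θ ω a) := by
  rw [ae_all_iff]
  intro a
  filter_upwards [ae_reward_mem_kernel hB a, ae_of_ae_map hB.measurable_param.aemeasurable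
    (hB.mean_eq a)] with ω h1 h2
  rw [← h2, meanReward, ofReal_integral_eq_lintegral_ofReal]
  · exact Integrable.of_mem_Icc 0 1
      (hB.measurable_reward.comp (measurable_pi_apply a)).aemeasurable h1
  · filter_upwards [h1] with y hy using hy.1

/-- The conditional mean of a reward that is not yet observed. -/
theorem lintegral_mul_reward [IsProbabilityMeasure P] [IsMarkovKernel K]
    (hB : IsNoisyBandit P μ K R θ Y) (hA : IsSTS P K R θ Y ξ ε σ g A) {t : ℕ} {r : ℕ∞}
    (hr : (t : ℕ∞) ≤ r) {f : ((Fin t → ℕ × 𝒴) × Ξ) × (ℕ → ℝ) → ℝ≥0∞} (hf : Measurable f)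
    {b : ((Fin t → ℕ × 𝒴) × Ξ) × (ℕ → ℝ) → ℕ} (hb : Measurable b) :
    ∫⁻ ω, f (fullState Y A ξ θ t ω) * ENNReal.ofReal (R (Y r ω (b (fullState Y A ξ θ t ω)))) ∂P
      = ∫⁻ ω, f (fullState Y A ξ θ t ω)
          * ENNReal.ofReal (θ ω (b (fullState Y A ξ θ t ω))) ∂P := by
  have hm : Measurable fun q : (((Fin t → ℕ × 𝒴) × Ξ) × (ℕ → ℝ)) × (ℕ → 𝒴) =>
      f q.1 * ENNReal.ofReal (R (q.2 (b q.1))) := by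
    refine (hf.comp measurable_fst).mul (ENNReal.measurable_ofReal.comp
      (hB.measurable_reward.comp (Measurable.eval_nat measurable_snd (hb.comp measurable_fst))))
  rw [lintegral_fullState_outcome hB hA hr hm]
  refine lintegral_congr_ae ?_
  filter_upwards [ae_lintegral_reward hB] with ω hω
  rw [lintegral_const_mul, hω]
  exact ENNReal.measurable_ofReal.comp (hB.measurable_reward.comp (measurable_pi_apply _))

/-- The law of the outcome of an arm as a Markov kernel in the arm and its parameter. -/
theorem exists_armKernel [Nonempty 𝒴] [IsMarkovKernel K] (hB : IsNoisyBandit P μ K R θ Y) :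
    ∃ q : Kernel (ℕ × ℝ) 𝒴, IsMarkovKernel q ∧
      ∀ᵐ ω ∂P, ∀ a, (K (θ ω)).map (fun y => y a) = q (a, θ ω a) := by
  classical
  obtain ⟨q, hq⟩ := hB.outcome_local
  set y₀ : 𝒴 := Classical.arbitrary 𝒴
  have hset : ∀ a, MeasurableSet {x : ℝ | q a x Set.univ = 1} := fun a =>
    measurableSet_eq_fun ((q a).measurable_coe MeasurableSet.univ) measurable_const
  -- The given kernels are known to be probability measures only along almost every parameter;
  -- elsewhere a Dirac mass is substituted so that the result is Markov.
  set q' : ℕ → Kernel ℝ 𝒴 := fun a => Kernel.piecewise (hset a) (q a) (Kernel.const ℝ (Measure.dirac y₀))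
    with hq'
  have hprob : ∀ a x, IsProbabilityMeasure (q' a x) := by
    intro a x
    simp only [hq', Kernel.piecewise_apply]
    split_ifs with h
    · exact ⟨h⟩
    · rw [Kernel.const_apply]; infer_instance
  refine ⟨⟨fun p => q' p.1 p.2, measurable_from_prod_countable_right fun a => (q' a).measurable⟩,
    ⟨fun p => hprob p.1 p.2⟩, ?_⟩
  rw [ae_all_iff]
  intro a
  filter_upwards [ae_of_ae_map hB.measurable_param.aemeasurable (hq a)] with ω hω
  have h1 : q a (θ ω a) Set.univ = 1 := by
    rw [← hω, Measure.map_apply (measurable_pi_apply a) MeasurableSet.univ]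
    simp
  rw [hω]
  change _ = q' a (θ ω a)
  rw [hq', Kernel.piecewise_apply, if_pos (by exact h1)]

/-- Integration of a function of the current state and of the next observation. -/
theorem lintegral_fullState_observed [IsProbabilityMeasure P] [IsMarkovKernel K]
    (hB : IsNoisyBandit P μ K R θ Y) (hA : IsSTS P K R θ Y ξ ε σ g A)
    {q : Kernel (ℕ × ℝ) 𝒴}
    (hq : ∀ᵐ ω ∂P, ∀ a, (K (θ ω)).map (fun y => y a) = q (a, θ ω a)) {t : ℕ}
    {f : (((Fin t → ℕ × 𝒴) × Ξ) × (ℕ → ℝ)) × 𝒴 → ℝ≥0∞} (hf : Measurable f) :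
    ∫⁻ ω, f (fullState Y A ξ θ t ω, observed Y A t ω) ∂P
      = ∫⁻ ω, ∫⁻ y, f (fullState Y A ξ θ t ω, y) ∂(q (A t ω, θ ω (A t ω))) ∂P := by
  obtain ⟨π, hπ, hAπ⟩ := exists_policy hB.measurable_reward hA t
  have hm : Measurable fun p : (((Fin t → ℕ × 𝒴) × Ξ) × (ℕ → ℝ)) × (ℕ → 𝒴) =>
      f (p.1, p.2 (π p.1.1)) :=
    hf.comp (measurable_fst.prodMk (Measurable.eval_nat measurable_snd (by fun_prop)))
  have := lintegral_fullState_outcome hB hA (t := t) (r := t) le_rfl hm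
  have e : ∀ ω, f (fullState Y A ξ θ t ω, observed Y A t ω)
      = f (fullState Y A ξ θ t ω, Y t ω (π (fullState Y A ξ θ t ω).1)) := by
    intro ω
    rw [observed, hAπ]; rfl
  simp_rw [e]
  rw [this]
  refine lintegral_congr_ae ?_
  filter_upwards [hq] with ω hω
  have hf1 : Measurable fun y => f (fullState Y A ξ θ t ω, y) := by fun_prop
  rw [← hω (A t ω), lintegral_map hf1 (measurable_pi_apply _), hAπ]
  rfl

end Outcomes

/-! ### The posterior kernel, and resampling of unplayed arms. -/

section Posterior

variable {Ω 𝒴 Ξ : Type*} [MeasurableSpace Ω] [MeasurableSpace 𝒴] [MeasurableSpace Ξ]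
  {P : Measure Ω} {μ : Measure ℝ} {K : Kernel (ℕ → ℝ) (ℕ → 𝒴)} {R : 𝒴 → ℝ} {θ : Ω → ℕ → ℝ}
  {Y : ℕ∞ → Ω → ℕ → 𝒴} {ξ : Ω → Ξ} {ε : ℝ} {σ : Ξ → ℕ → ℕ}
  {g : (t : ℕ) → (Fin t → ℕ × 𝒴) × Ξ → ℕ → ℝ} {A : ℕ → Ω → ℕ}

/-- The parameter and the exogenous variable are conditionally independent given the history. -/
theorem exists_posterior [StandardBorelSpace 𝒴] [Nonempty 𝒴] [IsProbabilityMeasure P]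
    [IsMarkovKernel K] (hB : IsNoisyBandit P μ K R θ Y) (hA : IsSTS P K R θ Y ξ ε σ g A) (t : ℕ) :
    ∃ k : Kernel (Fin t → ℕ × 𝒴) (ℕ → ℝ), IsMarkovKernel k ∧
      ∀ f : ((Fin t → ℕ × 𝒴) × Ξ) × (ℕ → ℝ) → ℝ≥0∞, Measurable f →
        ∫⁻ ω, f (fullState Y A ξ θ t ω) ∂P
          = ∫⁻ ω, ∫⁻ x, f ((history Y A t ω, ξ ω), x) ∂(k (history Y A t ω)) ∂P := by
  obtain ⟨q, hqM, hq⟩ := exists_armKernel hB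
  induction t with
  | zero =>
    have : IsProbabilityMeasure (P.map θ) :=
      Measure.isProbabilityMeasure_map hB.measurable_param.aemeasurable
    refine ⟨Kernel.const _ (P.map θ), inferInstance, fun f hf => ?_⟩
    have hind : IndepFun ξ θ P := hA.indep_exo.comp measurable_id measurable_fst
    have hprod := (indepFun_iff_map_prod_eq_prod_map_map hA.measurable_exo.aemeasurable
      hB.measurable_param.aemeasurable).1 hind
    set h0 : Fin 0 → ℕ × 𝒴 := fun i => i.elim0
    have hh : ∀ ω, history Y A 0 ω = h0 := fun ω => Subsingleton.elim _ _
    have hf' : Measurable fun p : Ξ × (ℕ → ℝ) => f ((h0, p.1), p.2) := by fun_prop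
    simp only [fullState, hh, Kernel.const_apply]
    have e := lintegral_map hf' (μ := P) (hA.measurable_exo.prodMk hB.measurable_param)
    rw [← e, hprod, lintegral_prod _ hf'.aemeasurable,
      lintegral_map hf'.lintegral_prod_right' hA.measurable_exo]
  | succ t ih =>
    obtain ⟨k, hk, ihk⟩ := ih
    obtain ⟨π, hπ, hAπ⟩ := exists_policy hB.measurable_reward hA t
    -- joint law of the next observation and the parameter, given the history and the arm
    set κ₁ : Kernel ((Fin t → ℕ × 𝒴) × ℕ) (ℕ → ℝ) := k.comap Prod.fst measurable_fst with hκ₁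
    set κ₂ : Kernel (((Fin t → ℕ × 𝒴) × ℕ) × (ℕ → ℝ)) 𝒴 :=
      q.comap (fun p => (p.1.2, p.2 p.1.2))
        (Measurable.prodMk (by fun_prop) (Measurable.eval_nat (by fun_prop) (by fun_prop))) with hκ₂
    set M : Kernel ((Fin t → ℕ × 𝒴) × ℕ) (𝒴 × (ℕ → ℝ)) := (κ₁ ⊗ₖ κ₂).map Prod.swap with hM
    have hMl : ∀ (p : (Fin t → ℕ × 𝒴) × ℕ) (F : 𝒴 × (ℕ → ℝ) → ℝ≥0∞), Measurable F →
        ∫⁻ x, ∫⁻ y, F (y, x) ∂(q (p.2, x p.2)) ∂(k p.1) = ∫⁻ z, F z ∂(M p) := by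
      intro p F hF
      rw [hM, Kernel.map_apply _ measurable_swap, lintegral_map hF measurable_swap,
        Kernel.lintegral_compProd _ _ _ (show Measurable fun a : (ℕ → ℝ) × 𝒴 => F a.swap from
          hF.comp measurable_swap)]
      rfl
    have hMd : ∀ (p : (Fin t → ℕ × 𝒴) × ℕ) (F : 𝒴 × (ℕ → ℝ) → ℝ≥0∞), Measurable F →
        ∫⁻ z, F z ∂(M p) = ∫⁻ z, ∫⁻ x, F (z.1, x) ∂(M.condKernel (p, z.1)) ∂(M p) := by
      intro p F hF
      have hd : M.fst ⊗ₖ M.condKernel = M := M.disintegrate M.condKernel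
      have hm : Measurable fun y => ∫⁻ x, F (y, x) ∂(M.condKernel (p, y)) := by
        have : Measurable fun y => ∫⁻ x, (fun w : (((Fin t → ℕ × 𝒴) × ℕ) × 𝒴) × (ℕ → ℝ) =>
            F (w.1.2, w.2)) ((p, y), x) ∂(M.condKernel (p, y)) :=
          ((show Measurable fun w : (((Fin t → ℕ × 𝒴) × ℕ) × 𝒴) × (ℕ → ℝ) =>
            F (w.1.2, w.2) by fun_prop).lintegral_kernel_prod_right' (κ := M.condKernel)).comp
            (measurable_const.prodMk measurable_id)
        exact this
      have h1 : ∫⁻ z, F z ∂((M.fst ⊗ₖ M.condKernel) p)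
          = ∫⁻ y, ∫⁻ x, F (y, x) ∂(M.condKernel (p, y)) ∂(M.fst p) :=
        Kernel.lintegral_compProd _ _ _ hF
      rw [hd, Kernel.fst_apply, lintegral_map hm measurable_fst] at h1
      exact h1
    -- Bayes' rule: `M` is disintegrated along the observation. The new kernel uses the old history,
    -- the arm and the observation but not `ξ`; the variable `ξ` enters only through the choice of
    -- the arm, and the arm is recorded in the history.
    set k' : Kernel (Fin (t + 1) → ℕ × 𝒴) (ℕ → ℝ) := M.condKernel.comap
      (fun h => ((fun i => h i.castSucc, (h (Fin.last t)).1), (h (Fin.last t)).2))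
      (by fun_prop) with hk'
    refine ⟨k', by rw [hk']; infer_instance, ?_⟩
    have hsnoc : ∀ {f : ((Fin (t + 1) → ℕ × 𝒴) × Ξ) × (ℕ → ℝ) → ℝ≥0∞}, Measurable f →
        ∀ (h : Fin t → ℕ × 𝒴) (a : ℕ) (z : Ξ), Measurable fun p : 𝒴 × (ℕ → ℝ) =>
          f ((Fin.snoc (α := fun _ => ℕ × 𝒴) h (a, p.1), z), p.2) := by
      intro f hf h a z
      have h1 : Measurable fun p : 𝒴 × (ℕ → ℝ) => (h, (a, p.1)) := by fun_prop
      exact hf.comp (((measurable_snoc.comp h1).prodMk measurable_const).prodMk measurable_snd)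
    -- one-step expansion of an expectation
    have step : ∀ f : ((Fin (t + 1) → ℕ × 𝒴) × Ξ) × (ℕ → ℝ) → ℝ≥0∞, Measurable f →
        ∫⁻ ω, f (fullState Y A ξ θ (t + 1) ω) ∂P
          = ∫⁻ ω, ∫⁻ z, f ((Fin.snoc (α := fun _ => ℕ × 𝒴) (history Y A t ω) (A t ω, z.1), ξ ω), z.2)
              ∂(M (history Y A t ω, A t ω)) ∂P := by
      intro f hf
      set F : (((Fin t → ℕ × 𝒴) × Ξ) × (ℕ → ℝ)) × 𝒴 → ℝ≥0∞ := fun p =>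
        f ((Fin.snoc (α := fun _ => ℕ × 𝒴) p.1.1.1 (π p.1.1, p.2), p.1.1.2), p.1.2) with hF
      have hFm : Measurable F := hf.comp (Measurable.prodMk (Measurable.prodMk
        (measurable_snoc.comp (Measurable.prodMk (by fun_prop) (by fun_prop))) (by fun_prop))
        (by fun_prop))
      have e1 : ∀ ω, f (fullState Y A ξ θ (t + 1) ω)
          = F (fullState Y A ξ θ t ω, observed Y A t ω) := by
        intro ω
        simp only [hF, fullState, history_succ, hAπ]
      simp_rw [e1]
      rw [lintegral_fullState_observed hB hA hq hFm]
      set G : ((Fin t → ℕ × 𝒴) × Ξ) × (ℕ → ℝ) → ℝ≥0∞ := fun p =>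
        ∫⁻ y, F (p, y) ∂(q (π p.1, p.2 (π p.1))) with hG
      have hGm : Measurable G := by
        have hκ : Measurable fun p : ((Fin t → ℕ × 𝒴) × Ξ) × (ℕ → ℝ) => (π p.1, p.2 (π p.1)) :=
          Measurable.prodMk (by fun_prop) (Measurable.eval_nat (by fun_prop) (by fun_prop))
        exact hFm.lintegral_kernel_prod_right' (κ := q.comap _ hκ)
      have e2 := ihk G hGm
      have e3 : ∀ ω, ∫⁻ y, F (fullState Y A ξ θ t ω, y) ∂(q (A t ω, θ ω (A t ω)))
          = G (fullState Y A ξ θ t ω) := by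
        intro ω
        simp only [hG, fullState, hAπ]
      simp_rw [e3]
      rw [e2]
      refine lintegral_congr fun ω => ?_
      rw [← hMl (history Y A t ω, A t ω) _ (hsnoc hf _ _ _)]
      simp only [hG, hF, hAπ]
    intro f hf
    -- Applying the one-step expansion to `f` and to its average `f'` reduces the claim to the
    -- disintegration of `M`, pointwise in `ω`.
    set f' : ((Fin (t + 1) → ℕ × 𝒴) × Ξ) × (ℕ → ℝ) → ℝ≥0∞ := fun p =>
      ∫⁻ x, f (p.1, x) ∂(k' p.1.1) with hf'
    have hf'm : Measurable f' := by
      have : Measurable fun p : (Fin (t + 1) → ℕ × 𝒴) × Ξ => ∫⁻ x, f (p, x) ∂(k' p.1) :=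
        hf.lintegral_kernel_prod_right' (κ := k'.comap Prod.fst measurable_fst)
      exact this.comp measurable_fst
    have e4 := step f' hf'm
    rw [step f hf]
    have e5 : ∀ ω, ∫⁻ x, f ((history Y A (t + 1) ω, ξ ω), x) ∂(k' (history Y A (t + 1) ω))
        = f' (fullState Y A ξ θ (t + 1) ω) := fun ω => rfl
    simp_rw [e5]
    rw [e4]
    refine lintegral_congr fun ω => ?_
    rw [hMd _ _ (hsnoc hf _ _ _)]
    simp only [hf', hk', Kernel.comap_apply, Fin.snoc_castSucc, Fin.snoc_last]

theorem measurable_update_nat (b : ℕ) :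
    Measurable fun p : (ℕ → ℝ) × ℝ => Function.update p.1 b p.2 := by
  refine measurable_pi_lambda _ fun i => ?_
  by_cases h : i = b
  · subst h; simpa using measurable_snd
  · simpa [Function.update_of_ne h] using (by fun_prop : Measurable fun p : (ℕ → ℝ) × ℝ => p.1 i)

/-- Resampling one coordinate of an i.i.d. sequence. -/
theorem lintegral_infinitePi_update [IsProbabilityMeasure μ] (b : ℕ) {f : (ℕ → ℝ) → ℝ≥0∞}
    (hf : Measurable f) :
    ∫⁻ x, ∫⁻ r, f (Function.update x b r) ∂μ ∂(Measure.infinitePi fun _ : ℕ => μ)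
      = ∫⁻ x, f x ∂(Measure.infinitePi fun _ : ℕ => μ) := by
  set Q := Measure.infinitePi fun _ : ℕ => μ
  have hu := measurable_update_nat b
  have key : (Q.prod μ).map (fun p => Function.update p.1 b p.2) = Q := by
    refine Measure.eq_infinitePi (μ := fun _ : ℕ => μ) fun s T hT => ?_
    rw [Measure.map_apply hu (MeasurableSet.pi (Finset.countable_toSet s) fun i _ => hT i)]
    have hpre : (fun p : (ℕ → ℝ) × ℝ => Function.update p.1 b p.2) ⁻¹' (Set.pi s T)
        = (Set.pi (s.erase b) T) ×ˢ (if b ∈ s then T b else Set.univ) := by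
      ext ⟨x, r⟩
      simp only [Set.mem_preimage, Set.mem_pi, Finset.mem_coe, Set.mem_prod, Finset.mem_erase]
      constructor
      · intro h
        refine ⟨fun i hi => by simpa [Function.update_of_ne hi.1] using h i hi.2, ?_⟩
        split_ifs with hb
        · simpa using h b hb
        · trivial
      · rintro ⟨h1, h2⟩ i hi
        by_cases hib : i = b
        · subst hib; simpa [hi] using h2
        · simpa [Function.update_of_ne hib] using h1 i ⟨hib, hi⟩
    rw [hpre, Measure.prod_prod, Measure.infinitePi_pi (μ := fun _ : ℕ => μ) fun i _ => hT i]
    by_cases hb : b ∈ s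
    · rw [if_pos hb, Finset.prod_erase_mul _ _ hb]
    · rw [if_neg hb, measure_univ, mul_one, Finset.erase_eq_of_notMem hb]
  conv_rhs => rw [← key]
  rw [lintegral_map hf hu, lintegral_prod _ (show Measurable fun p : (ℕ → ℝ) × ℝ =>
    f (Function.update p.1 b p.2) from hf.comp hu).aemeasurable]

/-- An arm that has not been played is distributed according to the prior, independently of the
history, of the exogenous variable and of the other arms. -/
theorem lintegral_update_of_notMem_arms [Nonempty 𝒴] [IsProbabilityMeasure P]
    [IsProbabilityMeasure μ] [IsMarkovKernel K] (hB : IsNoisyBandit P μ K R θ Y)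
    (hA : IsSTS P K R θ Y ξ ε σ g A) (b t : ℕ) :
    ∀ f : ((Fin t → ℕ × 𝒴) × Ξ) × (ℕ → ℝ) → ℝ≥0∞, Measurable f →
      (∀ p, b ∈ arms p.1.1 → f p = 0) →
      ∫⁻ ω, f (fullState Y A ξ θ t ω) ∂P
        = ∫⁻ ω, ∫⁻ r, f ((history Y A t ω, ξ ω), Function.update (θ ω) b r) ∂μ ∂P := by
  obtain ⟨q, hqM, hq⟩ := exists_armKernel hB
  induction t with
  | zero =>
    intro f hf _
    have hind : IndepFun ξ θ P := hA.indep_exo.comp measurable_id measurable_fst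
    have hprod := (indepFun_iff_map_prod_eq_prod_map_map hA.measurable_exo.aemeasurable
      hB.measurable_param.aemeasurable).1 hind
    rw [hB.param_iid] at hprod
    set h0 : Fin 0 → ℕ × 𝒴 := fun i => i.elim0
    have hh : ∀ ω, history Y A 0 ω = h0 := fun ω => Subsingleton.elim _ _
    simp only [fullState, hh]
    have key : ∀ F : Ξ × (ℕ → ℝ) → ℝ≥0∞, Measurable F → ∫⁻ ω, F (ξ ω, θ ω) ∂P
        = ∫⁻ z, ∫⁻ x, F (z, x) ∂(Measure.infinitePi fun _ : ℕ => μ) ∂(P.map ξ) := by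
      intro F hF
      rw [← lintegral_map hF (hA.measurable_exo.prodMk hB.measurable_param), hprod,
        lintegral_prod _ hF.aemeasurable]
    have hf1 : Measurable fun p : Ξ × (ℕ → ℝ) => f ((h0, p.1), p.2) := by fun_prop
    have hf2 : Measurable fun p : Ξ × (ℕ → ℝ) =>
        ∫⁻ r, f ((h0, p.1), Function.update p.2 b r) ∂μ := by
      have : Measurable fun p : (Ξ × (ℕ → ℝ)) × ℝ =>
          f ((h0, p.1.1), Function.update p.1.2 b p.2) :=
        hf.comp (Measurable.prodMk (by fun_prop)
          ((measurable_update_nat b).comp (by fun_prop : Measurable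
            fun p : (Ξ × (ℕ → ℝ)) × ℝ => (p.1.2, p.2))))
      exact this.lintegral_prod_right'
    rw [key _ hf1, key _ hf2]
    refine lintegral_congr fun z => ?_
    exact (lintegral_infinitePi_update b (hf1.comp (by fun_prop : Measurable fun x => (z, x)))).symm
  | succ t ih =>
    intro f hf hf0
    obtain ⟨π, hπ, hAπ⟩ := exists_policy hB.measurable_reward hA t
    -- one-step expansion of an expectation
    have step : ∀ F : ((Fin (t + 1) → ℕ × 𝒴) × Ξ) × (ℕ → ℝ) → ℝ≥0∞, Measurable F →
        ∫⁻ ω, F (fullState Y A ξ θ (t + 1) ω) ∂P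
          = ∫⁻ ω, ∫⁻ y, F ((Fin.snoc (α := fun _ => ℕ × 𝒴) (history Y A t ω) (A t ω, y), ξ ω), θ ω)
              ∂(q (A t ω, θ ω (A t ω))) ∂P := by
      intro F hF
      have hFm : Measurable fun p : (((Fin t → ℕ × 𝒴) × Ξ) × (ℕ → ℝ)) × 𝒴 =>
          F ((Fin.snoc (α := fun _ => ℕ × 𝒴) p.1.1.1 (π p.1.1, p.2), p.1.1.2), p.1.2) :=
        hF.comp (Measurable.prodMk (Measurable.prodMk
          (measurable_snoc.comp (Measurable.prodMk (by fun_prop) (by fun_prop))) (by fun_prop))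
          (by fun_prop))
      have := lintegral_fullState_observed hB hA hq hFm
      simpa only [fullState, history_succ, ← hAπ] using this
    set f' : ((Fin t → ℕ × 𝒴) × Ξ) × (ℕ → ℝ) → ℝ≥0∞ := fun p =>
      ∫⁻ y, f ((Fin.snoc (α := fun _ => ℕ × 𝒴) p.1.1 (π p.1, y), p.1.2), p.2)
        ∂(q (π p.1, p.2 (π p.1))) with hf'
    have hf'm : Measurable f' := by
      have hκ : Measurable fun p : ((Fin t → ℕ × 𝒴) × Ξ) × (ℕ → ℝ) => (π p.1, p.2 (π p.1)) :=
        Measurable.prodMk (by fun_prop) (Measurable.eval_nat (by fun_prop) (by fun_prop))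
      have hFm : Measurable fun p : (((Fin t → ℕ × 𝒴) × Ξ) × (ℕ → ℝ)) × 𝒴 =>
          f ((Fin.snoc (α := fun _ => ℕ × 𝒴) p.1.1.1 (π p.1.1, p.2), p.1.1.2), p.1.2) :=
        hf.comp (Measurable.prodMk (Measurable.prodMk
          (measurable_snoc.comp (Measurable.prodMk (by fun_prop) (by fun_prop))) (by fun_prop))
          (by fun_prop))
      exact hFm.lintegral_kernel_prod_right' (κ := q.comap _ hκ)
    have hf'0 : ∀ p, b ∈ arms p.1.1 → f' p = 0 := by
      intro p hp
      simp only [hf']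
      refine (lintegral_congr fun y => hf0 _ ?_).trans lintegral_zero
      rw [arms_snoc]
      exact Finset.mem_insert_of_mem hp
    have hUm : Measurable fun p : (((Fin (t + 1) → ℕ × 𝒴) × Ξ) × (ℕ → ℝ)) × ℝ =>
        f (p.1.1, Function.update p.1.2 b p.2) :=
      hf.comp (Measurable.prodMk (by fun_prop) ((measurable_update_nat b).comp (by fun_prop :
        Measurable fun p : (((Fin (t + 1) → ℕ × 𝒴) × Ξ) × (ℕ → ℝ)) × ℝ => (p.1.2, p.2))))
    have e1 := step f hf
    have e2 := step (fun p => ∫⁻ r, f (p.1, Function.update p.2 b r) ∂μ) hUm.lintegral_prod_right'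
    have e3 := ih f' hf'm hf'0
    have e4 : ∀ ω, ∫⁻ y, f ((Fin.snoc (α := fun _ => ℕ × 𝒴) (history Y A t ω) (A t ω, y), ξ ω), θ ω)
        ∂(q (A t ω, θ ω (A t ω))) = f' (fullState Y A ξ θ t ω) := by
      intro ω
      simp only [hf', fullState, ← hAπ]
    rw [e1]
    simp_rw [e4]
    rw [e3]
    refine Eq.trans (lintegral_congr fun ω => ?_) e2.symm
    rw [lintegral_lintegral_swap]
    · refine lintegral_congr fun r => ?_
      simp only [hf', ← hAπ]
      -- If arm `b` itself is played, it lies in the new history and both integrands vanish.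
      -- Otherwise the law of the observation depends on the parameter of another arm, which
      -- resampling coordinate `b` leaves alone.
      by_cases hb : A t ω = b
      · have hz : ∀ x y, f ((Fin.snoc (α := fun _ => ℕ × 𝒴) (history Y A t ω) (A t ω, y), ξ ω), x)
            = 0 := by
          intro x y
          apply hf0
          rw [arms_snoc, hb]
          exact Finset.mem_insert_self _ _
        simp [hz]
      · rw [Function.update_of_ne hb]
    · have hs : Measurable fun p : 𝒴 × ℝ =>
          (((Fin.snoc (α := fun _ => ℕ × 𝒴) (history Y A t ω) (A t ω, p.1) :
            Fin (t + 1) → ℕ × 𝒴), ξ ω), θ ω) := by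
        have h1 : Measurable fun p : 𝒴 × ℝ => (history Y A t ω, (A t ω, p.1)) := by fun_prop
        exact ((measurable_snoc.comp h1).prodMk measurable_const).prodMk measurable_const
      exact (hUm.comp (hs.prodMk measurable_snd)).aemeasurable

end Posterior

/-! ### Consequences of the support of the prior. -/

section Prior

variable {μ : Measure ℝ} [IsProbabilityMeasure μ]

theorem ae_mem_Icc_of_support (hs : μ.support = Set.Icc 0 1) : ∀ᵐ x ∂μ, x ∈ Set.Icc (0 : ℝ) 1 := by
  rw [← hs]; exact Measure.support_mem_ae

theorem measure_Ioi_pos_of_support (hs : μ.support = Set.Icc 0 1) {c : ℝ} (hc : c < 1) :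
    0 < μ (Set.Ioi c) := by
  have h1 : (1 : ℝ) ∈ μ.support := by rw [hs]; simp
  exact (Measure.mem_support_iff_forall 1).1 h1 _ (Ioi_mem_nhds hc)

theorem ae_infinitePi_mem_Icc (hs : μ.support = Set.Icc 0 1) :
    ∀ᵐ x ∂(Measure.infinitePi fun _ : ℕ => μ), ∀ a, x a ∈ Set.Icc (0 : ℝ) 1 := by
  rw [ae_all_iff]
  intro a
  have h := (measurePreserving_eval_infinitePi (fun _ : ℕ => μ) a).quasiMeasurePreserving
  exact h.ae (ae_mem_Icc_of_support hs)

/-- For `c < 1` the mass of `(-∞, c]` is below 1, so the probability that the first `n` coordinates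
all stay at or below `c` tends to 0. Rational levels suffice for all `c` simultaneously. -/
theorem ae_infinitePi_exists_gt (hs : μ.support = Set.Icc 0 1) :
    ∀ᵐ x ∂(Measure.infinitePi fun _ : ℕ => μ), ∀ c < (1 : ℝ), ∃ a, c < x a := by
  have key : ∀ c : ℚ, (c : ℝ) < 1 →
      ∀ᵐ x ∂(Measure.infinitePi fun _ : ℕ => μ), ∃ a, (c : ℝ) < x a := by
    intro c hc
    have hlt : μ (Set.Iic (c : ℝ)) < 1 := by
      have h1 := measure_Ioi_pos_of_support hs hc
      rw [← prob_add_prob_compl (μ := μ) (s := Set.Iic (c : ℝ)) measurableSet_Iic, Set.compl_Iic]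
      exact ENNReal.lt_add_right (measure_ne_top _ _) h1.ne'
    have hb : ∀ n : ℕ, (Measure.infinitePi fun _ : ℕ => μ) {x | ¬ ∃ a, (c : ℝ) < x a}
        ≤ μ (Set.Iic (c : ℝ)) ^ n := by
      intro n
      have h2 := Measure.infinitePi_pi (μ := fun _ : ℕ => μ) (s := Finset.range n)
        (t := fun _ => Set.Iic (c : ℝ)) fun _ _ => measurableSet_Iic
      rw [Finset.prod_const, Finset.card_range] at h2
      rw [← h2]
      refine measure_mono fun x hx => ?_
      have hx' : ∀ a, x a ≤ c := by simpa using hx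
      exact fun i _ => hx' i
    have : (Measure.infinitePi fun _ : ℕ => μ) {x | ¬ ∃ a, (c : ℝ) < x a} ≤ 0 :=
      ge_of_tendsto' (ENNReal.tendsto_pow_atTop_nhds_zero_of_lt_one hlt) hb
    exact le_antisymm this zero_le
  have key' : ∀ᵐ x ∂(Measure.infinitePi fun _ : ℕ => μ), ∀ c : ℚ, (c : ℝ) < 1 →
      ∃ a, (c : ℝ) < x a := by
    rw [ae_all_iff]
    intro c
    by_cases hc : (c : ℝ) < 1
    · filter_upwards [key c hc] with x hx _ using hx
    · exact Filter.Eventually.of_forall fun x h => absurd h hc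
  filter_upwards [key'] with x hx c hc
  obtain ⟨r, hr1, hr2⟩ := exists_rat_btwn hc
  obtain ⟨a, ha⟩ := hx r hr2
  exact ⟨a, hr1.trans ha⟩

end Prior

/-! ### The rule expressed through the level `1 - ε`. -/

section Rule

variable {Ω 𝒴 Ξ : Type*} [MeasurableSpace Ω] [MeasurableSpace 𝒴] [MeasurableSpace Ξ]
  {P : Measure Ω} {μ : Measure ℝ} {K : Kernel (ℕ → ℝ) (ℕ → 𝒴)} {R : 𝒴 → ℝ} {θ : Ω → ℕ → ℝ}
  {Y : ℕ∞ → Ω → ℕ → 𝒴} {ξ : Ω → Ξ} {ε : ℝ} {σ : Ξ → ℕ → ℕ}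
  {g : (t : ℕ) → (Fin t → ℕ × 𝒴) × Ξ → ℕ → ℝ} {A : ℕ → Ω → ℕ}

/-- The coordinates lie in `[0, 1]` and come arbitrarily close to 1, so their supremum is 1. This is
what turns `ε`-optimality into the condition that the parameter is at least `1 - ε`. -/
theorem ae_map_param_reward [IsProbabilityMeasure μ] (hB : IsNoisyBandit P μ K R θ Y) :
    ∀ᵐ x ∂(P.map θ), (∀ a, meanReward K R x a = x a) ∧ optReward K R x = 1 ∧
      ∀ a, x a ∈ Set.Icc (0 : ℝ) 1 := by
  have h1 : ∀ᵐ x ∂(P.map θ), ∀ a, meanReward K R x a = x a := ae_all_iff.2 hB.mean_eq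
  have h2 := ae_infinitePi_mem_Icc hB.support_prior
  have h3 := ae_infinitePi_exists_gt hB.support_prior
  rw [← hB.param_iid] at h2 h3
  filter_upwards [h1, h2, h3] with x hx1 hx2 hx3
  refine ⟨hx1, ?_, hx2⟩
  have : optReward K R x = ⨆ a, x a := by simp only [optReward, hx1]
  rw [this]
  exact ciSup_eq_of_forall_le_of_forall_lt_exists_gt (fun a => (hx2 a).2) hx3

theorem ae_param_reward [IsProbabilityMeasure μ] (hB : IsNoisyBandit P μ K R θ Y) :
    ∀ᵐ ω ∂P, (∀ a, meanReward K R (θ ω) a = θ ω a) ∧ optReward K R (θ ω) = 1 ∧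
      ∀ a, θ ω a ∈ Set.Icc (0 : ℝ) 1 :=
  ae_of_ae_map hB.measurable_param.aemeasurable (ae_map_param_reward hB)

theorem measurable_sample [IsSFiniteKernel K] (hB : IsNoisyBandit P μ K R θ Y)
    (hA : IsSTS P K R θ Y ξ ε σ g A) (t : ℕ) :
    Measurable fun ω => g t (history Y A t ω, ξ ω) :=
  (hA.measurable_sample t).comp ((measurable_history hB hA t).prodMk hA.measurable_exo)

theorem lintegral_sample [IsSFiniteKernel K] (hB : IsNoisyBandit P μ K R θ Y)
    (hA : IsSTS P K R θ Y ξ ε σ g A) (t : ℕ) {f : (Fin t → ℕ × 𝒴) × (ℕ → ℝ) → ℝ≥0∞}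
    (hf : Measurable f) :
    ∫⁻ ω, f (history Y A t ω, g t (history Y A t ω, ξ ω)) ∂P
      = ∫⁻ ω, f (history Y A t ω, θ ω) ∂P := by
  have hF := measurable_history hB hA t
  rw [← lintegral_map hf (hF.prodMk (measurable_sample hB hA t)), hA.posterior_sample t,
    lintegral_map hf (hF.prodMk hB.measurable_param)]

theorem map_sample [IsSFiniteKernel K] (hB : IsNoisyBandit P μ K R θ Y)
    (hA : IsSTS P K R θ Y ξ ε σ g A) (t : ℕ) :
    P.map (fun ω => g t (history Y A t ω, ξ ω)) = P.map θ := by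
  have hF := measurable_history hB hA t
  have := congrArg (fun m => m.map Prod.snd) (hA.posterior_sample t)
  rw [Measure.map_map measurable_snd (hF.prodMk (measurable_sample hB hA t)),
    Measure.map_map measurable_snd (hF.prodMk hB.measurable_param)] at this
  exact this

theorem action_mem_or (hA : IsSTS P K R θ Y ξ ε σ g A) (t : ℕ) (ω : Ω) :
    A t ω ∈ arms (history Y A t ω) ∨ A t ω = σ (ξ ω) (arms (history Y A t ω)).card := by
  rw [← sampledArms_eq]
  by_cases h : ∀ k < t, ¬ (optReward K R (g t (history Y A t ω, ξ ω)) ≤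
        meanReward K R (g t (history Y A t ω, ξ ω)) (A k ω) + ε)
  · exact Or.inr (hA.play_new t ω h)
  · push Not at h
    obtain ⟨k, ⟨hk, hsat⟩, hmin⟩ := WellFounded.has_min (wellFounded_lt (α := ℕ))
      {k | k < t ∧ optReward K R (g t (history Y A t ω, ξ ω)) ≤
        meanReward K R (g t (history Y A t ω, ξ ω)) (A k ω) + ε} h
    left
    have := hA.play_satisficing t ω k hk hsat fun j hj hc => hmin j ⟨hj.trans hk, hc⟩ hj
    rw [this, sampledArms]
    exact Finset.mem_image.2 ⟨k, Finset.mem_range.2 hk, rfl⟩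

theorem arms_history_succ (t : ℕ) (ω : Ω) :
    arms (history Y A (t + 1) ω) = insert (A t ω) (arms (history Y A t ω)) := by
  rw [history_succ, arms_snoc]

/-- The played arms form an initial segment of the exploration order. -/
theorem arms_history_eq (hA : IsSTS P K R θ Y ξ ε σ g A) (t : ℕ) (ω : Ω) :
    arms (history Y A t ω)
      = (Finset.range (arms (history Y A t ω)).card).image (σ (ξ ω)) := by
  induction t with
  | zero => simp [arms]
  | succ t ih =>
    rw [arms_history_succ]
    by_cases hmem : A t ω ∈ arms (history Y A t ω)
    · rw [Finset.insert_eq_of_mem hmem]; exact ih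
    · have h := (action_mem_or hA t ω).resolve_left hmem
      rw [Finset.card_insert_of_notMem hmem, Finset.range_add_one, Finset.image_insert, ← ih, ← h]

/-- The played arms fill exactly the positions below their number in an injective order, so the next
position holds an arm not yet played. -/
theorem order_card_notMem (hA : IsSTS P K R θ Y ξ ε σ g A) (t : ℕ) (ω : Ω) :
    σ (ξ ω) (arms (history Y A t ω)).card ∉ arms (history Y A t ω) := by
  intro h
  rw [arms_history_eq hA t ω] at h
  obtain ⟨i, hi, hi'⟩ := Finset.mem_image.1 h
  have := hA.injective_order (ξ ω) hi'
  have h2 : (arms (history Y A t ω)).card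
      = ((Finset.range (arms (history Y A t ω)).card).image (σ (ξ ω))).card :=
    congrArg Finset.card (arms_history_eq hA t ω)
  rw [← h2] at this
  simp [this] at hi

/-- In terms of the posterior sample, the rule plays the earliest arm at level `1 - ε`, and a new
arm if there is none. -/
theorem ae_rule [IsProbabilityMeasure μ] [IsSFiniteKernel K]
    (hB : IsNoisyBandit P μ K R θ Y) (hA : IsSTS P K R θ Y ξ ε σ g A) (t : ℕ) :
    ∀ᵐ ω ∂P,
      (∀ a, g t (history Y A t ω, ξ ω) ∈ firstGood (1 - ε) (history Y A t ω) a → A t ω = a) ∧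
      (g t (history Y A t ω, ξ ω) ∈ allBad (1 - ε) (history Y A t ω) →
        A t ω ∉ arms (history Y A t ω)) := by
  have h := ae_map_param_reward hB
  -- The draw has the law of the parameter, so the almost sure identities for mean rewards also hold
  -- at the draw.
  rw [← map_sample hB hA t] at h
  filter_upwards [ae_of_ae_map (measurable_sample hB hA t).aemeasurable h] with ω hω
  obtain ⟨hm, ho, -⟩ := hω
  have hiff : ∀ a, optReward K R (g t (history Y A t ω, ξ ω)) ≤
      meanReward K R (g t (history Y A t ω, ξ ω)) a + ε
      ↔ 1 - ε ≤ g t (history Y A t ω, ξ ω) a := by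
    intro a
    rw [ho, hm]
    constructor <;> intro h <;> linarith
  constructor
  · rintro a ⟨i, rfl, hi, hi'⟩
    exact hA.play_satisficing t ω i i.2 ((hiff _).2 hi)
      fun j hj hc => absurd ((hiff _).1 hc) (not_le.2 (hi' ⟨j, hj.trans i.2⟩ hj))
  · intro hbad
    have := hA.play_new t ω fun k hk hc => absurd ((hiff _).1 hc) (not_le.2 (hbad ⟨k, hk⟩))
    rw [sampledArms_eq (Y := Y)] at this
    rw [this]
    exact order_card_notMem hA t ω

/-- The sets `firstGood` and `allBad` partition the parameter space, which upgrades the implications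
of `ae_rule` to equivalences. The law of the played arm can then be read off from the law of the
draw. -/
theorem ae_mem_firstGood_iff [IsProbabilityMeasure μ] [IsSFiniteKernel K]
    (hB : IsNoisyBandit P μ K R θ Y) (hA : IsSTS P K R θ Y ξ ε σ g A) (t : ℕ) :
    ∀ᵐ ω ∂P, (∀ a, (A t ω = a ∧ a ∈ arms (history Y A t ω)) ↔
        g t (history Y A t ω, ξ ω) ∈ firstGood (1 - ε) (history Y A t ω) a) ∧
      (A t ω ∉ arms (history Y A t ω) ↔
        g t (history Y A t ω, ξ ω) ∈ allBad (1 - ε) (history Y A t ω)) := by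
  filter_upwards [ae_rule hB hA t] with ω ⟨h1, h2⟩
  refine ⟨fun a => ⟨?_, fun h => ⟨h1 a h, mem_arms_of_mem_firstGood h⟩⟩, ⟨?_, h2⟩⟩
  · rintro ⟨ha, hmem⟩
    have hnb : g t (history Y A t ω, ξ ω) ∉ allBad (1 - ε) (history Y A t ω) :=
      fun hb => h2 hb (ha ▸ hmem)
    obtain ⟨b, hb⟩ := exists_mem_firstGood hnb
    rw [← ha, h1 b hb]; exact hb
  · intro hn
    by_contra hnb
    obtain ⟨b, hb⟩ := exists_mem_firstGood hnb
    exact hn (h1 b hb ▸ mem_arms_of_mem_firstGood hb)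

end Rule

/-! ### Fresh arms, and decay of the probability that no good arm has been found. -/

section Exploration

variable {Ω 𝒴 Ξ : Type*} [MeasurableSpace Ω] [MeasurableSpace 𝒴] [MeasurableSpace Ξ]
  {P : Measure Ω} {μ : Measure ℝ} {K : Kernel (ℕ → ℝ) (ℕ → 𝒴)} {R : 𝒴 → ℝ} {θ : Ω → ℕ → ℝ}
  {Y : ℕ∞ → Ω → ℕ → 𝒴} {ξ : Ω → Ξ} {ε : ℝ} {σ : Ξ → ℕ → ℕ}
  {g : (t : ℕ) → (Fin t → ℕ × 𝒴) × Ξ → ℕ → ℝ} {A : ℕ → Ω → ℕ}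

theorem measurableSet_new [IsSFiniteKernel K] (hB : IsNoisyBandit P μ K R θ Y)
    (hA : IsSTS P K R θ Y ξ ε σ g A) (t : ℕ) :
    MeasurableSet {ω | A t ω ∉ arms (history Y A t ω)} := by
  have : {ω | A t ω ∉ arms (history Y A t ω)}
      = ⋃ a, {ω | A t ω = a} ∩ {ω | a ∈ arms (history Y A t ω)}ᶜ := by ext; simp
  rw [this]
  exact MeasurableSet.iUnion fun a =>
    (measurable_action hB hA t (measurableSet_singleton a)).inter
      ((measurable_history hB hA t) (measurableSet_mem_arms a)).compl

theorem measurableSet_allBad_history [IsSFiniteKernel K] (hB : IsNoisyBandit P μ K R θ Y)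
    (hA : IsSTS P K R θ Y ξ ε σ g A) (c : ℝ) (t : ℕ) :
    MeasurableSet {ω | θ ω ∈ allBad c (history Y A t ω)} :=
  ((measurable_history hB hA t).prodMk hB.measurable_param) (measurableSet_allBad c)

/-- The parameter of a newly played arm is distributed according to the prior, independently of
anything that does not involve unplayed arms. -/
theorem setLIntegral_new_mul [Nonempty 𝒴] [IsProbabilityMeasure P]
    [IsProbabilityMeasure μ] [IsMarkovKernel K] (hB : IsNoisyBandit P μ K R θ Y)
    (hA : IsSTS P K R θ Y ξ ε σ g A) (t : ℕ)
    {G : ((Fin t → ℕ × 𝒴) × Ξ) × (ℕ → ℝ) → ℝ≥0∞} (hG : Measurable G)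
    (hGinv : ∀ q x b r, b ∉ arms q.1 → G (q, Function.update x b r) = G (q, x))
    {w : ℝ → ℝ≥0∞} (hw : Measurable w) :
    ∫⁻ ω in {ω | A t ω ∉ arms (history Y A t ω)}, G (fullState Y A ξ θ t ω) * w (θ ω (A t ω)) ∂P
      = (∫⁻ ω in {ω | A t ω ∉ arms (history Y A t ω)}, G (fullState Y A ξ θ t ω) ∂P)
          * ∫⁻ r, w r ∂μ := by
  classical
  obtain ⟨π, hπ, hAπ⟩ := exists_policy hB.measurable_reward hA t
  set I : ℕ → ((Fin t → ℕ × 𝒴) × Ξ) → ℝ≥0∞ := fun b q => if b ∉ arms q.1 ∧ π q = b then 1 else 0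
    with hI
  have hIm : ∀ b, Measurable (I b) := fun b => by
    refine Measurable.ite ?_ measurable_const measurable_const
    exact (measurable_fst (measurableSet_mem_arms b).compl).inter (hπ (measurableSet_singleton b))
  -- decomposition over the identity of the new arm
  have hdec : ∀ H : Ω → ℝ≥0∞, Measurable H →
      ∫⁻ ω in {ω | A t ω ∉ arms (history Y A t ω)}, H ω ∂P
        = ∑' b, ∫⁻ ω, I b (history Y A t ω, ξ ω) * H ω ∂P := by
    intro H hH
    have hIΩ : ∀ b, Measurable fun ω => I b (history Y A t ω, ξ ω) := fun b =>
      (hIm b).comp ((measurable_history hB hA t).prodMk hA.measurable_exo)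
    rw [← lintegral_tsum (f := fun b ω => I b (history Y A t ω, ξ ω) * H ω)
        fun b => ((hIΩ b).mul hH).aemeasurable,
      ← lintegral_indicator (measurableSet_new hB hA t)]
    refine lintegral_congr fun ω => ?_
    rw [tsum_eq_single (A t ω)]
    · by_cases h : A t ω ∉ arms (history Y A t ω)
      · rw [Set.indicator_of_mem (by exact h)]
        simp only [hI]
        rw [if_pos ⟨h, (hAπ ω).symm⟩, one_mul]
      · rw [Set.indicator_of_notMem (by exact h)]
        simp only [hI]
        rw [if_neg fun hh => h hh.1, zero_mul]
    · intro b hb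
      simp only [hI]
      rw [if_neg, zero_mul]
      rintro ⟨-, h⟩
      exact hb (h.symm.trans (hAπ ω).symm)
  have hX := measurable_fullState hB hA t
  have hθA : Measurable fun ω => θ ω (A t ω) :=
    hB.measurable_param.eval_nat (measurable_action hB hA t)
  rw [hdec (fun ω => G (fullState Y A ξ θ t ω) * w (θ ω (A t ω)))
    ((hG.comp hX).mul (hw.comp hθA)), hdec (fun ω => G (fullState Y A ξ θ t ω)) (hG.comp hX), ← ENNReal.tsum_mul_right]
  congr 1 with b
  -- With the identity of the fresh arm frozen at `b`, the integrand vanishes once `b` has been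
  -- played, so coordinate `b` may be resampled from `μ`. The factor `G` does not see the
  -- resampling, and the weight integrates to its prior mean.
  have h1 := lintegral_update_of_notMem_arms hB hA b t (fun p => I b p.1 * (G p * w (p.2 b)))
    (((hIm b).comp measurable_fst).mul (hG.mul (hw.comp (by fun_prop)))) (by
      intro p hp
      simp only [hI]
      rw [if_neg fun h => h.1 hp, zero_mul])
  have e1 : ∀ ω, I b (history Y A t ω, ξ ω) * (G (fullState Y A ξ θ t ω) * w (θ ω (A t ω)))
      = I b (fullState Y A ξ θ t ω).1 * (G (fullState Y A ξ θ t ω)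
          * w ((fullState Y A ξ θ t ω).2 b)) := by
    intro ω
    by_cases h : b ∉ arms (history Y A t ω) ∧ π (history Y A t ω, ξ ω) = b
    · have : A t ω = b := (hAπ ω).trans h.2
      rw [this]; rfl
    · have : I b (history Y A t ω, ξ ω) = 0 := if_neg h
      simp [fullState, this]
  have e2 : ∀ ω, ∫⁻ r, I b (history Y A t ω, ξ ω) * (G ((history Y A t ω, ξ ω),
      Function.update (θ ω) b r) * w (Function.update (θ ω) b r b)) ∂μ
      = I b (history Y A t ω, ξ ω) * G (fullState Y A ξ θ t ω) * ∫⁻ r, w r ∂μ := by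
    intro ω
    by_cases h : b ∉ arms (history Y A t ω) ∧ π (history Y A t ω, ξ ω) = b
    · simp only [fun x r => hGinv (history Y A t ω, ξ ω) x b r h.1, Function.update_self]
      rw [← lintegral_const_mul _ hw]
      simp only [mul_assoc, fullState]
    · have : I b (history Y A t ω, ξ ω) = 0 := if_neg h
      simp [this]
  calc ∫⁻ ω, I b (history Y A t ω, ξ ω) * (G (fullState Y A ξ θ t ω) * w (θ ω (A t ω))) ∂P
      = ∫⁻ ω, I b (history Y A t ω, ξ ω) * G (fullState Y A ξ θ t ω) * ∫⁻ r, w r ∂μ ∂P := by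
        simp_rw [e1]
        rw [h1]
        simp_rw [e2]
    _ = _ := by
        rw [lintegral_mul_const]
        · exact ((hIm b).comp ((measurable_history hB hA t).prodMk hA.measurable_exo)).mul
            (hG.comp hX)

theorem update_mem_allBad_iff {t : ℕ} {c : ℝ} {h : Fin t → ℕ × 𝒴} {x : ℕ → ℝ} {b : ℕ} {r : ℝ}
    (hb : b ∉ arms h) : Function.update x b r ∈ allBad c h ↔ x ∈ allBad c h := by
  have : ∀ i, Function.update x b r (h i).1 = x (h i).1 := fun i =>
    Function.update_of_ne (fun hc => hb (mem_arms.2 ⟨i, hc⟩)) _ _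
  simp only [allBad, Set.mem_ofPred_eq, this]

/-- The kernel `k` is the posterior law of the parameter given the history, even when the exogenous
variable is also given. -/
def IsPosterior (P : Measure Ω) (Y : ℕ∞ → Ω → ℕ → 𝒴) (A : ℕ → Ω → ℕ) (ξ : Ω → Ξ)
    (θ : Ω → ℕ → ℝ) (t : ℕ) (k : Kernel (Fin t → ℕ × 𝒴) (ℕ → ℝ)) : Prop :=
  ∀ f : ((Fin t → ℕ × 𝒴) × Ξ) × (ℕ → ℝ) → ℝ≥0∞, Measurable f →
    ∫⁻ ω, f (fullState Y A ξ θ t ω) ∂P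
      = ∫⁻ ω, ∫⁻ x, f ((history Y A t ω, ξ ω), x) ∂(k (history Y A t ω)) ∂P

theorem measurable_kernel_allBad {t : ℕ} (k : Kernel (Fin t → ℕ × 𝒴) (ℕ → ℝ)) [IsSFiniteKernel k]
    (c : ℝ) : Measurable fun h => k h (allBad c h) :=
  Kernel.measurable_kernel_prodMk_left (measurableSet_allBad c)

theorem measurable_kernel_firstGood {t : ℕ} (k : Kernel (Fin t → ℕ × 𝒴) (ℕ → ℝ))
    [IsSFiniteKernel k] (c : ℝ) (a : ℕ) : Measurable fun h => k h (firstGood c h a) :=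
  Kernel.measurable_kernel_prodMk_left (measurableSet_firstGood c a)

/-- A fresh arm is played exactly when the draw is bad at all played arms, and jointly with the
history the draw is distributed as the parameter. -/
theorem measure_new_eq [IsProbabilityMeasure μ] [IsSFiniteKernel K]
    (hB : IsNoisyBandit P μ K R θ Y) (hA : IsSTS P K R θ Y ξ ε σ g A) (t : ℕ) :
    P {ω | A t ω ∉ arms (history Y A t ω)} = P {ω | θ ω ∈ allBad (1 - ε) (history Y A t ω)} := by
  have h := lintegral_sample hB hA t
    (f := {q : (Fin t → ℕ × 𝒴) × (ℕ → ℝ) | q.2 ∈ allBad (1 - ε) q.1}.indicator fun _ => 1)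
    (measurable_const.indicator (measurableSet_allBad _))
  rw [← lintegral_indicator_one (measurableSet_new hB hA t),
    ← lintegral_indicator_one (measurableSet_allBad_history hB hA _ t)]
  refine Eq.trans (lintegral_congr_ae ?_) h
  filter_upwards [ae_mem_firstGood_iff hB hA t] with ω hω
  by_cases hn : A t ω ∉ arms (history Y A t ω)
  · rw [Set.indicator_of_mem (by exact hn), Set.indicator_of_mem (by exact hω.2.1 hn)]; rfl
  · rw [Set.indicator_of_notMem (by exact hn),
      Set.indicator_of_notMem (by exact fun hc => hn (hω.2.2 hc))]

/-- The probability that the best arm level is still missing and a new arm is played. -/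
theorem measure_allBad_inter_new [IsProbabilityMeasure P] [IsProbabilityMeasure μ]
    [IsMarkovKernel K] (hB : IsNoisyBandit P μ K R θ Y) (hA : IsSTS P K R θ Y ξ ε σ g A) (t : ℕ)
    {k : Kernel (Fin t → ℕ × 𝒴) (ℕ → ℝ)} [IsMarkovKernel k] (hk : IsPosterior P Y A ξ θ t k) :
    P ({ω | θ ω ∈ allBad (1 - ε) (history Y A t ω)} ∩ {ω | A t ω ∉ arms (history Y A t ω)})
      = ∫⁻ ω, k (history Y A t ω) (allBad (1 - ε) (history Y A t ω)) ^ 2 ∂P := by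
  set c := 1 - ε with hc
  set B : Set ((Fin t → ℕ × 𝒴) × (ℕ → ℝ)) := {q | q.2 ∈ allBad c q.1} with hBdef
  have hBm : MeasurableSet B := measurableSet_allBad c
  have hF := measurable_history hB hA t
  have hq := measurable_kernel_allBad k c
  -- first integrate out the parameter, then the posterior sample
  have h1 := hk (fun p => B.indicator (fun _ => 1) (p.1.1, g t p.1)
    * B.indicator (fun _ => 1) (p.1.1, p.2)) (by
      refine Measurable.mul ?_ ?_
      · exact (measurable_const.indicator hBm).comp
          (Measurable.prodMk (by fun_prop) ((hA.measurable_sample t).comp measurable_fst))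
      · exact (measurable_const.indicator hBm).comp (by fun_prop))
  have h2 := lintegral_sample hB hA t (f := fun q => B.indicator (fun _ => 1) q
    * k q.1 (allBad c q.1)) ((measurable_const.indicator hBm).mul (hq.comp measurable_fst))
  have h3 := hk (fun p => B.indicator (fun _ => 1) (p.1.1, p.2) * k p.1.1 (allBad c p.1.1)) (by
    refine Measurable.mul ?_ (hq.comp (by fun_prop))
    exact (measurable_const.indicator hBm).comp (by fun_prop))
  have hkB : ∀ h, ∫⁻ x, B.indicator (fun _ => (1 : ℝ≥0∞)) (h, x) ∂(k h) = k h (allBad c h) := by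
    intro h
    have hm : MeasurableSet (allBad c h) := measurable_prodMk_left hBm
    rw [← lintegral_indicator_one hm]
    rfl
  have hBk : ∀ h, Measurable fun x => B.indicator (fun _ => (1 : ℝ≥0∞)) (h, x) := fun h =>
    (measurable_const.indicator hBm).comp measurable_prodMk_left
  rw [← lintegral_indicator_one ((measurableSet_allBad_history hB hA _ t).inter
    (measurableSet_new hB hA t))]
  calc _ = ∫⁻ ω, B.indicator (fun _ => 1) (history Y A t ω, g t (history Y A t ω, ξ ω))
        * B.indicator (fun _ => 1) (history Y A t ω, θ ω) ∂P := by
        refine lintegral_congr_ae ?_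
        filter_upwards [ae_mem_firstGood_iff hB hA t] with ω hω
        have e1 : (history Y A t ω, g t (history Y A t ω, ξ ω)) ∈ B
            ↔ A t ω ∉ arms (history Y A t ω) := hω.2.symm
        have e2 : (history Y A t ω, θ ω) ∈ B ↔ θ ω ∈ allBad c (history Y A t ω) := Iff.rfl
        by_cases h1 : A t ω ∈ arms (history Y A t ω) <;>
          by_cases h2 : θ ω ∈ allBad c (history Y A t ω) <;>
          simp [e1, e2, h1, h2]
    _ = ∫⁻ ω, B.indicator (fun _ => 1) (history Y A t ω, g t (history Y A t ω, ξ ω))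
        * k (history Y A t ω) (allBad c (history Y A t ω)) ∂P := by
        refine h1.trans (lintegral_congr fun ω => ?_)
        dsimp only
        rw [lintegral_const_mul _ (hBk _), hkB]
    _ = ∫⁻ ω, B.indicator (fun _ => 1) (history Y A t ω, θ ω)
        * k (history Y A t ω) (allBad c (history Y A t ω)) ∂P := h2
    _ = _ := by
        refine h3.trans (lintegral_congr fun ω => ?_)
        dsimp only
        rw [lintegral_mul_const _ (hBk _), hkB, sq]

theorem measure_allBad_eq {t : ℕ} [IsSFiniteKernel K] (hB : IsNoisyBandit P μ K R θ Y)
    (hA : IsSTS P K R θ Y ξ ε σ g A)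
    {k : Kernel (Fin t → ℕ × 𝒴) (ℕ → ℝ)} (hk : IsPosterior P Y A ξ θ t k) (c : ℝ) :
    P {ω | θ ω ∈ allBad c (history Y A t ω)}
      = ∫⁻ ω, k (history Y A t ω) (allBad c (history Y A t ω)) ∂P := by
  have hBm := measurableSet_allBad (t := t) (𝒴 := 𝒴) c
  have := hk (fun p => {q : (Fin t → ℕ × 𝒴) × (ℕ → ℝ) | q.2 ∈ allBad c q.1}.indicator
    (fun _ => 1) (p.1.1, p.2)) ((measurable_const.indicator hBm).comp (by fun_prop))
  rw [← lintegral_indicator_one (measurableSet_allBad_history hB hA _ t)]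
  refine this.trans (lintegral_congr fun ω => ?_)
  have hm : MeasurableSet (allBad c (history Y A t ω)) := measurable_prodMk_left hBm
  rw [← lintegral_indicator_one hm]
  rfl

/-- The probability that no satisficing arm has been played decreases quadratically. -/
theorem measureReal_allBad_succ_le [StandardBorelSpace 𝒴] [Nonempty 𝒴] [IsProbabilityMeasure P]
    [IsProbabilityMeasure μ] [IsMarkovKernel K] (hB : IsNoisyBandit P μ K R θ Y)
    (hA : IsSTS P K R θ Y ξ ε σ g A) (t : ℕ) :
    P.real {ω | θ ω ∈ allBad (1 - ε) (history Y A (t + 1) ω)}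
      ≤ P.real {ω | θ ω ∈ allBad (1 - ε) (history Y A t ω)}
        - μ.real (Set.Ici (1 - ε)) * P.real {ω | θ ω ∈ allBad (1 - ε) (history Y A t ω)} ^ 2 := by
  classical
  obtain ⟨k, hkM, hk⟩ := exists_posterior hB hA t
  set c := 1 - ε with hc
  set E := {ω | θ ω ∈ allBad c (history Y A t ω)} with hE
  set E' := {ω | θ ω ∈ allBad c (history Y A (t + 1) ω)} with hE'
  set N := {ω | A t ω ∉ arms (history Y A t ω)} with hN
  have hEm : MeasurableSet E := measurableSet_allBad_history hB hA c t
  have hE'm : MeasurableSet E' := measurableSet_allBad_history hB hA c (t + 1)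
  have hNm : MeasurableSet N := measurableSet_new hB hA t
  have hθA : Measurable fun ω => θ ω (A t ω) :=
    hB.measurable_param.eval_nat (measurable_action hB hA t)
  have hsub : E' ⊆ E := fun ω hω => by
    have : θ ω ∈ allBad c (history Y A (t + 1) ω) := hω
    rw [history_succ, mem_allBad_snoc] at this
    exact this.1
  -- The bad event is left at time `t` exactly when a fresh arm is played and its parameter reaches
  -- `c`. That parameter is independent of the event `E ∩ N`.
  have hdiff : P (E \ E') = P (E ∩ N) * μ (Set.Ici c) := by
    have h := setLIntegral_new_mul hB hA t
      (G := fun p => {q : (Fin t → ℕ × 𝒴) × (ℕ → ℝ) | q.2 ∈ allBad c q.1}.indicator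
        (fun _ => 1) (p.1.1, p.2))
      ((measurable_const.indicator (measurableSet_allBad c)).comp (by fun_prop))
      (fun q x b r hb => by
        simp only [Set.indicator_apply, Set.mem_ofPred_eq, update_mem_allBad_iff hb])
      (w := (Set.Ici c).indicator fun _ => 1) (measurable_const.indicator measurableSet_Ici)
    have r1 : ∫⁻ r, (Set.Ici c).indicator (fun _ => (1 : ℝ≥0∞)) r ∂μ = μ (Set.Ici c) :=
      lintegral_indicator_one measurableSet_Ici
    have r2 : ∫⁻ ω in N, {q : (Fin t → ℕ × 𝒴) × (ℕ → ℝ) | q.2 ∈ allBad c q.1}.indicator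
        (fun _ => (1 : ℝ≥0∞)) ((fullState Y A ξ θ t ω).1.1, (fullState Y A ξ θ t ω).2) ∂P
        = P (E ∩ N) := by
      have : ∫⁻ ω in N, E.indicator 1 ω ∂P = P (E ∩ N) := by
        rw [lintegral_indicator_one hEm, Measure.restrict_apply hEm]
      rw [← this]; rfl
    rw [r1, r2] at h
    rw [← h]
    have hset : E \ E' = (E ∩ (fun ω => θ ω (A t ω)) ⁻¹' (Set.Ici c)) ∩ N := by
      ext ω
      have h1 : ω ∈ E' ↔ ω ∈ E ∧ θ ω (A t ω) < c := by
        change θ ω ∈ allBad c (history Y A (t + 1) ω) ↔ _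
        rw [history_succ, mem_allBad_snoc]; rfl
      constructor
      · rintro ⟨h2, h3⟩
        rw [h1] at h3
        have h4 : c ≤ θ ω (A t ω) := by
          by_contra h5; exact h3 ⟨h2, not_le.1 h5⟩
        refine ⟨⟨h2, h4⟩, fun hmem => ?_⟩
        obtain ⟨i, hi⟩ := mem_arms.1 hmem
        have h6 : θ ω ∈ allBad c (history Y A t ω) := h2
        have h7 := h6 i
        rw [hi] at h7
        exact absurd h7 (not_lt.2 h4)
      · rintro ⟨⟨h2, h3⟩, -⟩
        exact ⟨h2, fun h4 => absurd (h1.1 h4).2 (not_lt.2 h3)⟩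
    have hEA : MeasurableSet (E ∩ (fun ω => θ ω (A t ω)) ⁻¹' (Set.Ici c)) :=
      hEm.inter (hθA measurableSet_Ici)
    rw [hset, ← Measure.restrict_apply hEA, ← lintegral_indicator_one hEA]
    refine lintegral_congr fun ω => ?_
    have e1 : ((fullState Y A ξ θ t ω).1.1, (fullState Y A ξ θ t ω).2)
        ∈ {q : (Fin t → ℕ × 𝒴) × (ℕ → ℝ) | q.2 ∈ allBad c q.1} ↔ ω ∈ E := Iff.rfl
    by_cases h1 : ω ∈ E <;> by_cases h2 : θ ω (A t ω) ∈ Set.Ici c <;>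
      simp only [Set.indicator_apply, e1, h1, h2, Set.mem_inter_iff, Set.mem_preimage, if_true,
        if_false, and_true, and_false, mul_one, mul_zero, Pi.one_apply]
  set Q : Ω → ℝ := fun ω => (k (history Y A t ω)).real (allBad c (history Y A t ω)) with hQ
  have hQm : Measurable Q :=
    ((measurable_kernel_allBad k c).comp (measurable_history hB hA t)).ennreal_toReal
  have hQ01 : ∀ ω, Q ω ∈ Set.Icc (0 : ℝ) 1 := fun ω => ⟨measureReal_nonneg, measureReal_le_one⟩
  have hQi : Integrable Q P := Integrable.of_mem_Icc 0 1 hQm.aemeasurable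
    (Filter.Eventually.of_forall hQ01)
  have hQ2i : Integrable (fun ω => Q ω ^ 2) P := Integrable.of_mem_Icc 0 1
    (hQm.pow_const 2).aemeasurable (Filter.Eventually.of_forall fun ω =>
      ⟨sq_nonneg _, pow_le_one₀ (hQ01 ω).1 (hQ01 ω).2⟩)
  have hx : P.real E = ∫ ω, Q ω ∂P := by
    rw [measureReal_def, measure_allBad_eq hB hA hk c, hQ]
    simp only [measureReal_def]
    rw [integral_toReal]
    · exact ((measurable_kernel_allBad k c).comp (measurable_history hB hA t)).aemeasurable
    · exact Filter.Eventually.of_forall fun ω => measure_lt_top _ _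
  have hx2 : P.real (E ∩ N) = ∫ ω, Q ω ^ 2 ∂P := by
    rw [measureReal_def, measure_allBad_inter_new hB hA t hk, hQ]
    simp only [measureReal_def, ← ENNReal.toReal_pow]
    rw [integral_toReal]
    · exact (((measurable_kernel_allBad k c).comp
        (measurable_history hB hA t)).pow_const 2).aemeasurable
    · exact Filter.Eventually.of_forall fun ω => ENNReal.pow_lt_top (measure_lt_top _ _)
  -- Jensen's inequality for `Q ^ 2`, obtained from the tangent line of the square at the mean of
  -- `Q`.
  have hsq : P.real E ^ 2 ≤ P.real (E ∩ N) := by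
    rw [hx2]
    have : ∫ ω, (2 * P.real E * Q ω - P.real E ^ 2) ∂P ≤ ∫ ω, Q ω ^ 2 ∂P := by
      refine integral_mono ((hQi.const_mul _).sub (integrable_const _)) hQ2i fun ω => ?_
      change 2 * P.real E * Q ω - P.real E ^ 2 ≤ Q ω ^ 2
      nlinarith [sq_nonneg (Q ω - P.real E)]
    rw [integral_sub (hQi.const_mul _) (integrable_const _), integral_const_mul, ← hx] at this
    simp only [integral_const, probReal_univ, smul_eq_mul, one_mul] at this
    nlinarith
  have hd : P.real E' = P.real E - P.real (E ∩ N) * μ.real (Set.Ici c) := by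
    have h1 : P.real (E \ E') = P.real (E ∩ N) * μ.real (Set.Ici c) := by
      rw [measureReal_def, hdiff, ENNReal.toReal_mul]; rfl
    rw [measureReal_sdiff hsub hE'm] at h1
    linarith
  rw [hd]
  nlinarith [(measureReal_nonneg : 0 ≤ μ.real (Set.Ici c))]

theorem measureReal_allBad_le [StandardBorelSpace 𝒴] [Nonempty 𝒴] [IsProbabilityMeasure P]
    [IsProbabilityMeasure μ] [IsMarkovKernel K] (hB : IsNoisyBandit P μ K R θ Y)
    (hA : IsSTS P K R θ Y ξ ε σ g A) (t : ℕ) :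
    P.real {ω | θ ω ∈ allBad (1 - ε) (history Y A t ω)}
      ≤ 1 / (1 + μ.real (Set.Ici (1 - ε)) * t) :=
  le_one_div_of_sq_decrement
    (x := fun t => P.real {ω | θ ω ∈ allBad (1 - ε) (history Y A t ω)})
    measureReal_nonneg measureReal_le_one (fun _ => measureReal_nonneg)
    (measureReal_allBad_succ_le hB hA) t

/-- Almost surely a satisficing arm is eventually played. -/
theorem ae_exists_satisficing [StandardBorelSpace 𝒴] [Nonempty 𝒴] [IsProbabilityMeasure P]
    [IsProbabilityMeasure μ] [IsMarkovKernel K] (hB : IsNoisyBandit P μ K R θ Y)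
    (hA : IsSTS P K R θ Y ξ ε σ g A) (hε : 0 < ε) :
    ∀ᵐ ω ∂P, ∃ t : ℕ, 1 - ε ≤ θ ω (A t ω) := by
  set p := μ.real (Set.Ici (1 - ε)) with hp
  have hp0 : 0 < p := by
    have h1 := measure_Ioi_pos_of_support hB.support_prior (c := 1 - ε) (by linarith)
    exact ENNReal.toReal_pos (h1.trans_le (measure_mono Set.Ioi_subset_Ici_self)).ne'
      (measure_ne_top _ _)
  have hle : ∀ t : ℕ, P.real {ω | ¬ ∃ t : ℕ, 1 - ε ≤ θ ω (A t ω)} ≤ 1 / (1 + p * t) := by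
    intro t
    refine (measureReal_mono ?_).trans (measureReal_allBad_le hB hA t)
    intro ω hω
    exact fun i => not_le.1 fun hc => hω ⟨i, hc⟩
  have hlim : Filter.Tendsto (fun t : ℕ => 1 / (1 + p * (t : ℝ))) Filter.atTop (nhds 0) := by
    simp_rw [one_div]
    refine Filter.Tendsto.inv_tendsto_atTop (Filter.tendsto_atTop_add_const_left _ _ ?_)
    exact (tendsto_natCast_atTop_atTop).const_mul_atTop hp0
  have h0 : P.real {ω | ¬ ∃ t : ℕ, 1 - ε ≤ θ ω (A t ω)} ≤ 0 := ge_of_tendsto' hlim hle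
  exact (measureReal_eq_zero_iff (measure_ne_top _ _)).1 (le_antisymm h0 measureReal_nonneg)

/-- The expected number of arms played before time `t`. -/
theorem lintegral_card_arms [IsProbabilityMeasure μ] [IsProbabilityMeasure P] [IsSFiniteKernel K]
    (hB : IsNoisyBandit P μ K R θ Y) (hA : IsSTS P K R θ Y ξ ε σ g A) (t : ℕ) :
    ∫⁻ ω, ((arms (history Y A t ω)).card : ℝ≥0∞) ∂P
      = ∑ s ∈ Finset.range t, P {ω | θ ω ∈ allBad (1 - ε) (history Y A s ω)} := by
  induction t with
  | zero => simp [arms]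
  | succ t ih =>
    rw [Finset.sum_range_succ, ← ih, ← measure_new_eq hB hA t,
      ← lintegral_indicator_one (measurableSet_new hB hA t), ← lintegral_add_right]
    · refine lintegral_congr fun ω => ?_
      rw [arms_history_succ]
      by_cases h : A t ω ∈ arms (history Y A t ω)
      · rw [Finset.insert_eq_of_mem h, Set.indicator_of_notMem (by exact fun hc => hc h), add_zero]
      · rw [Finset.card_insert_of_notMem h, Set.indicator_of_mem (by exact h)]
        push_cast; rfl
    · exact measurable_one.indicator (measurableSet_new hB hA t)

end Exploration

/-! ### The benchmark arm: location in the exploration order and entropy. -/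

section SatisficingArm

variable {Ω 𝒴 Ξ : Type*} [MeasurableSpace Ω] [MeasurableSpace 𝒴] [MeasurableSpace Ξ]
  {P : Measure Ω} {μ : Measure ℝ} {K : Kernel (ℕ → ℝ) (ℕ → 𝒴)} {R : 𝒴 → ℝ} {θ : Ω → ℕ → ℝ}
  {Y : ℕ∞ → Ω → ℕ → 𝒴} {ξ : Ω → Ξ} {ε : ℝ} {σ : Ξ → ℕ → ℕ}
  {g : (t : ℕ) → (Fin t → ℕ × 𝒴) × Ξ → ℕ → ℝ} {A : ℕ → Ω → ℕ}

theorem satisficingTime_eq {ω : Ω} {n : ℕ} (h1 : 1 - ε ≤ θ ω (A n ω))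
    (h2 : ∀ j < n, θ ω (A j ω) < 1 - ε) : satisficingTime θ A ε ω = n := by
  apply le_antisymm
  · exact Nat.sInf_le h1
  · by_contra hlt
    push Not at hlt
    have hmem : satisficingTime θ A ε ω ∈ {t : ℕ | 1 - ε ≤ θ ω (A t ω)} :=
      Nat.sInf_mem ⟨n, h1⟩
    exact absurd (h2 _ hlt) (not_lt.2 hmem)

theorem satisficingArm_eq_of_mem_firstGood {t a : ℕ} {ω : Ω}
    (h : θ ω ∈ firstGood (1 - ε) (history Y A t ω) a) : satisficingArm θ A ε ω = a := by
  obtain ⟨i, hia, hi, hi'⟩ := h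
  have : satisficingTime θ A ε ω = i :=
    satisficingTime_eq hi fun j hj => hi' ⟨j, hj.trans i.2⟩ hj
  rw [satisficingArm, this]
  exact hia

theorem satisficingArm_eq_action {t : ℕ} {ω : Ω} (h : θ ω ∈ allBad (1 - ε) (history Y A t ω))
    (h1 : 1 - ε ≤ θ ω (A t ω)) : satisficingArm θ A ε ω = A t ω := by
  have : satisficingTime θ A ε ω = t := satisficingTime_eq h1 fun j hj => h ⟨j, hj⟩
  rw [satisficingArm, this]

theorem satisficingArm_good {ω : Ω} (hex : ∃ t : ℕ, 1 - ε ≤ θ ω (A t ω)) :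
    1 - ε ≤ θ ω (satisficingArm θ A ε ω) :=
  Nat.sInf_mem hex

theorem satisficingArm_notMem_arms {t : ℕ} {ω : Ω} (hex : ∃ t : ℕ, 1 - ε ≤ θ ω (A t ω))
    (h : θ ω ∈ allBad (1 - ε) (history Y A t ω)) :
    satisficingArm θ A ε ω ∉ arms (history Y A t ω) := by
  intro hmem
  obtain ⟨i, hi⟩ := mem_arms.1 hmem
  have h1 := h i
  rw [hi] at h1
  exact absurd h1 (not_lt.2 (satisficingArm_good hex))

/-- If a good arm occurs in the history, the earliest one is the benchmark; if none does, the
benchmark is good and hence cannot be in the history. -/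
theorem satisficingArm_eq_iff {t a : ℕ} {ω : Ω} (hex : ∃ t : ℕ, 1 - ε ≤ θ ω (A t ω))
    (ha : a ∈ arms (history Y A t ω)) :
    satisficingArm θ A ε ω = a ↔ θ ω ∈ firstGood (1 - ε) (history Y A t ω) a := by
  refine ⟨fun h => ?_, satisficingArm_eq_of_mem_firstGood⟩
  by_cases hb : θ ω ∈ allBad (1 - ε) (history Y A t ω)
  · exact absurd (h ▸ ha) (satisficingArm_notMem_arms hex hb)
  · obtain ⟨b, hb⟩ := exists_mem_firstGood hb
    rw [← h, satisficingArm_eq_of_mem_firstGood hb]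
    exact hb

/-- A good arm already in the history would itself be the benchmark, so a fresh arm can be the
benchmark only by being the first good arm, found at this very step. -/
theorem satisficingArm_eq_action_iff {t : ℕ} {ω : Ω} (hex : ∃ t : ℕ, 1 - ε ≤ θ ω (A t ω))
    (ha : A t ω ∉ arms (history Y A t ω)) :
    satisficingArm θ A ε ω = A t ω ↔
      θ ω ∈ allBad (1 - ε) (history Y A t ω) ∧ 1 - ε ≤ θ ω (A t ω) := by
  refine ⟨fun h => ⟨?_, h ▸ satisficingArm_good hex⟩,
    fun h => satisficingArm_eq_action h.1 h.2⟩
  by_contra hb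
  obtain ⟨b, hb⟩ := exists_mem_firstGood hb
  rw [satisficingArm_eq_of_mem_firstGood hb] at h
  exact ha (h ▸ mem_arms_of_mem_firstGood hb)

theorem measurable_satisficingTime [IsSFiniteKernel K] (hB : IsNoisyBandit P μ K R θ Y)
    (hA : IsSTS P K R θ Y ξ ε σ g A) : Measurable (satisficingTime θ A ε) := by
  have hm : ∀ n, Measurable fun ω => θ ω (A n ω) := fun n =>
    hB.measurable_param.eval_nat (measurable_action hB hA n)
  have hgood : ∀ n, MeasurableSet {ω | 1 - ε ≤ θ ω (A n ω)} := fun n =>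
    measurableSet_le measurable_const (hm n)
  refine measurable_to_countable' fun n => ?_
  -- The second set accounts for the default value `sInf ∅ = 0` when no good arm is ever played.
  have heq : satisficingTime θ A ε ⁻¹' {n}
      = ({ω | 1 - ε ≤ θ ω (A n ω)} ∩ ⋂ j, ⋂ _ : j < n, {ω | 1 - ε ≤ θ ω (A j ω)}ᶜ) ∪
        ({_ω | n = 0} ∩ ⋂ j, {ω | 1 - ε ≤ θ ω (A j ω)}ᶜ) := by
    ext ω
    simp only [Set.mem_preimage, Set.mem_singleton_iff, Set.mem_union, Set.mem_inter_iff,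
      Set.mem_ofPred_eq, Set.mem_iInter, Set.mem_compl_iff]
    constructor
    · intro h
      by_cases hex : ∃ t : ℕ, 1 - ε ≤ θ ω (A t ω)
      · left
        have h1 : n ∈ {t : ℕ | 1 - ε ≤ θ ω (A t ω)} := h ▸ Nat.sInf_mem hex
        exact ⟨h1, fun j hj hc => absurd (h ▸ Nat.sInf_le hc) (not_le.2 hj)⟩
      · right
        push Not at hex
        refine ⟨?_, fun j => not_le.2 (hex j)⟩
        have : {t : ℕ | 1 - ε ≤ θ ω (A t ω)} = ∅ := by
          exact Set.eq_empty_iff_forall_notMem.2 fun j hj => absurd hj (not_le.2 (hex j))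
        rw [← h, satisficingTime, this, Nat.sInf_empty]
    · rintro (⟨h1, h2⟩ | ⟨h1, h2⟩)
      · exact satisficingTime_eq h1 fun j hj => not_le.1 (h2 j hj)
      · have : {t : ℕ | 1 - ε ≤ θ ω (A t ω)} = ∅ := by
          exact Set.eq_empty_iff_forall_notMem.2 fun j hj => absurd hj (h2 j)
        rw [satisficingTime, this, Nat.sInf_empty, h1]
  rw [heq]
  refine MeasurableSet.union ((hgood n).inter ?_) (MeasurableSet.inter (MeasurableSet.const _) ?_)
  · exact MeasurableSet.iInter fun j => MeasurableSet.iInter fun _ => (hgood j).compl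
  · exact MeasurableSet.iInter fun j => (hgood j).compl

theorem measurable_satisficingArm [IsSFiniteKernel K] (hB : IsNoisyBandit P μ K R θ Y)
    (hA : IsSTS P K R θ Y ξ ε σ g A) : Measurable (satisficingArm θ A ε) := by
  have h1 : Measurable fun q : Ω × ℕ => A q.2 q.1 :=
    measurable_from_prod_countable_left fun n => measurable_action hB hA n
  exact h1.comp (measurable_id.prodMk (measurable_satisficingTime hB hA))

/-- The parameters under which the arm at position `n` of the order `s` is the first one that
reaches the level `c`. -/
def firstInOrder (c : ℝ) (s : ℕ → ℕ) (n : ℕ) : Set (ℕ → ℝ) :=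
  {x | c ≤ x (s n) ∧ ∀ j < n, x (s j) < c}

/-- At the satisficing time the played arms are all bad and form an initial segment of the order,
and the good arm then played must be the next one. So the benchmark depends only on the parameter
and the order: neither the draws nor the observations affect it. -/
theorem exists_satisficingArm_eq_order (hA : IsSTS P K R θ Y ξ ε σ g A) {ω : Ω}
    (hex : ∃ t : ℕ, 1 - ε ≤ θ ω (A t ω)) :
    ∃ n, satisficingArm θ A ε ω = σ (ξ ω) n ∧ θ ω ∈ firstInOrder (1 - ε) (σ (ξ ω)) n := by
  set τ := satisficingTime θ A ε ω with hτ
  have hbad : θ ω ∈ allBad (1 - ε) (history Y A τ ω) := by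
    intro i
    by_contra hc
    have hle : satisficingTime θ A ε ω ≤ i :=
      Nat.sInf_le (show (i : ℕ) ∈ {t : ℕ | 1 - ε ≤ θ ω (A t ω)} from not_lt.1 hc)
    exact absurd i.2 (not_lt.2 hle)
  have hgood : 1 - ε ≤ θ ω (A τ ω) := Nat.sInf_mem hex
  have hnew : A τ ω ∉ arms (history Y A τ ω) := by
    intro hmem
    obtain ⟨i, hi⟩ := mem_arms.1 hmem
    have := hbad i
    rw [hi] at this
    exact absurd this (not_lt.2 hgood)
  have hord := (action_mem_or hA τ ω).resolve_left hnew
  refine ⟨(arms (history Y A τ ω)).card, hord, ?_, fun j hj => ?_⟩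
  · rw [← hord]; exact hgood
  · have hmem : σ (ξ ω) j ∈ arms (history Y A τ ω) := by
      rw [arms_history_eq hA τ ω]
      exact Finset.mem_image.2 ⟨j, Finset.mem_range.2 hj, rfl⟩
    obtain ⟨i, hi⟩ := mem_arms.1 hmem
    rw [← hi]
    exact hbad i

theorem eq_of_mem_firstInOrder {c : ℝ} {s : ℕ → ℕ} {m n : ℕ} {x : ℕ → ℝ}
    (hm : x ∈ firstInOrder c s m) (hn : x ∈ firstInOrder c s n) : m = n := by
  rcases lt_trichotomy m n with h | h | h
  · exact absurd (hn.2 m h) (not_lt.2 hm.1)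
  · exact h
  · exact absurd (hm.2 n h) (not_lt.2 hn.1)

/-- Injectivity of the order makes the parameters at its first `n + 1` positions independent: `n`
failures followed by a success. -/
theorem infinitePi_firstInOrder [IsProbabilityMeasure μ] (c : ℝ) {s : ℕ → ℕ}
    (hs : Function.Injective s) (n : ℕ) :
    (Measure.infinitePi fun _ : ℕ => μ) (firstInOrder c s n)
      = μ (Set.Ici c) * μ (Set.Iio c) ^ n := by
  classical
  set T : ℕ → Set ℝ := fun i => if i = s n then Set.Ici c else Set.Iio c with hT
  have hTm : ∀ i, MeasurableSet (T i) := fun i => by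
    simp only [hT]; split_ifs; exacts [measurableSet_Ici, measurableSet_Iio]
  have hset : firstInOrder c s n = Set.pi ((Finset.range (n + 1)).image s : Finset ℕ) T := by
    ext x
    simp only [firstInOrder, Set.mem_ofPred_eq, Set.mem_pi, Finset.coe_image, Finset.coe_range,
      Set.mem_image, Set.mem_Iio, forall_exists_index, and_imp, forall_apply_eq_imp_iff₂]
    constructor
    · rintro ⟨h1, h2⟩ j hj
      rcases Nat.lt_succ_iff_lt_or_eq.1 hj with h | rfl
      · simp only [hT]
        rw [if_neg fun hc => h.ne (hs hc)]
        exact h2 j h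
      · simp only [hT, if_true]; exact h1
    · intro h
      refine ⟨?_, fun j hj => ?_⟩
      · simpa [hT] using h n (Nat.lt_succ_self n)
      · have := h j (hj.trans (Nat.lt_succ_self n))
        simp only [hT] at this
        rw [if_neg fun hc => hj.ne (hs hc)] at this
        exact this
  rw [hset, Measure.infinitePi_pi (μ := fun _ : ℕ => μ) fun i _ => hTm i,
    Finset.prod_image fun i _ j _ h => hs h, Finset.prod_range_succ]
  have h1 : ∏ x ∈ Finset.range n, μ (T (s x)) = μ (Set.Iio c) ^ n := by
    rw [Finset.prod_congr rfl (g := fun _ => μ (Set.Iio c)), Finset.prod_const, Finset.card_range]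
    intro j hj
    simp only [hT]
    rw [if_neg fun hc => (Finset.mem_range.1 hj).ne (hs hc)]
  rw [h1]
  simp only [hT, if_true]
  rw [mul_comm]

/-- As `ξ` is independent of the parameter, the order can be frozen and the position of the first
good arm is geometric. The order need not exhaust the arms, hence the separate claim about arms
outside its range. -/
theorem ae_condDistrib_satisficingArm [StandardBorelSpace 𝒴] [Nonempty 𝒴]
    [IsProbabilityMeasure P] [IsProbabilityMeasure μ] [IsMarkovKernel K]
    (hB : IsNoisyBandit P μ K R θ Y) (hA : IsSTS P K R θ Y ξ ε σ g A) (hε : 0 < ε) :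
    ∀ᵐ ω ∂P, (∀ n, condDistrib (satisficingArm θ A ε) ξ P (ξ ω) {σ (ξ ω) n}
        = μ (Set.Ici (1 - ε)) * μ (Set.Iio (1 - ε)) ^ n) ∧
      condDistrib (satisficingArm θ A ε) ξ P (ξ ω) (Set.range (σ (ξ ω)))ᶜ = 0 := by
  set c := 1 - ε with hc
  have hξ := hA.measurable_exo
  have hÃ := measurable_satisficingArm hB hA
  have hex := ae_exists_satisficing hB hA hε
  have hσ : ∀ n, Measurable fun z => σ z n := fun n =>
    (measurable_pi_apply n).comp hA.measurable_order
  have hind : IndepFun ξ θ P := hA.indep_exo.comp measurable_id measurable_fst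
  have hprod := (indepFun_iff_map_prod_eq_prod_map_map hξ.aemeasurable
    hB.measurable_param.aemeasurable).1 hind
  rw [hB.param_iid] at hprod
  have h1 : ∀ n, ∀ᵐ ω ∂P, condDistrib (satisficingArm θ A ε) ξ P (ξ ω) {σ (ξ ω) n}
      = μ (Set.Ici c) * μ (Set.Iio c) ^ n := by
    intro n
    have hS : MeasurableSet {q : Ξ × ℕ | q.2 = σ q.1 n} :=
      measurableSet_eq_fun measurable_snd ((hσ n).comp measurable_fst)
    have hE : MeasurableSet {q : Ξ × (ℕ → ℝ) | q.2 ∈ firstInOrder c (σ q.1) n} := by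
      have : {q : Ξ × (ℕ → ℝ) | q.2 ∈ firstInOrder c (σ q.1) n}
          = {q | c ≤ q.2 (σ q.1 n)} ∩ ⋂ j, ⋂ _ : j < n, {q | q.2 (σ q.1 j) < c} := by
        ext; simp [firstInOrder]
      rw [this]
      have hm : ∀ j, Measurable fun q : Ξ × (ℕ → ℝ) => q.2 (σ q.1 j) := fun j =>
        Measurable.eval_nat measurable_snd ((hσ j).comp measurable_fst)
      exact (measurableSet_le measurable_const (hm n)).inter (MeasurableSet.iInter fun j =>
        MeasurableSet.iInter fun _ => measurableSet_lt (hm j) measurable_const)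
    have := ae_lintegral_condDistrib_eq (P := P) hξ hÃ
      (f := {q : Ξ × ℕ | q.2 = σ q.1 n}.indicator fun _ => 1) (measurable_const.indicator hS)
      (w := fun _ => μ (Set.Ici c) * μ (Set.Iio c) ^ n) measurable_const (by
        intro D hD
        rw [← lintegral_indicator (hξ hD), lintegral_const, Measure.restrict_apply_univ]
        have e : ∫⁻ ω, (ξ ⁻¹' D).indicator (fun ω => {q : Ξ × ℕ | q.2 = σ q.1 n}.indicator
            (fun _ => (1 : ℝ≥0∞)) (ξ ω, satisficingArm θ A ε ω)) ω ∂P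
            = ∫⁻ ω, (fun q : Ξ × (ℕ → ℝ) => D.indicator (fun _ => (1 : ℝ≥0∞)) q.1
              * {q : Ξ × (ℕ → ℝ) | q.2 ∈ firstInOrder c (σ q.1) n}.indicator (fun _ => 1) q)
                (ξ ω, θ ω) ∂P := by
          refine lintegral_congr_ae ?_
          filter_upwards [hex] with ω hω
          obtain ⟨m, hm1, hm2⟩ := exists_satisficingArm_eq_order hA hω
          have hiff : satisficingArm θ A ε ω = σ (ξ ω) n ↔ θ ω ∈ firstInOrder c (σ (ξ ω)) n := by
            rw [hm1]
            constructor
            · intro h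
              rw [← hA.injective_order _ h]; exact hm2
            · intro h
              rw [eq_of_mem_firstInOrder hm2 h]
          by_cases hD' : ξ ω ∈ D <;> by_cases h2 : θ ω ∈ firstInOrder c (σ (ξ ω)) n <;>
            simp [hD', h2, hiff]
        have hm : Measurable fun q : Ξ × (ℕ → ℝ) => D.indicator (fun _ => (1 : ℝ≥0∞)) q.1
              * {q : Ξ × (ℕ → ℝ) | q.2 ∈ firstInOrder c (σ q.1) n}.indicator (fun _ => 1) q :=
          ((measurable_const.indicator hD).comp measurable_fst).mul (measurable_const.indicator hE)
        rw [e, ← lintegral_map hm (hξ.prodMk hB.measurable_param), hprod,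
          lintegral_prod _ hm.aemeasurable]
        have e2 : ∀ z, ∫⁻ x, D.indicator (fun _ => (1 : ℝ≥0∞)) z
              * {q : Ξ × (ℕ → ℝ) | q.2 ∈ firstInOrder c (σ q.1) n}.indicator (fun _ => 1) (z, x)
                ∂(Measure.infinitePi fun _ : ℕ => μ)
            = D.indicator (fun _ => (1 : ℝ≥0∞)) z * (μ (Set.Ici c) * μ (Set.Iio c) ^ n) := by
          intro z
          rw [lintegral_const_mul]
          · congr 1
            have hEz : MeasurableSet (firstInOrder c (σ z) n) := measurable_prodMk_left hE
            rw [← infinitePi_firstInOrder c (hA.injective_order z) n,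
              ← lintegral_indicator_one hEz]
            rfl
          · exact (measurable_const.indicator hE).comp measurable_prodMk_left
        dsimp only
        simp_rw [e2]
        rw [lintegral_mul_const _ (measurable_const.indicator hD), lintegral_indicator_const hD,
          one_mul, Measure.map_apply hξ hD, mul_comm])
    filter_upwards [this] with ω hω
    rw [← hω, ← lintegral_indicator_one (measurableSet_singleton _)]
    rfl
  have h2 : ∀ᵐ ω ∂P, condDistrib (satisficingArm θ A ε) ξ P (ξ ω) (Set.range (σ (ξ ω)))ᶜ = 0 := by
    have hS : MeasurableSet {q : Ξ × ℕ | q.2 ∈ (Set.range (σ q.1))ᶜ} := by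
      have : {q : Ξ × ℕ | q.2 ∈ (Set.range (σ q.1))ᶜ} = ⋂ n, {q | σ q.1 n = q.2}ᶜ := by
        ext; simp
      rw [this]
      exact MeasurableSet.iInter fun n =>
        (measurableSet_eq_fun ((hσ n).comp measurable_fst) measurable_snd).compl
    have := ae_lintegral_condDistrib_eq (P := P) hξ hÃ
      (f := {q : Ξ × ℕ | q.2 ∈ (Set.range (σ q.1))ᶜ}.indicator fun _ => 1)
      (measurable_const.indicator hS) (w := fun _ => 0) measurable_const (by
        intro D hD
        refine lintegral_congr_ae (ae_restrict_of_ae ?_)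
        filter_upwards [hex] with ω hω
        obtain ⟨m, hm1, -⟩ := exists_satisficingArm_eq_order hA hω
        rw [Set.indicator_of_notMem]
        intro h
        exact h ⟨m, hm1.symm⟩)
    filter_upwards [this] with ω hω
    rw [← hω, ← lintegral_indicator_one (Set.to_countable _).measurableSet]
    rfl
  filter_upwards [ae_all_iff.2 h1, h2] with ω a b using ⟨a, b⟩

/-- The entropy bound for the satisficing arm. -/
theorem condEntropy_satisficingArm_le [StandardBorelSpace 𝒴] [Nonempty 𝒴]
    [IsProbabilityMeasure P] [IsProbabilityMeasure μ] [IsMarkovKernel K]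
    (hB : IsNoisyBandit P μ K R θ Y) (hA : IsSTS P K R θ Y ξ ε σ g A) (hε : 0 < ε) :
    condEntropy P (satisficingArm θ A ε) ξ
      ≤ ENNReal.ofReal (1 + Real.log (1 / μ.real (Set.Ioi (1 - ε)))) := by
  set c := 1 - ε with hc
  set p := μ.real (Set.Ici c) with hp
  have hδ0 : 0 < μ.real (Set.Ioi c) :=
    ENNReal.toReal_pos (measure_Ioi_pos_of_support hB.support_prior (by linarith)).ne'
      (measure_ne_top _ _)
  have hδp : μ.real (Set.Ioi c) ≤ p := measureReal_mono Set.Ioi_subset_Ici_self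
  have hp0 : 0 < p := hδ0.trans_le hδp
  have hp1 : p ≤ 1 := measureReal_le_one
  have hq : μ.real (Set.Iio c) = 1 - p := by
    rw [hp, ← Set.compl_Ici, probReal_compl_eq_one_sub measurableSet_Ici]
  have hgeo := (tsum_negMulLog_geometric_le hp0 hp1).trans (ENNReal.ofReal_le_ofReal
    (show 1 + Real.log (1 / p) ≤ 1 + Real.log (1 / μ.real (Set.Ioi c)) by
      gcongr))
  have hm : ∀ a : ℕ, Measurable fun z =>
      ENNReal.ofReal (Real.negMulLog ((condDistrib (satisficingArm θ A ε) ξ P z).real {a})) :=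
    fun a => ENNReal.measurable_ofReal.comp (Real.continuous_negMulLog.measurable.comp
      (Kernel.measurable_coe _ (measurableSet_singleton a)).ennreal_toReal)
  rw [condEntropy, lintegral_map (Measurable.tsum hm) hA.measurable_exo]
  refine le_trans (lintegral_mono_ae (g := fun _ =>
    ENNReal.ofReal (1 + Real.log (1 / μ.real (Set.Ioi c)))) ?_) (by simp)
  filter_upwards [ae_condDistrib_satisficingArm hB hA hε] with ω hω
  refine le_trans (le_of_eq ?_) hgeo
  have hinj := hA.injective_order (ξ ω)
  -- The sum over arms is reindexed by position in the order; arms outside the range have mass 0 and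
  -- contribute nothing.
  rw [← hinj.tsum_eq]
  · congr 1 with n
    congr 2
    rw [measureReal_def, hω.1 n, ENNReal.toReal_mul, ENNReal.toReal_pow, ← hq]
    rfl
  · intro a ha
    by_contra hna
    apply ha
    have h0 : condDistrib (satisficingArm θ A ε) ξ P (ξ ω) {a} = 0 :=
      measure_mono_null (Set.singleton_subset_iff.2 hna) hω.2
    simp [measureReal_def, h0]

end SatisficingArm

/-! ### Posterior quantities of the played arm, and their measurability. -/

section PosteriorMasses

variable {𝒴 Ξ : Type*} [MeasurableSpace 𝒴] [MeasurableSpace Ξ] {t : ℕ}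

theorem measurableSet_mem_arms_pair :
    MeasurableSet {q : (Fin t → ℕ × 𝒴) × ℕ | q.2 ∈ arms q.1} := by
  have : {q : (Fin t → ℕ × 𝒴) × ℕ | q.2 ∈ arms q.1} = ⋃ a, {q | q.1 ∈ {h | a ∈ arms h}} ∩ {q | q.2 = a} := by
    ext; simp
  rw [this]
  exact MeasurableSet.iUnion fun a => (measurable_fst (measurableSet_mem_arms a)).inter
    (measurable_snd (measurableSet_singleton a))

theorem measurableSet_firstGood_pair (c : ℝ) :
    MeasurableSet {q : ((Fin t → ℕ × 𝒴) × ℕ) × (ℕ → ℝ) | q.2 ∈ firstGood c q.1.1 q.1.2} := by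
  have : {q : ((Fin t → ℕ × 𝒴) × ℕ) × (ℕ → ℝ) | q.2 ∈ firstGood c q.1.1 q.1.2}
      = ⋃ a, (fun q => (q.1.1, q.2)) ⁻¹' {q | q.2 ∈ firstGood c q.1 a} ∩ {q | q.1.2 = a} := by
    ext; simp
  rw [this]
  exact MeasurableSet.iUnion fun a =>
    ((show Measurable fun q : ((Fin t → ℕ × 𝒴) × ℕ) × (ℕ → ℝ) => (q.1.1, q.2) by fun_prop)
      (measurableSet_firstGood c a)).inter
    ((show Measurable fun q : ((Fin t → ℕ × 𝒴) × ℕ) × (ℕ → ℝ) => q.1.2 by fun_prop)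
      (measurableSet_singleton a))

theorem update_mem_firstGood_iff {c : ℝ} {h : Fin t → ℕ × 𝒴} {x : ℕ → ℝ} {a b : ℕ} {r : ℝ}
    (hb : b ∉ arms h) : Function.update x b r ∈ firstGood c h a ↔ x ∈ firstGood c h a := by
  have : ∀ i, Function.update x b r (h i).1 = x (h i).1 := fun i =>
    Function.update_of_ne (fun hc => hb (mem_arms.2 ⟨i, hc⟩)) _ _
  simp only [firstGood, Set.mem_ofPred_eq, this]

theorem le_of_mem_firstGood {c : ℝ} {h : Fin t → ℕ × 𝒴} {x : ℕ → ℝ} {a : ℕ}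
    (hx : x ∈ firstGood c h a) : c ≤ x a := by
  obtain ⟨i, rfl, hi, -⟩ := hx
  exact hi

theorem measurable_lintegral_kernel_fst {E : Type*} [MeasurableSpace E]
    (k : Kernel (Fin t → ℕ × 𝒴) (ℕ → ℝ)) [IsSFiniteKernel k]
    {f : ((Fin t → ℕ × 𝒴) × E) × (ℕ → ℝ) → ℝ≥0∞} (hf : Measurable f) :
    Measurable fun q : (Fin t → ℕ × 𝒴) × E => ∫⁻ x, f (q, x) ∂(k q.1) :=
  Measurable.lintegral_kernel_prod_right' (κ := k.comap Prod.fst measurable_fst) hf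

/-- The posterior expectation of a weight of the parameter of arm `a`, on the event that `a` is the
earliest arm of the history that reaches the level `c`. -/
def firstMass (k : Kernel (Fin t → ℕ × 𝒴) (ℕ → ℝ)) (c : ℝ) (w : ℝ → ℝ≥0∞) (h : Fin t → ℕ × 𝒴)
    (a : ℕ) : ℝ≥0∞ :=
  ∫⁻ x, (firstGood c h a).indicator (fun x => w (x a)) x ∂(k h)

/-- The posterior expectation of a weight of the parameter of a new arm, on the event that this
is the first arm to reach the level `c`. -/
def newMass (μ : Measure ℝ) (k : Kernel (Fin t → ℕ × 𝒴) (ℕ → ℝ)) (c : ℝ) (w : ℝ → ℝ≥0∞)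
    (h : Fin t → ℕ × 𝒴) : ℝ≥0∞ :=
  k h (allBad c h) * ∫⁻ r in Set.Ici c, w r ∂μ

/-- The posterior mean of the parameter of arm `a`. -/
def armMean (k : Kernel (Fin t → ℕ × 𝒴) (ℕ → ℝ)) (h : Fin t → ℕ × 𝒴) (a : ℕ) : ℝ≥0∞ :=
  ∫⁻ x, ENNReal.ofReal (x a) ∂(k h)

variable {μ : Measure ℝ} {k : Kernel (Fin t → ℕ × 𝒴) (ℕ → ℝ)} [IsMarkovKernel k] {c : ℝ}
  {w : ℝ → ℝ≥0∞} {π : (Fin t → ℕ × 𝒴) × Ξ → ℕ}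

theorem measurable_firstMass (hw : Measurable w) :
    Measurable fun q : (Fin t → ℕ × 𝒴) × ℕ => firstMass k c w q.1 q.2 := by
  refine measurable_lintegral_kernel_fst (E := ℕ) k
    (f := fun q => (firstGood c q.1.1 q.1.2).indicator (fun x => w (x q.1.2)) q.2) ?_
  exact Measurable.indicator (s := {q : ((Fin t → ℕ × 𝒴) × ℕ) × (ℕ → ℝ) |
    q.2 ∈ firstGood c q.1.1 q.1.2}) (f := fun q => w (q.2 q.1.2))
    (hw.comp (Measurable.eval_nat measurable_snd (by fun_prop))) (measurableSet_firstGood_pair c)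

theorem measurable_newMass : Measurable (newMass μ k c w) :=
  (measurable_kernel_allBad k c).mul_const _

theorem measurable_armMean : Measurable fun q : (Fin t → ℕ × 𝒴) × ℕ => armMean k q.1 q.2 :=
  measurable_lintegral_kernel_fst (E := ℕ) k (f := fun q => ENNReal.ofReal (q.2 q.1.2))
    (ENNReal.measurable_ofReal.comp (Measurable.eval_nat measurable_snd (by fun_prop)))

open Classical in
/-- A function of the played arm and the history, with a separate value for new arms. -/
def byArm (π : (Fin t → ℕ × 𝒴) × Ξ → ℕ) (Φ : (Fin t → ℕ × 𝒴) → ℕ → ℝ≥0∞)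
    (φ : (Fin t → ℕ × 𝒴) → ℝ≥0∞) (q : (Fin t → ℕ × 𝒴) × Ξ) : ℝ≥0∞ :=
  if π q ∈ arms q.1 then Φ q.1 (π q) else φ q.1

theorem measurableSet_old (hπ : Measurable π) :
    MeasurableSet {q : (Fin t → ℕ × 𝒴) × Ξ | π q ∈ arms q.1} :=
  (show Measurable fun q : (Fin t → ℕ × 𝒴) × Ξ => (q.1, π q) from measurable_fst.prodMk hπ)
    measurableSet_mem_arms_pair

theorem measurable_byArm (hπ : Measurable π) {Φ : (Fin t → ℕ × 𝒴) → ℕ → ℝ≥0∞}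
    {φ : (Fin t → ℕ × 𝒴) → ℝ≥0∞}
    (hΦ : Measurable fun q : (Fin t → ℕ × 𝒴) × ℕ => Φ q.1 q.2) (hφ : Measurable φ) :
    Measurable (byArm π Φ φ) := by
  classical
  refine Measurable.ite (measurableSet_old hπ) ?_ (hφ.comp measurable_fst)
  exact hΦ.comp (measurable_fst.prodMk hπ)

/-- The event that the played arm is the satisficing arm, in terms of the state. -/
def hitSet (c : ℝ) (π : (Fin t → ℕ × 𝒴) × Ξ → ℕ) :
    Set (((Fin t → ℕ × 𝒴) × Ξ) × (ℕ → ℝ)) :=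
  {p | (π p.1 ∈ arms p.1.1 ∧ p.2 ∈ firstGood c p.1.1 (π p.1)) ∨
    (π p.1 ∉ arms p.1.1 ∧ p.2 ∈ allBad c p.1.1 ∧ c ≤ p.2 (π p.1))}

theorem measurableSet_firstGood_policy (hπ : Measurable π) :
    MeasurableSet {p : ((Fin t → ℕ × 𝒴) × Ξ) × (ℕ → ℝ) | p.2 ∈ firstGood c p.1.1 (π p.1)} :=
  (show Measurable fun p : ((Fin t → ℕ × 𝒴) × Ξ) × (ℕ → ℝ) => ((p.1.1, π p.1), p.2) by fun_prop)
    (measurableSet_firstGood_pair c)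

theorem measurableSet_allBad_fst :
    MeasurableSet {p : ((Fin t → ℕ × 𝒴) × Ξ) × (ℕ → ℝ) | p.2 ∈ allBad c p.1.1} :=
  (show Measurable fun p : ((Fin t → ℕ × 𝒴) × Ξ) × (ℕ → ℝ) => (p.1.1, p.2) by fun_prop)
    (measurableSet_allBad c)

theorem measurable_eval_policy (hπ : Measurable π) :
    Measurable fun p : ((Fin t → ℕ × 𝒴) × Ξ) × (ℕ → ℝ) => p.2 (π p.1) :=
  Measurable.eval_nat measurable_snd (hπ.comp measurable_fst)

theorem measurableSet_hitSet (hπ : Measurable π) : MeasurableSet (hitSet c π) := by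
  have hold : MeasurableSet {p : ((Fin t → ℕ × 𝒴) × Ξ) × (ℕ → ℝ) | π p.1 ∈ arms p.1.1} :=
    measurable_fst (measurableSet_old hπ)
  refine (hold.inter (measurableSet_firstGood_policy hπ)).union (hold.compl.inter
    (measurableSet_allBad_fst.inter (measurableSet_le measurable_const (measurable_eval_policy hπ))))

end PosteriorMasses

/-! ### Conditional expectations given the state, and the law of the played arm given the history.
-/

section PosteriorIdentities

variable {Ω 𝒴 Ξ : Type*} [MeasurableSpace Ω] [MeasurableSpace 𝒴] [MeasurableSpace Ξ]
  {P : Measure Ω} {μ : Measure ℝ} {K : Kernel (ℕ → ℝ) (ℕ → 𝒴)} {R : 𝒴 → ℝ} {θ : Ω → ℕ → ℝ}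
  {Y : ℕ∞ → Ω → ℕ → 𝒴} {ξ : Ω → Ξ} {ε : ℝ} {σ : Ξ → ℕ → ℕ}
  {g : (t : ℕ) → (Fin t → ℕ × 𝒴) × Ξ → ℕ → ℝ} {A : ℕ → Ω → ℕ} {t : ℕ}
  {k : Kernel (Fin t → ℕ × 𝒴) (ℕ → ℝ)} {π : (Fin t → ℕ × 𝒴) × Ξ → ℕ} {w : ℝ → ℝ≥0∞}

theorem measurable_state [IsSFiniteKernel K] (hB : IsNoisyBandit P μ K R θ Y)
    (hA : IsSTS P K R θ Y ξ ε σ g A) (t : ℕ) :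
    Measurable fun ω => (history Y A t ω, ξ ω) :=
  (measurable_history hB hA t).prodMk hA.measurable_exo

theorem setLIntegral_posterior [IsMarkovKernel K] (hB : IsNoisyBandit P μ K R θ Y)
    (hA : IsSTS P K R θ Y ξ ε σ g A) [IsMarkovKernel k] (hk : IsPosterior P Y A ξ θ t k)
    {S : Set ((Fin t → ℕ × 𝒴) × Ξ)} (hS : MeasurableSet S)
    {f : ((Fin t → ℕ × 𝒴) × Ξ) × (ℕ → ℝ) → ℝ≥0∞} (hf : Measurable f) :
    ∫⁻ ω in (fun ω => (history Y A t ω, ξ ω)) ⁻¹' S, f (fullState Y A ξ θ t ω) ∂P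
      = ∫⁻ ω in (fun ω => (history Y A t ω, ξ ω)) ⁻¹' S,
          ∫⁻ x, f ((history Y A t ω, ξ ω), x) ∂(k (history Y A t ω)) ∂P := by
  have hm := measurable_state hB hA t
  rw [← lintegral_indicator (hm hS), ← lintegral_indicator (hm hS)]
  have := hk (fun p => (Prod.fst ⁻¹' S).indicator f p) (hf.indicator (measurable_fst hS))
  refine Eq.trans (lintegral_congr fun ω => ?_) (this.trans (lintegral_congr fun ω => ?_))
  · by_cases h : (history Y A t ω, ξ ω) ∈ S
    · rw [Set.indicator_of_mem (by exact h), Set.indicator_of_mem (by exact h)]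
    · rw [Set.indicator_of_notMem (by exact h), Set.indicator_of_notMem (by exact h)]
  · by_cases h : (history Y A t ω, ξ ω) ∈ S
    · rw [Set.indicator_of_mem (by exact h)]
      refine lintegral_congr fun x => ?_
      rw [Set.indicator_of_mem (by exact h)]
    · rw [Set.indicator_of_notMem (by exact h), ← lintegral_zero (μ := k (history Y A t ω))]
      refine lintegral_congr fun x => ?_
      rw [Set.indicator_of_notMem (by exact h)]

/-- Expectations of a weight of the parameter of the played arm, given the history and the
exogenous variable. -/
theorem setLIntegral_mul_action [Nonempty 𝒴] [IsProbabilityMeasure P] [IsProbabilityMeasure μ]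
    [IsMarkovKernel K] (hB : IsNoisyBandit P μ K R θ Y) (hA : IsSTS P K R θ Y ξ ε σ g A)
    [IsMarkovKernel k] (hk : IsPosterior P Y A ξ θ t k) (hπ : Measurable π)
    (hAπ : ∀ ω, A t ω = π (history Y A t ω, ξ ω))
    {G : ((Fin t → ℕ × 𝒴) × Ξ) × (ℕ → ℝ) → ℝ≥0∞} (hG : Measurable G)
    (hGinv : ∀ q x b r, b ∉ arms q.1 → G (q, Function.update x b r) = G (q, x))
    (hw : Measurable w) {Φ : (Fin t → ℕ × 𝒴) → ℕ → ℝ≥0∞} {φ : (Fin t → ℕ × 𝒴) → ℝ≥0∞}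
    (hΦ : ∀ q, π q ∈ arms q.1 → ∫⁻ x, G (q, x) * w (x (π q)) ∂(k q.1) = Φ q.1 (π q))
    (hφ : ∀ q, π q ∉ arms q.1 → (∫⁻ x, G (q, x) ∂(k q.1)) * ∫⁻ r, w r ∂μ = φ q.1)
    {D : Set ((Fin t → ℕ × 𝒴) × Ξ)} (hD : MeasurableSet D) :
    ∫⁻ ω in (fun ω => (history Y A t ω, ξ ω)) ⁻¹' D,
        G (fullState Y A ξ θ t ω) * w (θ ω (A t ω)) ∂P
      = ∫⁻ ω in (fun ω => (history Y A t ω, ξ ω)) ⁻¹' D,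
          byArm π Φ φ (history Y A t ω, ξ ω) ∂P := by
  have hm := measurable_state hB hA t
  have hold := measurableSet_old (t := t) hπ
  set O : Set ((Fin t → ℕ × 𝒴) × Ξ) := {q | π q ∈ arms q.1} with hO
  -- Where the played arm is old, its parameter is integrated against the posterior. Where it is
  -- fresh, the parameter has law `μ` independently of `G`, so the integral factorizes.
  rw [← lintegral_inter_add_sdiff _ _ (hm hold), ← lintegral_inter_add_sdiff (μ := P)
    (fun ω => byArm π Φ φ (history Y A t ω, ξ ω)) _ (hm hold), ← Set.preimage_inter,
    ← Set.preimage_sdiff]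
  congr 1
  · have h1 := setLIntegral_posterior hB hA hk (hD.inter hold)
      (f := fun p => G p * w (p.2 (π p.1))) (hG.mul (hw.comp (measurable_eval_policy hπ)))
    refine Eq.trans ?_ (h1.trans ?_)
    · refine setLIntegral_congr_fun (hm (hD.inter hold)) fun ω _ => ?_
      rw [hAπ]; rfl
    · refine setLIntegral_congr_fun (hm (hD.inter hold)) fun ω hω => ?_
      have hω' : π (history Y A t ω, ξ ω) ∈ arms (history Y A t ω) := hω.2
      dsimp only
      rw [byArm, if_pos hω', ← hΦ _ hω']
  · have hDO := hD.diff hold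
    have h1 := setLIntegral_posterior hB hA hk hDO hG
    have h2 := setLIntegral_new_mul hB hA t (G := (Prod.fst ⁻¹' D).indicator G)
      (hG.indicator (measurable_fst hD)) (by
        intro q x b r hb
        by_cases hq : q ∈ D
        · rw [Set.indicator_of_mem (by exact hq), Set.indicator_of_mem (by exact hq), hGinv q x b r hb]
        · rw [Set.indicator_of_notMem (by exact hq), Set.indicator_of_notMem (by exact hq)]) hw
    have hset : ∀ f : Ω → ℝ≥0∞, ∫⁻ ω in {ω | A t ω ∉ arms (history Y A t ω)},
        ((fun ω => (history Y A t ω, ξ ω)) ⁻¹' D).indicator f ω ∂P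
        = ∫⁻ ω in (fun ω => (history Y A t ω, ξ ω)) ⁻¹' (D \ O), f ω ∂P := by
      intro f
      rw [setLIntegral_indicator (hm hD)]
      congr 2
      ext ω
      simp only [hO, Set.mem_inter_iff, Set.mem_preimage, Set.mem_ofPred_eq, Set.mem_sdiff, hAπ]
    have e1 : ∀ ω, (Prod.fst ⁻¹' D).indicator G (fullState Y A ξ θ t ω) * w (θ ω (A t ω))
        = ((fun ω => (history Y A t ω, ξ ω)) ⁻¹' D).indicator
          (fun ω => G (fullState Y A ξ θ t ω) * w (θ ω (A t ω))) ω := by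
      intro ω
      by_cases hq : (history Y A t ω, ξ ω) ∈ D
      · rw [Set.indicator_of_mem (by exact hq), Set.indicator_of_mem (by exact hq)]
      · rw [Set.indicator_of_notMem (by exact hq), Set.indicator_of_notMem (by exact hq), zero_mul]
    have e2 : ∀ ω, (Prod.fst ⁻¹' D).indicator G (fullState Y A ξ θ t ω)
        = ((fun ω => (history Y A t ω, ξ ω)) ⁻¹' D).indicator
          (fun ω => G (fullState Y A ξ θ t ω)) ω := fun ω => rfl
    simp_rw [e1, e2, hset] at h2
    rw [h2, h1, ← lintegral_mul_const]
    · refine setLIntegral_congr_fun (hm hDO) fun ω hω => ?_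
      have hω' : π (history Y A t ω, ξ ω) ∉ arms (history Y A t ω) := hω.2
      rw [byArm, if_neg hω', ← hφ _ hω']
    · exact (measurable_lintegral_kernel_fst k hG).comp hm

/-- The law of the played arm given the history. -/
theorem lintegral_byArm [IsProbabilityMeasure μ] [IsMarkovKernel K]
    (hB : IsNoisyBandit P μ K R θ Y) (hA : IsSTS P K R θ Y ξ ε σ g A)
    [IsMarkovKernel k] (hk : IsPosterior P Y A ξ θ t k)
    (hAπ : ∀ ω, A t ω = π (history Y A t ω, ξ ω))
    {Φ : (Fin t → ℕ × 𝒴) → ℕ → ℝ≥0∞} {φ : (Fin t → ℕ × 𝒴) → ℝ≥0∞}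
    (hΦ : Measurable fun q : (Fin t → ℕ × 𝒴) × ℕ => Φ q.1 q.2) (hφ : Measurable φ)
    {D : Set (Fin t → ℕ × 𝒴)} (hD : MeasurableSet D) :
    ∫⁻ ω in history Y A t ⁻¹' D, byArm π Φ φ (history Y A t ω, ξ ω) ∂P
      = ∫⁻ ω in history Y A t ⁻¹' D, (∑' a, k (history Y A t ω)
            (firstGood (1 - ε) (history Y A t ω) a) * Φ (history Y A t ω) a
          + k (history Y A t ω) (allBad (1 - ε) (history Y A t ω)) * φ (history Y A t ω)) ∂P := by
  set c := 1 - ε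
  have hF := measurable_history hB hA t
  have hΦa : ∀ a, Measurable fun h => Φ h a := fun a =>
    hΦ.comp (measurable_id.prodMk measurable_const)
  set f : (Fin t → ℕ × 𝒴) × (ℕ → ℝ) → ℝ≥0∞ := fun q =>
    ∑' a, {q : (Fin t → ℕ × 𝒴) × (ℕ → ℝ) | q.2 ∈ firstGood c q.1 a}.indicator (fun q => Φ q.1 a) q
      + {q : (Fin t → ℕ × 𝒴) × (ℕ → ℝ) | q.2 ∈ allBad c q.1}.indicator (fun q => φ q.1) q with hf
  have hfa : ∀ a, Measurable ({q : (Fin t → ℕ × 𝒴) × (ℕ → ℝ) |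
      q.2 ∈ firstGood c q.1 a}.indicator (fun q => Φ q.1 a)) := fun a =>
    ((hΦa a).comp measurable_fst).indicator (measurableSet_firstGood c a)
  have hfb : Measurable ({q : (Fin t → ℕ × 𝒴) × (ℕ → ℝ) |
      q.2 ∈ allBad c q.1}.indicator (fun q => φ q.1)) :=
    (hφ.comp measurable_fst).indicator (measurableSet_allBad c)
  have hfm : Measurable f := (Measurable.tsum hfa).add hfb
  have h1 : ∀ᵐ ω ∂P, byArm π Φ φ (history Y A t ω, ξ ω)
      = f (history Y A t ω, g t (history Y A t ω, ξ ω)) := by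
    filter_upwards [ae_mem_firstGood_iff hB hA t] with ω hω
    simp only [hf]
    by_cases ho : A t ω ∈ arms (history Y A t ω)
    · have hg := (hω.1 (A t ω)).1 ⟨rfl, ho⟩
      rw [byArm, ← hAπ, if_pos ho, tsum_eq_single (A t ω),
        Set.indicator_of_mem (by exact hg), Set.indicator_of_notMem, add_zero]
      · exact notMem_allBad_of_mem_firstGood hg
      · intro a ha
        exact Set.indicator_of_notMem (fun hc => ha (eq_of_mem_firstGood (by exact hc) hg)) _
    · have hg := hω.2.1 ho
      rw [byArm, ← hAπ, if_neg ho, ENNReal.tsum_eq_zero.2, zero_add,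
        Set.indicator_of_mem (by exact hg)]
      intro a
      exact Set.indicator_of_notMem (fun hc => notMem_allBad_of_mem_firstGood (by exact hc) hg) _
  -- The Thompson step: the integrand depends only on the history and the draw, so the draw may be
  -- exchanged for the true parameter and then integrated against the posterior.
  have h2 := lintegral_sample hB hA t (f := (Prod.fst ⁻¹' D).indicator f)
    (hfm.indicator (measurable_fst hD))
  have h3 := setLIntegral_posterior hB hA hk (S := Prod.fst ⁻¹' D) (measurable_fst hD)
    (f := fun p => f (p.1.1, p.2)) (hfm.comp (by fun_prop))
  calc ∫⁻ ω in history Y A t ⁻¹' D, byArm π Φ φ (history Y A t ω, ξ ω) ∂P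
      = ∫⁻ ω in history Y A t ⁻¹' D, f (history Y A t ω, g t (history Y A t ω, ξ ω)) ∂P :=
        lintegral_congr_ae (ae_restrict_of_ae h1)
    _ = ∫⁻ ω in history Y A t ⁻¹' D, f (history Y A t ω, θ ω) ∂P := by
        rw [← lintegral_indicator (hF hD), ← lintegral_indicator (hF hD)]
        exact h2
    _ = _ := h3
    _ = _ := by
        refine lintegral_congr fun ω => ?_
        have hsa : ∀ a, MeasurableSet (firstGood c (history Y A t ω) a) := fun a =>
          measurable_prodMk_left (measurableSet_firstGood c a)
        have hsb : MeasurableSet (allBad c (history Y A t ω)) :=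
          measurable_prodMk_left (measurableSet_allBad c)
        simp only [hf]
        have hma : ∀ a, Measurable fun x => {q : (Fin t → ℕ × 𝒴) × (ℕ → ℝ) |
            q.2 ∈ firstGood c q.1 a}.indicator (fun q => Φ q.1 a) (history Y A t ω, x) := fun a =>
          (hfa a).comp measurable_prodMk_left
        rw [lintegral_add_left (Measurable.tsum hma), lintegral_tsum fun a => (hma a).aemeasurable]
        congr 1
        · congr 1 with a
          rw [mul_comm, ← lintegral_indicator_const (hsa a)]; rfl
        · rw [mul_comm, ← lintegral_indicator_const hsb]; rfl

end PosteriorIdentities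

/-! ### The event that the played arm is the benchmark, and the information it yields. -/

section HitIdentities

variable {Ω 𝒴 Ξ : Type*} [MeasurableSpace Ω] [MeasurableSpace 𝒴] [MeasurableSpace Ξ]
  {P : Measure Ω} {μ : Measure ℝ} {K : Kernel (ℕ → ℝ) (ℕ → 𝒴)} {R : 𝒴 → ℝ} {θ : Ω → ℕ → ℝ}
  {Y : ℕ∞ → Ω → ℕ → 𝒴} {ξ : Ω → Ξ} {ε : ℝ} {σ : Ξ → ℕ → ℕ}
  {g : (t : ℕ) → (Fin t → ℕ × 𝒴) × Ξ → ℕ → ℝ} {A : ℕ → Ω → ℕ} {t : ℕ}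
  {k : Kernel (Fin t → ℕ × 𝒴) (ℕ → ℝ)} {π : (Fin t → ℕ × 𝒴) × Ξ → ℕ} {w : ℝ → ℝ≥0∞}

/-- The conditional expectation, given the state, of a weight of the parameter of the played arm on
the event that it is the satisficing arm. -/
def hitMass (μ : Measure ℝ) (k : Kernel (Fin t → ℕ × 𝒴) (ℕ → ℝ)) (c : ℝ)
    (π : (Fin t → ℕ × 𝒴) × Ξ → ℕ) (w : ℝ → ℝ≥0∞) : (Fin t → ℕ × 𝒴) × Ξ → ℝ≥0∞ :=
  byArm π (firstMass k c w) (newMass μ k c w)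

/-- The conditional mean, given the state, of the parameter of the played arm. -/
def playMean (μ : Measure ℝ) (k : Kernel (Fin t → ℕ × 𝒴) (ℕ → ℝ))
    (π : (Fin t → ℕ × 𝒴) × Ξ → ℕ) : (Fin t → ℕ × 𝒴) × Ξ → ℝ≥0∞ :=
  byArm π (armMean k) fun _ => ∫⁻ r, ENNReal.ofReal r ∂μ

theorem measurable_hitMass [IsMarkovKernel k] {c : ℝ} (hπ : Measurable π) (hw : Measurable w) :
    Measurable (hitMass μ k c π w) :=
  measurable_byArm hπ (measurable_firstMass hw) measurable_newMass

theorem measurable_playMean [IsMarkovKernel k] (hπ : Measurable π) :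
    Measurable (playMean μ k π) :=
  measurable_byArm hπ measurable_armMean measurable_const

/-- On an old arm, being the first good arm already forces the level `c`. On a fresh arm the event
splits into a bad history and a good fresh parameter, which are independent. The function `G` in the
proof therefore ignores unplayed coordinates, and the level condition is moved into the weight. -/
theorem setLIntegral_hitSet [Nonempty 𝒴] [IsProbabilityMeasure P] [IsProbabilityMeasure μ]
    [IsMarkovKernel K] (hB : IsNoisyBandit P μ K R θ Y) (hA : IsSTS P K R θ Y ξ ε σ g A)
    [IsMarkovKernel k] (hk : IsPosterior P Y A ξ θ t k) (hπ : Measurable π)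
    (hAπ : ∀ ω, A t ω = π (history Y A t ω, ξ ω)) (c : ℝ) (hw : Measurable w)
    {D : Set ((Fin t → ℕ × 𝒴) × Ξ)} (hD : MeasurableSet D) :
    ∫⁻ ω in (fun ω => (history Y A t ω, ξ ω)) ⁻¹' D,
        (hitSet c π).indicator (fun p => w (p.2 (π p.1))) (fullState Y A ξ θ t ω) ∂P
      = ∫⁻ ω in (fun ω => (history Y A t ω, ξ ω)) ⁻¹' D,
          hitMass μ k c π w (history Y A t ω, ξ ω) ∂P := by
  classical
  have hold : MeasurableSet {p : ((Fin t → ℕ × 𝒴) × Ξ) × (ℕ → ℝ) | π p.1 ∈ arms p.1.1} :=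
    measurable_fst (measurableSet_old hπ)
  set G : ((Fin t → ℕ × 𝒴) × Ξ) × (ℕ → ℝ) → ℝ≥0∞ := fun p =>
    if π p.1 ∈ arms p.1.1 then (if p.2 ∈ firstGood c p.1.1 (π p.1) then 1 else 0)
      else (if p.2 ∈ allBad c p.1.1 then 1 else 0) with hG
  have hGm : Measurable G := Measurable.ite hold
    (Measurable.ite (measurableSet_firstGood_policy hπ) measurable_const measurable_const)
    (Measurable.ite measurableSet_allBad_fst measurable_const measurable_const)
  have key := setLIntegral_mul_action hB hA hk hπ hAπ hGm (w := (Set.Ici c).indicator w)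
    (Φ := firstMass k c w) (φ := newMass μ k c w) (by
      intro q x b r hb
      simp only [hG, update_mem_firstGood_iff hb, update_mem_allBad_iff hb])
    (hw.indicator measurableSet_Ici) (by
      intro q hq
      refine lintegral_congr fun x => ?_
      simp only [hG, if_pos hq]
      by_cases hx : x ∈ firstGood c q.1 (π q)
      · rw [if_pos hx, one_mul, Set.indicator_of_mem hx,
          Set.indicator_of_mem (by exact le_of_mem_firstGood hx)]
      · rw [if_neg hx, zero_mul, Set.indicator_of_notMem hx]) (by
      intro q hq
      have hsb : MeasurableSet (allBad c q.1) := measurable_prodMk_left (measurableSet_allBad c)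
      rw [newMass, lintegral_indicator measurableSet_Ici, ← lintegral_indicator_one hsb]
      congr 1
      refine lintegral_congr fun x => ?_
      simp only [hG, if_neg hq]
      by_cases hx : x ∈ allBad c q.1
      · rw [if_pos hx, Set.indicator_of_mem hx]; rfl
      · rw [if_neg hx, Set.indicator_of_notMem hx]) hD
  rw [hitMass, ← key]
  refine lintegral_congr fun ω => ?_
  rw [hAπ]
  simp only [hG, fullState]
  by_cases ho : π (history Y A t ω, ξ ω) ∈ arms (history Y A t ω)
  · rw [if_pos ho]
    by_cases hx : θ ω ∈ firstGood c (history Y A t ω) (π (history Y A t ω, ξ ω))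
    · rw [if_pos hx, one_mul, Set.indicator_of_mem (by exact Or.inl ⟨ho, hx⟩),
        Set.indicator_of_mem (by exact le_of_mem_firstGood hx)]
    · rw [if_neg hx, zero_mul, Set.indicator_of_notMem]
      rintro (⟨-, h⟩ | ⟨h, -⟩)
      exacts [hx h, h ho]
  · rw [if_neg ho]
    by_cases hx : θ ω ∈ allBad c (history Y A t ω)
    · rw [if_pos hx, one_mul]
      by_cases hc : c ≤ θ ω (π (history Y A t ω, ξ ω))
      · rw [Set.indicator_of_mem (by exact Or.inr ⟨ho, hx, hc⟩), Set.indicator_of_mem (by exact hc)]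
      · rw [Set.indicator_of_notMem, Set.indicator_of_notMem (by exact hc)]
        rintro (⟨h, -⟩ | ⟨-, -, h⟩)
        exacts [ho h, hc h]
    · rw [if_neg hx, zero_mul, Set.indicator_of_notMem]
      rintro (⟨h, -⟩ | ⟨-, h, -⟩)
      exacts [ho h, hx h]

/-- The reward function, truncated to the unit interval. -/
def clip (R : 𝒴 → ℝ) (y : 𝒴) : ℝ := max 0 (min 1 (R y))

theorem clip_mem (R : 𝒴 → ℝ) (y : 𝒴) : clip R y ∈ Set.Icc (0 : ℝ) 1 :=
  ⟨le_max_left _ _, max_le zero_le_one (min_le_left _ _)⟩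

theorem measurable_clip (hR : Measurable R) : Measurable (clip R) :=
  measurable_const.max (measurable_const.min hR)

theorem clip_eq {y : 𝒴} (h : R y ∈ Set.Icc (0 : ℝ) 1) : clip R y = R y := by
  rw [clip, min_eq_right h.2, max_eq_right h.1]

theorem ae_reward_mem (hB : IsNoisyBandit P μ K R θ Y) (r : ℕ∞) :
    ∀ᵐ ω ∂P, ∀ a, R (Y r ω a) ∈ Set.Icc (0 : ℝ) 1 :=
  ae_all_iff.2 fun a => hB.reward_mem r a

/-- Expresses the hit event, whose definition involves the whole trajectory, through the state at
time `t`. It holds almost surely only because a satisficing time must exist. -/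
theorem ae_satisficingArm_iff [StandardBorelSpace 𝒴] [Nonempty 𝒴] [IsProbabilityMeasure P]
    [IsProbabilityMeasure μ] [IsMarkovKernel K] (hB : IsNoisyBandit P μ K R θ Y)
    (hA : IsSTS P K R θ Y ξ ε σ g A) (hε : 0 < ε)
    (hAπ : ∀ ω, A t ω = π (history Y A t ω, ξ ω)) :
    ∀ᵐ ω ∂P, satisficingArm θ A ε ω = A t ω ↔ fullState Y A ξ θ t ω ∈ hitSet (1 - ε) π := by
  filter_upwards [ae_exists_satisficing hB hA hε] with ω hω
  by_cases ho : A t ω ∈ arms (history Y A t ω)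
  · rw [satisficingArm_eq_iff hω ho]
    simp only [hitSet, fullState, Set.mem_ofPred_eq, ← hAπ, ho, true_and, not_true_eq_false,
      false_and, or_false]
  · rw [satisficingArm_eq_action_iff hω ho]
    simp only [hitSet, fullState, Set.mem_ofPred_eq, ← hAπ, ho, true_and, not_false_eq_true,
      false_and, false_or]

variable [StandardBorelSpace 𝒴] [Nonempty 𝒴] [IsProbabilityMeasure P] [IsProbabilityMeasure μ]
  [IsMarkovKernel K] [IsMarkovKernel k]

theorem setLIntegral_hit_one (hB : IsNoisyBandit P μ K R θ Y) (hA : IsSTS P K R θ Y ξ ε σ g A)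
    (hε : 0 < ε) (hk : IsPosterior P Y A ξ θ t k) (hπ : Measurable π)
    (hAπ : ∀ ω, A t ω = π (history Y A t ω, ξ ω))
    {D : Set ((Fin t → ℕ × 𝒴) × Ξ)} (hD : MeasurableSet D) :
    ∫⁻ ω in (fun ω => (history Y A t ω, ξ ω)) ⁻¹' D,
        {ω | satisficingArm θ A ε ω = A t ω}.indicator (fun _ => 1) ω ∂P
      = ∫⁻ ω in (fun ω => (history Y A t ω, ξ ω)) ⁻¹' D,
          hitMass μ k (1 - ε) π (fun _ => 1) (history Y A t ω, ξ ω) ∂P := by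
  rw [← setLIntegral_hitSet hB hA hk hπ hAπ (1 - ε) measurable_const hD]
  refine lintegral_congr_ae (ae_restrict_of_ae ?_)
  filter_upwards [ae_satisficingArm_iff hB hA hε hAπ] with ω hω
  by_cases h : satisficingArm θ A ε ω = A t ω
  · rw [Set.indicator_of_mem (by exact h), Set.indicator_of_mem (hω.1 h)]
  · rw [Set.indicator_of_notMem (by exact h), Set.indicator_of_notMem fun hc => h (hω.2 hc)]

/-- The hit event is determined by the state, and the outcome at time `t` is conditionally
independent of the state given the parameter. The observed reward may thus be replaced by the
parameter of the played arm. -/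
theorem setLIntegral_hit_reward (hB : IsNoisyBandit P μ K R θ Y)
    (hA : IsSTS P K R θ Y ξ ε σ g A)
    (hε : 0 < ε) (hk : IsPosterior P Y A ξ θ t k) (hπ : Measurable π)
    (hAπ : ∀ ω, A t ω = π (history Y A t ω, ξ ω))
    {D : Set ((Fin t → ℕ × 𝒴) × Ξ)} (hD : MeasurableSet D) :
    ∫⁻ ω in (fun ω => (history Y A t ω, ξ ω)) ⁻¹' D, {ω | satisficingArm θ A ε ω = A t ω}.indicator
        (fun ω => ENNReal.ofReal (clip R (observed Y A t ω))) ω ∂P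
      = ∫⁻ ω in (fun ω => (history Y A t ω, ξ ω)) ⁻¹' D,
          hitMass μ k (1 - ε) π ENNReal.ofReal (history Y A t ω, ξ ω) ∂P := by
  have hm := measurable_state hB hA t
  have hS : MeasurableSet (Prod.fst ⁻¹' D ∩ hitSet (1 - ε) π) :=
    (measurable_fst hD).inter (measurableSet_hitSet hπ)
  rw [← setLIntegral_hitSet hB hA hk hπ hAπ (1 - ε) ENNReal.measurable_ofReal hD,
    ← lintegral_indicator (hm hD), ← lintegral_indicator (hm hD)]
  have key := lintegral_mul_reward hB hA (t := t) (r := t) le_rfl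
    (f := (Prod.fst ⁻¹' D ∩ hitSet (1 - ε) π).indicator fun _ => 1)
    (measurable_const.indicator hS) (b := fun p => π p.1) (hπ.comp measurable_fst)
  refine Eq.trans (lintegral_congr_ae ?_) (key.trans (lintegral_congr fun ω => ?_))
  · filter_upwards [ae_satisficingArm_iff hB hA hε hAπ, ae_reward_mem hB t] with ω h1 h2
    have e : R (Y t ω (π (fullState Y A ξ θ t ω).1)) = clip R (observed Y A t ω) := by
      rw [observed, clip_eq (h2 _), hAπ]; rfl
    rw [e]
    by_cases hd : (history Y A t ω, ξ ω) ∈ D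
    · rw [Set.indicator_of_mem (by exact hd)]
      by_cases h : satisficingArm θ A ε ω = A t ω
      · rw [Set.indicator_of_mem (by exact h), Set.indicator_of_mem (by exact ⟨hd, h1.1 h⟩), one_mul]
      · rw [Set.indicator_of_notMem (by exact h),
          Set.indicator_of_notMem fun hc => h (h1.2 hc.2), zero_mul]
    · rw [Set.indicator_of_notMem (by exact hd), Set.indicator_of_notMem fun hc => hd hc.1,
        zero_mul]
  · by_cases hd : (history Y A t ω, ξ ω) ∈ D
    · rw [Set.indicator_of_mem (s := (fun ω => (history Y A t ω, ξ ω)) ⁻¹' D) (by exact hd)]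
      by_cases h : fullState Y A ξ θ t ω ∈ hitSet (1 - ε) π
      · rw [Set.indicator_of_mem (by exact ⟨hd, h⟩), Set.indicator_of_mem h, one_mul]; rfl
      · rw [Set.indicator_of_notMem fun hc => h hc.2, Set.indicator_of_notMem h, zero_mul]
    · rw [Set.indicator_of_notMem fun hc => hd hc.1, Set.indicator_of_notMem (by exact hd),
        zero_mul]

theorem setLIntegral_reward (hB : IsNoisyBandit P μ K R θ Y) (hA : IsSTS P K R θ Y ξ ε σ g A)
    (hk : IsPosterior P Y A ξ θ t k) (hπ : Measurable π)
    (hAπ : ∀ ω, A t ω = π (history Y A t ω, ξ ω))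
    {D : Set ((Fin t → ℕ × 𝒴) × Ξ)} (hD : MeasurableSet D) :
    ∫⁻ ω in (fun ω => (history Y A t ω, ξ ω)) ⁻¹' D,
        ENNReal.ofReal (clip R (observed Y A t ω)) ∂P
      = ∫⁻ ω in (fun ω => (history Y A t ω, ξ ω)) ⁻¹' D,
          playMean μ k π (history Y A t ω, ξ ω) ∂P := by
  have hm := measurable_state hB hA t
  have h1 := setLIntegral_mul_action hB hA hk hπ hAπ (G := fun _ => 1) measurable_const
    (fun _ _ _ _ _ => rfl) ENNReal.measurable_ofReal (Φ := armMean k)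
    (φ := fun _ => ∫⁻ r, ENNReal.ofReal r ∂μ) (by intro q _; simp [armMean]) (by simp) hD
  rw [playMean, ← h1]
  have key := lintegral_mul_reward hB hA (t := t) (r := t) le_rfl
    (f := (Prod.fst ⁻¹' D).indicator fun _ => 1)
    (measurable_const.indicator (measurable_fst hD)) (b := fun p => π p.1) (hπ.comp measurable_fst)
  rw [← lintegral_indicator (hm hD), ← lintegral_indicator (hm hD)]
  refine Eq.trans (lintegral_congr_ae ?_) (key.trans (lintegral_congr fun ω => ?_))
  · filter_upwards [ae_reward_mem hB t] with ω h2
    have e : R (Y t ω (π (fullState Y A ξ θ t ω).1)) = clip R (observed Y A t ω) := by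
      rw [observed, clip_eq (h2 _), hAπ]; rfl
    rw [e]
    by_cases hd : (history Y A t ω, ξ ω) ∈ D
    · rw [Set.indicator_of_mem (by exact hd), Set.indicator_of_mem (by exact hd), one_mul]
    · rw [Set.indicator_of_notMem (by exact hd), Set.indicator_of_notMem (by exact hd), zero_mul]
  · by_cases hd : (history Y A t ω, ξ ω) ∈ D
    · rw [Set.indicator_of_mem (by exact hd), Set.indicator_of_mem (by exact hd), hAπ]; rfl
    · rw [Set.indicator_of_notMem (by exact hd), Set.indicator_of_notMem (by exact hd), zero_mul]

/-- The squared covariance of an event of mass `v` with a reward of mean `m`, relative to `v`. -/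
def gain (v u m : ℝ≥0∞) : ℝ≥0∞ :=
  ENNReal.ofReal ((u.toReal - v.toReal * m.toReal) ^ 2 / v.toReal)

theorem measurable_gain {α : Type*} [MeasurableSpace α] {v u m : α → ℝ≥0∞} (hv : Measurable v)
    (hu : Measurable u) (hm : Measurable m) : Measurable fun x => gain (v x) (u x) (m x) :=
  ENNReal.measurable_ofReal.comp (((hu.ennreal_toReal.sub
    (hv.ennreal_toReal.mul hm.ennreal_toReal)).pow_const 2).div hv.ennreal_toReal)

/-- A lower bound for the information gained in one step, given the state. -/
def stepGain (μ : Measure ℝ) (k : Kernel (Fin t → ℕ × 𝒴) (ℕ → ℝ)) (c : ℝ)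
    (π : (Fin t → ℕ × 𝒴) × Ξ → ℕ) (q : (Fin t → ℕ × 𝒴) × Ξ) : ℝ≥0∞ :=
  gain (hitMass μ k c π (fun _ => 1) q) (hitMass μ k c π ENNReal.ofReal q) (playMean μ k π q)

theorem measurable_stepGain {c : ℝ} (hπ : Measurable π) :
    Measurable (stepGain μ k c π) :=
  measurable_gain (measurable_hitMass hπ measurable_const)
    (measurable_hitMass hπ ENNReal.measurable_ofReal) (measurable_playMean hπ)

/-- The covariance bound is applied to the slice of the played arm, which is constant once the state
is given. The three integrals it involves are identified by testing against events of the state. -/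
theorem ae_stepGain_le_mutualInfo (hB : IsNoisyBandit P μ K R θ Y)
    (hA : IsSTS P K R θ Y ξ ε σ g A) (hε : 0 < ε) (hk : IsPosterior P Y A ξ θ t k)
    (hπ : Measurable π) (hAπ : ∀ ω, A t ω = π (history Y A t ω, ξ ω)) :
    ∀ᵐ q ∂(P.map fun ω => (history Y A t ω, ξ ω)), stepGain μ k (1 - ε) π q
      ≤ mutualInfo (condDistrib (fun ω => (satisficingArm θ A ε ω, observed Y A t ω))
          (fun ω => (history Y A t ω, ξ ω)) P q) := by
  have hm := measurable_state hB hA t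
  have hobs : Measurable (observed Y A t) :=
    measurable_observed hB.measurable_outcome (measurable_action hB hA t)
  have hZ : Measurable fun ω => (satisficingArm θ A ε ω, observed Y A t ω) :=
    (measurable_satisficingArm hB hA).prodMk hobs
  have hc := measurable_clip hB.measurable_reward
  have hS : MeasurableSet {p : ((Fin t → ℕ × 𝒴) × Ξ) × (ℕ × 𝒴) | p.2.1 = π p.1} :=
    measurableSet_eq_fun (by fun_prop) (by fun_prop)
  have hcm : Measurable fun p : ((Fin t → ℕ × 𝒴) × Ξ) × (ℕ × 𝒴) =>
      ENNReal.ofReal (clip R p.2.2) := by fun_prop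
  have e1 := ae_map_lintegral_condDistrib_eq (P := P) hm hZ
    (f := {p : ((Fin t → ℕ × 𝒴) × Ξ) × (ℕ × 𝒴) | p.2.1 = π p.1}.indicator fun _ => 1)
    (measurable_const.indicator hS)
    (measurable_hitMass (μ := μ) (k := k) (c := 1 - ε) hπ measurable_const) (fun D hD => by
      rw [← setLIntegral_hit_one hB hA hε hk hπ hAπ hD]
      refine lintegral_congr fun ω => ?_
      by_cases h : satisficingArm θ A ε ω = A t ω
      · rw [Set.indicator_of_mem (by exact h.trans (hAπ ω)), Set.indicator_of_mem (by exact h)]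
      · rw [Set.indicator_of_notMem fun hc => h (hc.trans (hAπ ω).symm),
          Set.indicator_of_notMem (by exact h)])
  have e2 := ae_map_lintegral_condDistrib_eq (P := P) hm hZ
    (f := {p : ((Fin t → ℕ × 𝒴) × Ξ) × (ℕ × 𝒴) | p.2.1 = π p.1}.indicator fun p =>
      ENNReal.ofReal (clip R p.2.2)) (hcm.indicator hS)
    (measurable_hitMass (μ := μ) (k := k) (c := 1 - ε) hπ ENNReal.measurable_ofReal) (fun D hD => by
      rw [← setLIntegral_hit_reward hB hA hε hk hπ hAπ hD]
      refine lintegral_congr fun ω => ?_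
      by_cases h : satisficingArm θ A ε ω = A t ω
      · rw [Set.indicator_of_mem (by exact h.trans (hAπ ω)), Set.indicator_of_mem (by exact h)]
      · rw [Set.indicator_of_notMem fun hc => h (hc.trans (hAπ ω).symm),
          Set.indicator_of_notMem (by exact h)])
  have e3 := ae_map_lintegral_condDistrib_eq (P := P) hm hZ hcm
    (measurable_playMean (μ := μ) (k := k) hπ)
    (fun D hD => setLIntegral_reward hB hA hk hπ hAπ hD)
  filter_upwards [e1, e2, e3] with q h1 h2 h3
  set ρ := condDistrib (fun ω => (satisficingArm θ A ε ω, observed Y A t ω))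
    (fun ω => (history Y A t ω, ξ ω)) P q with hρ
  have hs : MeasurableSet (Prod.fst ⁻¹' {π q} : Set (ℕ × 𝒴)) :=
    measurable_fst (measurableSet_singleton _)
  have hcs : Measurable fun x : ℕ × 𝒴 => clip R x.2 := by fun_prop
  have i1 : ρ.real (Prod.fst ⁻¹' {π q}) = (hitMass μ k (1 - ε) π (fun _ => 1) q).toReal := by
    rw [← h1, measureReal_def, ← lintegral_indicator_one hs]; rfl
  have i2 : ∫ x in Prod.fst ⁻¹' {π q}, clip R x.2 ∂ρ
      = (hitMass μ k (1 - ε) π ENNReal.ofReal q).toReal := by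
    rw [integral_eq_lintegral_of_nonneg_ae (Filter.Eventually.of_forall fun x : ℕ × 𝒴 => (clip_mem R x.2).1)
      hcs.aestronglyMeasurable, ← h2, ← lintegral_indicator hs]
    rfl
  have i3 : ∫ x, clip R x.2 ∂ρ = (playMean μ k π q).toReal := by
    rw [integral_eq_lintegral_of_nonneg_ae (Filter.Eventually.of_forall fun x : ℕ × 𝒴 => (clip_mem R x.2).1)
      hcs.aestronglyMeasurable, ← h3]
  rw [stepGain, gain, ← i1, ← i2, ← i3]
  -- The clipped reward is used because the bound asks for values in `[0, 1]` at every outcome, not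
  -- just almost surely.
  exact sq_cov_div_le_mutualInfo ρ hc (fun y => clip_mem R y) (π q)

end HitIdentities

/-- Identification of a conditional expectation given a random variable. -/
theorem condExp_comap_ae_eq {Ω γ : Type*} [MeasurableSpace Ω] [MeasurableSpace γ] {P : Measure Ω}
    [IsProbabilityMeasure P] {F : Ω → γ} (hF : Measurable F) {f : Ω → ℝ} (hf : Measurable f)
    (hf01 : ∀ᵐ ω ∂P, f ω ∈ Set.Icc (0 : ℝ) 1) {w : γ → ℝ≥0∞} (hw : Measurable w)
    (h : ∀ D, MeasurableSet D →
      ∫⁻ ω in F ⁻¹' D, ENNReal.ofReal (f ω) ∂P = ∫⁻ ω in F ⁻¹' D, w (F ω) ∂P) :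
    P[f | MeasurableSpace.comap F inferInstance] =ᵐ[P] fun ω => (w (F ω)).toReal := by
  have hfi : Integrable f P := Integrable.of_mem_Icc 0 1 hf.aemeasurable hf01
  have hwF : Measurable fun ω => w (F ω) := hw.comp hF
  have hfin : ∫⁻ ω, w (F ω) ∂P ≠ ∞ := by
    have h1 := h Set.univ MeasurableSet.univ
    simp only [Set.preimage_univ, Measure.restrict_univ] at h1
    rw [← h1]
    exact hfi.lintegral_lt_top.ne
  have hwi : Integrable (fun ω => (w (F ω)).toReal) P :=
    integrable_toReal_of_lintegral_ne_top hwF.aemeasurable hfin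
  symm
  refine ae_eq_condExp_of_forall_setIntegral_eq hF.comap_le hfi (fun s _ _ => hwi.integrableOn)
    ?_ ?_
  · rintro s ⟨D, hD, rfl⟩ -
    rw [integral_toReal hwF.aemeasurable.restrict
      (ae_restrict_of_ae (ae_lt_top hwF hfin)), ← h D hD,
      integral_eq_lintegral_of_nonneg_ae (ae_restrict_of_ae ?_) hf.aestronglyMeasurable]
    filter_upwards [hf01] with ω hω using hω.1
  · exact (hw.ennreal_toReal.comp (comap_measurable F)).aestronglyMeasurable

/-! ### Conditional mean of the benchmark reward. -/

section Shortfall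

variable {Ω 𝒴 Ξ : Type*} [MeasurableSpace Ω] [MeasurableSpace 𝒴] [MeasurableSpace Ξ]
  {P : Measure Ω} {μ : Measure ℝ} {K : Kernel (ℕ → ℝ) (ℕ → 𝒴)} {R : 𝒴 → ℝ} {θ : Ω → ℕ → ℝ}
  {Y : ℕ∞ → Ω → ℕ → 𝒴} {ξ : Ω → Ξ} {ε : ℝ} {σ : Ξ → ℕ → ℕ}
  {g : (t : ℕ) → (Fin t → ℕ × 𝒴) × Ξ → ℕ → ℝ} {A : ℕ → Ω → ℕ} {t : ℕ}
  {k : Kernel (Fin t → ℕ × 𝒴) (ℕ → ℝ)} {π : (Fin t → ℕ × 𝒴) × Ξ → ℕ} {w : ℝ → ℝ≥0∞}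
  [StandardBorelSpace 𝒴] [Nonempty 𝒴] [IsProbabilityMeasure P] [IsProbabilityMeasure μ]
  [IsMarkovKernel K] [IsMarkovKernel k]

/-- The event that the history lies in `D` and that the satisficing time is `s ≥ t`. -/
def hitAt (Y : ℕ∞ → Ω → ℕ → 𝒴) (A : ℕ → Ω → ℕ) (θ : Ω → ℕ → ℝ) (c : ℝ)
    (D : Set (Fin t → ℕ × 𝒴)) (s : ℕ) : Set Ω :=
  {ω | history Y A t ω ∈ D ∧ t ≤ s ∧ θ ω ∈ allBad c (history Y A s ω) ∧ c ≤ θ ω (A s ω)}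

theorem measurableSet_hitAt (hB : IsNoisyBandit P μ K R θ Y) (hA : IsSTS P K R θ Y ξ ε σ g A)
    (c : ℝ) {D : Set (Fin t → ℕ × 𝒴)} (hD : MeasurableSet D) (s : ℕ) :
    MeasurableSet (hitAt Y A θ c D s) :=
  (measurable_history hB hA t hD).inter ((MeasurableSet.const _).inter
    ((measurableSet_allBad_history hB hA c s).inter (measurableSet_le measurable_const
      (hB.measurable_param.eval_nat (measurable_action hB hA s)))))

/-- The mean reward of the satisficing arm, on the event that it is found at time `s`. -/
theorem setLIntegral_hitAt (hB : IsNoisyBandit P μ K R θ Y) (hA : IsSTS P K R θ Y ξ ε σ g A)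
    {D : Set (Fin t → ℕ × 𝒴)} (hD : MeasurableSet D) (s : ℕ) :
    (∫⁻ ω in hitAt Y A θ (1 - ε) D s, ENNReal.ofReal (R (Y ⊤ ω (satisficingArm θ A ε ω))) ∂P)
        * μ (Set.Ici (1 - ε))
      = P (hitAt Y A θ (1 - ε) D s) * ∫⁻ r in Set.Ici (1 - ε), ENNReal.ofReal r ∂μ := by
  classical
  set c := 1 - ε with hc
  have hEm := measurableSet_hitAt hB hA c hD s
  by_cases hts : t ≤ s
  swap
  · have : hitAt Y A θ c D s = ∅ :=
      Set.eq_empty_iff_forall_notMem.2 fun ω hω => hts hω.2.1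
    simp [this]
  obtain ⟨π, hπ, hAπ⟩ := exists_policy hB.measurable_reward hA s
  set S : Set (((Fin s → ℕ × 𝒴) × Ξ) × (ℕ → ℝ)) :=
    {p | (fun i => p.1.1 (Fin.castLE hts i)) ∈ D ∧ p.2 ∈ allBad c p.1.1} with hS
  have hSm : MeasurableSet S :=
    ((show Measurable fun p : ((Fin s → ℕ × 𝒴) × Ξ) × (ℕ → ℝ) =>
      fun i => p.1.1 (Fin.castLE hts i) by fun_prop) hD).inter measurableSet_allBad_fst
  have hmem : ∀ ω, ω ∈ hitAt Y A θ c D s ↔ fullState Y A ξ θ s ω ∈ S ∧ c ≤ θ ω (A s ω) := by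
    intro ω
    constructor
    · rintro ⟨h1, -, h3, h4⟩; exact ⟨⟨h1, h3⟩, h4⟩
    · rintro ⟨⟨h1, h3⟩, h4⟩; exact ⟨h1, hts, h3, h4⟩
  have hnew : ∀ ω ∈ hitAt Y A θ c D s, A s ω ∉ arms (history Y A s ω) := by
    rintro ω ⟨-, -, h3, h4⟩ ha
    obtain ⟨i, hi⟩ := mem_arms.1 ha
    exact absurd h4 (not_le.2 (hi ▸ h3 i))
  -- The arm found at time `s` is fresh, so a weight of its parameter contributes only through its
  -- integral above the level. The choices `w = 1` and `w = ENNReal.ofReal` share the other factor,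
  -- which gives the cross-multiplied identity.
  have key : ∀ w : ℝ → ℝ≥0∞, Measurable w →
      ∫⁻ ω in hitAt Y A θ c D s, w (θ ω (A s ω)) ∂P
        = (∫⁻ ω in {ω | A s ω ∉ arms (history Y A s ω)},
            S.indicator (fun _ => 1) (fullState Y A ξ θ s ω) ∂P) * ∫⁻ r in Set.Ici c, w r ∂μ := by
    intro w hw
    have h1 := setLIntegral_new_mul hB hA s (G := S.indicator fun _ => 1)
      (measurable_const.indicator hSm) (by
        intro q x b r hb
        simp only [Set.indicator_apply, hS, Set.mem_ofPred_eq, update_mem_allBad_iff hb])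
      (w := (Set.Ici c).indicator w) (hw.indicator measurableSet_Ici)
    rw [lintegral_indicator measurableSet_Ici] at h1
    rw [← h1, ← lintegral_indicator hEm, ← lintegral_indicator (measurableSet_new hB hA s)]
    refine lintegral_congr fun ω => ?_
    by_cases hω : ω ∈ hitAt Y A θ c D s
    · rw [Set.indicator_of_mem hω, Set.indicator_of_mem (by exact hnew ω hω),
        Set.indicator_of_mem ((hmem ω).1 hω).1, Set.indicator_of_mem (by exact ((hmem ω).1 hω).2),
        one_mul]
    · rw [Set.indicator_of_notMem hω]
      symm
      apply Set.indicator_apply_eq_zero.2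
      intro _
      by_cases h2 : fullState Y A ξ θ s ω ∈ S
      · rw [Set.indicator_of_notMem (s := Set.Ici c) (fun h3 => hω ((hmem ω).2 ⟨h2, h3⟩)), mul_zero]
      · rw [Set.indicator_of_notMem h2, zero_mul]
  -- On this event the benchmark is the arm played at time `s`, a function of the state; the extra
  -- copy `Y ⊤` counts as a later outcome, so its reward averages to the parameter.
  have hR : ∫⁻ ω in hitAt Y A θ c D s, ENNReal.ofReal (R (Y ⊤ ω (satisficingArm θ A ε ω))) ∂P
      = ∫⁻ ω in hitAt Y A θ c D s, ENNReal.ofReal (θ ω (A s ω)) ∂P := by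
    have hT : MeasurableSet (S ∩ {p | c ≤ p.2 (π p.1)}) :=
      hSm.inter (measurableSet_le measurable_const (measurable_eval_policy hπ))
    have h1 := lintegral_mul_reward hB hA (t := s) (r := ⊤) le_top
      (f := (S ∩ {p | c ≤ p.2 (π p.1)}).indicator fun _ => 1) (measurable_const.indicator hT)
      (b := fun p => π p.1) (hπ.comp measurable_fst)
    have hmem' : ∀ ω, ω ∈ hitAt Y A θ c D s ↔
        fullState Y A ξ θ s ω ∈ S ∩ {p | c ≤ p.2 (π p.1)} := by
      intro ω
      rw [hmem ω, hAπ]; rfl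
    rw [← lintegral_indicator hEm, ← lintegral_indicator hEm]
    refine Eq.trans (lintegral_congr fun ω => ?_) (h1.trans (lintegral_congr fun ω => ?_))
    · by_cases hω : ω ∈ hitAt Y A θ c D s
      · rw [Set.indicator_of_mem hω, Set.indicator_of_mem ((hmem' ω).1 hω), one_mul,
          satisficingArm_eq_action (by exact hω.2.2.1) hω.2.2.2, hAπ]
        rfl
      · rw [Set.indicator_of_notMem hω, Set.indicator_of_notMem fun h => hω ((hmem' ω).2 h),
          zero_mul]
    · by_cases hω : ω ∈ hitAt Y A θ c D s
      · rw [Set.indicator_of_mem hω, Set.indicator_of_mem ((hmem' ω).1 hω), one_mul, hAπ]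
        rfl
      · rw [Set.indicator_of_notMem hω, Set.indicator_of_notMem fun h => hω ((hmem' ω).2 h),
          zero_mul]
  have h2 := key (fun _ => 1) measurable_const
  rw [setLIntegral_one, setLIntegral_one] at h2
  rw [hR, key _ ENNReal.measurable_ofReal, h2]
  ring

/-- The mean reward of the satisficing arm, on the event that it is not yet found. -/
theorem setLIntegral_allBad_reward (hB : IsNoisyBandit P μ K R θ Y)
    (hA : IsSTS P K R θ Y ξ ε σ g A) (hε : 0 < ε) {D : Set (Fin t → ℕ × 𝒴)}
    (hD : MeasurableSet D) :
    (∫⁻ ω in history Y A t ⁻¹' D ∩ {ω | θ ω ∈ allBad (1 - ε) (history Y A t ω)},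
        ENNReal.ofReal (R (Y ⊤ ω (satisficingArm θ A ε ω))) ∂P) * μ (Set.Ici (1 - ε))
      = P (history Y A t ⁻¹' D ∩ {ω | θ ω ∈ allBad (1 - ε) (history Y A t ω)})
          * ∫⁻ r in Set.Ici (1 - ε), ENNReal.ofReal r ∂μ := by
  set c := 1 - ε with hc
  -- Up to a null set, "not found before `t`" is the disjoint union over the times `s ≥ t` at which
  -- the benchmark is found; each piece has the same conditional mean reward.
  have hae : (history Y A t ⁻¹' D ∩ {ω | θ ω ∈ allBad c (history Y A t ω)} : Set Ω)
      =ᵐ[P] ⋃ s, hitAt Y A θ c D s := by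
    filter_upwards [ae_exists_satisficing hB hA hε] with ω hex
    refine propext ⟨fun hω => ?_, fun hω => ?_⟩
    · refine Set.mem_iUnion.2 ⟨satisficingTime θ A ε ω, hω.1, ?_, fun i => ?_, Nat.sInf_mem hex⟩
      · by_contra hlt
        push Not at hlt
        exact absurd (Nat.sInf_mem hex) (not_le.2 (hω.2 ⟨satisficingTime θ A ε ω, hlt⟩))
      · by_contra hcon
        have hle : satisficingTime θ A ε ω ≤ i :=
          Nat.sInf_le (show (i : ℕ) ∈ {t : ℕ | 1 - ε ≤ θ ω (A t ω)} from not_lt.1 hcon)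
        exact absurd i.2 (not_lt.2 hle)
    · obtain ⟨s, h1, h2, h3, -⟩ := Set.mem_iUnion.1 hω
      exact ⟨h1, fun i => h3 (Fin.castLE h2 i)⟩
  have hdisj : Pairwise (Function.onFun Disjoint fun s => hitAt Y A θ c D s) := by
    intro s s' hss'
    refine Set.disjoint_left.2 fun ω h1 h2 => ?_
    rcases lt_or_gt_of_ne hss' with h | h
    · exact absurd (h2.2.2.1 ⟨s, h⟩) (not_lt.2 h1.2.2.2)
    · exact absurd (h1.2.2.1 ⟨s', h⟩) (not_lt.2 h2.2.2.2)
  rw [setLIntegral_congr hae, measure_congr hae,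
    lintegral_iUnion (measurableSet_hitAt hB hA c hD) hdisj,
    measure_iUnion hdisj (measurableSet_hitAt hB hA c hD), ← ENNReal.tsum_mul_right,
    ← ENNReal.tsum_mul_right]
  exact tsum_congr fun s => setLIntegral_hitAt hB hA hD s

/-- The conditional mean of the benchmark reward given the history. -/
theorem setLIntegral_benchmark (hB : IsNoisyBandit P μ K R θ Y) (hA : IsSTS P K R θ Y ξ ε σ g A)
    (hε : 0 < ε) (hk : IsPosterior P Y A ξ θ t k) {D : Set (Fin t → ℕ × 𝒴)}
    (hD : MeasurableSet D) :
    ∫⁻ ω in history Y A t ⁻¹' D, ENNReal.ofReal (R (Y ⊤ ω (satisficingArm θ A ε ω))) ∂P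
      = ∫⁻ ω in history Y A t ⁻¹' D, (∑' a, firstMass k (1 - ε) ENNReal.ofReal (history Y A t ω) a
          + k (history Y A t ω) (allBad (1 - ε) (history Y A t ω))
            * ((∫⁻ r in Set.Ici (1 - ε), ENNReal.ofReal r ∂μ) / μ (Set.Ici (1 - ε)))) ∂P := by
  set c := 1 - ε with hc
  have hF := measurable_history hB hA t
  have hFD := hF hD
  have hbad := measurableSet_allBad_history hB hA c t
  have hp : μ (Set.Ici c) ≠ 0 :=
    ((measure_Ioi_pos_of_support hB.support_prior (by linarith)).trans_le
      (measure_mono Set.Ioi_subset_Ici_self)).ne'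
  have hgm : ∀ a, MeasurableSet {ω | θ ω ∈ firstGood c (history Y A t ω) a} := fun a =>
    (hF.prodMk hB.measurable_param) (measurableSet_firstGood c a)
  have hset : history Y A t ⁻¹' D \ {ω | θ ω ∈ allBad c (history Y A t ω)}
      = ⋃ a, history Y A t ⁻¹' D ∩ {ω | θ ω ∈ firstGood c (history Y A t ω) a} := by
    ext ω
    simp only [Set.mem_sdiff, Set.mem_iUnion, Set.mem_inter_iff, Set.mem_ofPred_eq]
    constructor
    · rintro ⟨h1, h2⟩
      obtain ⟨a, ha⟩ := exists_mem_firstGood h2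
      exact ⟨a, h1, ha⟩
    · rintro ⟨a, h1, ha⟩
      exact ⟨h1, notMem_allBad_of_mem_firstGood ha⟩
  have hm1 : ∀ a, Measurable fun h => firstMass k c ENNReal.ofReal h a := fun a =>
    (measurable_firstMass ENNReal.measurable_ofReal).comp (measurable_id.prodMk measurable_const)
  have hm1' : ∀ a, Measurable fun ω => firstMass k c ENNReal.ofReal (history Y A t ω) a :=
    fun a => (hm1 a).comp hF
  -- The benchmark is either still to be found, where its mean reward is the prior mean conditioned
  -- on the level, or equal to a fixed old arm `a` on the event `firstGood`.
  rw [lintegral_add_left (Measurable.tsum hm1'), lintegral_tsum fun a => (hm1' a).aemeasurable,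
    add_comm, ← lintegral_inter_add_sdiff _ _ hbad, hset, lintegral_iUnion]
  rotate_left
  · exact fun a => hFD.inter (hgm a)
  · intro a b hab
    exact Set.disjoint_left.2 fun ω h1 h2 => hab (eq_of_mem_firstGood h1.2 h2.2)
  congr 1
  · rw [lintegral_mul_const _ (show Measurable fun ω => k (history Y A t ω)
      (allBad c (history Y A t ω)) from (measurable_kernel_allBad k c).comp hF), ← mul_div_assoc,
      ENNReal.eq_div_iff hp (measure_ne_top _ _), mul_comm,
      setLIntegral_allBad_reward hB hA hε hD]
    congr 1
    have := setLIntegral_posterior hB hA hk (S := Prod.fst ⁻¹' D) (measurable_fst hD)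
      (f := {p | p.2 ∈ allBad c p.1.1}.indicator fun _ => 1)
      (measurable_const.indicator measurableSet_allBad_fst)
    rw [← setLIntegral_one, Set.inter_comm, ← setLIntegral_indicator hbad]
    refine Eq.trans (Eq.trans ?_ this) (lintegral_congr fun ω => ?_)
    · rfl
    · have hsb : MeasurableSet (allBad c (history Y A t ω)) :=
        measurable_prodMk_left (measurableSet_allBad c)
      rw [← lintegral_indicator_one hsb]; rfl
  · refine tsum_congr fun a => ?_
    have hS : MeasurableSet ((fun p : ((Fin t → ℕ × 𝒴) × Ξ) × (ℕ → ℝ) => p.1.1) ⁻¹' D ∩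
        (fun p => (p.1.1, p.2)) ⁻¹' {q | q.2 ∈ firstGood c q.1 a}) :=
      ((show Measurable fun p : ((Fin t → ℕ × 𝒴) × Ξ) × (ℕ → ℝ) => p.1.1 by fun_prop) hD).inter
        ((show Measurable fun p : ((Fin t → ℕ × 𝒴) × Ξ) × (ℕ → ℝ) => (p.1.1, p.2) by fun_prop)
          (measurableSet_firstGood c a))
    have hG : MeasurableSet {p : ((Fin t → ℕ × 𝒴) × Ξ) × (ℕ → ℝ) | p.2 ∈ firstGood c p.1.1 a} :=
      (show Measurable fun p : ((Fin t → ℕ × 𝒴) × Ξ) × (ℕ → ℝ) => (p.1.1, p.2) by fun_prop)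
          (measurableSet_firstGood c a)
    have h1 := lintegral_mul_reward hB hA (t := t) (r := ⊤) le_top
      (measurable_const.indicator hS) (f := Set.indicator _ fun _ => 1) (b := fun _ => a)
      measurable_const
    have h2 := setLIntegral_posterior hB hA hk (S := Prod.fst ⁻¹' D) (measurable_fst hD)
      (f := {p | p.2 ∈ firstGood c p.1.1 a}.indicator fun p => ENNReal.ofReal (p.2 a))
      ((show Measurable fun p : ((Fin t → ℕ × 𝒴) × Ξ) × (ℕ → ℝ) => ENNReal.ofReal (p.2 a) by
        fun_prop).indicator hG)
    refine Eq.trans ?_ (h2.trans rfl)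
    rw [← lintegral_indicator (hFD.inter (hgm a)), ← lintegral_indicator (by exact hFD)]
    refine Eq.trans (lintegral_congr fun ω => ?_) (h1.trans (lintegral_congr fun ω => ?_))
    · by_cases hω : ω ∈ history Y A t ⁻¹' D ∩ {ω | θ ω ∈ firstGood c (history Y A t ω) a}
      · rw [Set.indicator_of_mem hω, Set.indicator_of_mem (by exact hω), one_mul,
          satisficingArm_eq_of_mem_firstGood hω.2]
      · rw [Set.indicator_of_notMem hω, Set.indicator_of_notMem (by exact hω), zero_mul]
    · by_cases h3 : history Y A t ω ∈ D
      · rw [Set.indicator_of_mem (s := _ ⁻¹' (Prod.fst ⁻¹' D)) (by exact h3)]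
        by_cases h4 : θ ω ∈ firstGood c (history Y A t ω) a
        · rw [Set.indicator_of_mem (by exact ⟨h3, h4⟩), one_mul,
            Set.indicator_of_mem (by exact h4)]
          rfl
        · rw [Set.indicator_of_notMem (fun h => h4 h.2), zero_mul,
            Set.indicator_of_notMem (by exact h4)]
      · rw [Set.indicator_of_notMem (fun h => h3 h.1), zero_mul,
          Set.indicator_of_notMem (by exact h3)]

end Shortfall

/-- Cauchy–Schwarz with weight 1 on each term of the sum and weight `p` on the extra term. -/
theorem sq_sum_add_le {s : Finset ℕ} {B : ℕ → ℝ} {D p : ℝ} (hp : 0 < p) :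
    (∑ a ∈ s, B a + D) ^ 2 ≤ (s.card + 1 / p) * (∑ a ∈ s, B a ^ 2 + p * D ^ 2) := by
  have h1 : (∑ a ∈ s, B a) ^ 2 ≤ s.card * ∑ a ∈ s, B a ^ 2 := sq_sum_le_card_mul_sum_sq
  set S := ∑ a ∈ s, B a
  set Q := ∑ a ∈ s, B a ^ 2
  have hn : (0 : ℝ) ≤ s.card := Nat.cast_nonneg _
  set n : ℝ := (s.card : ℝ)
  have e : (n + 1 / p) * (Q + p * D ^ 2) = n * Q + n * p * D ^ 2 + Q / p + D ^ 2 := by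
    field_simp
    ring
  rw [e]
  have h2 : 2 * S * D ≤ n * p * D ^ 2 + Q / p := by
    rcases hn.eq_or_lt with h0 | h0
    · rw [← h0] at h1 ⊢
      have hS : S = 0 := by nlinarith
      have hQ : 0 ≤ Q := Finset.sum_nonneg fun a _ => sq_nonneg _
      rw [hS]
      have := div_nonneg hQ hp.le
      linarith
    · have h3 : S ^ 2 / (n * p) ≤ Q / p := by
        rw [div_le_div_iff₀ (by positivity) hp]
        nlinarith
      have h4 : 2 * S * D ≤ n * p * D ^ 2 + S ^ 2 / (n * p) := by
        have h5 : n * p * D ^ 2 + S ^ 2 / (n * p) - 2 * S * D = (n * p * D - S) ^ 2 / (n * p) := by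
          field_simp
          ring
        have h6 : 0 ≤ (n * p * D - S) ^ 2 / (n * p) := by positivity
        linarith
      linarith
  nlinarith

/-! ### Shortfall against information, for a fixed history. -/

section ShortfallBound

variable {𝒴 Ξ : Type*} [MeasurableSpace 𝒴] [MeasurableSpace Ξ] {t : ℕ}

/-- The posterior mean of the benchmark reward. -/
def benchmarkMean (μ : Measure ℝ) (k : Kernel (Fin t → ℕ × 𝒴) (ℕ → ℝ)) (c : ℝ)
    (h : Fin t → ℕ × 𝒴) : ℝ≥0∞ :=
  ∑' a, firstMass k c ENNReal.ofReal h a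
    + k h (allBad c h) * ((∫⁻ r in Set.Ici c, ENNReal.ofReal r ∂μ) / μ (Set.Ici c))

/-- The posterior mean of `Φ`, evaluated at the played arm, with the value `φ` at a new arm. -/
def armAverage (k : Kernel (Fin t → ℕ × 𝒴) (ℕ → ℝ)) (c : ℝ) (Φ : (Fin t → ℕ × 𝒴) → ℕ → ℝ≥0∞)
    (φ : (Fin t → ℕ × 𝒴) → ℝ≥0∞) (h : Fin t → ℕ × 𝒴) : ℝ≥0∞ :=
  ∑' a, k h (firstGood c h a) * Φ h a + k h (allBad c h) * φ h

/-- The posterior mean of the reward of the played arm. -/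
def rewardMean (μ : Measure ℝ) (k : Kernel (Fin t → ℕ × 𝒴) (ℕ → ℝ)) (c : ℝ) :
    (Fin t → ℕ × 𝒴) → ℝ≥0∞ :=
  armAverage k c (armMean k) fun _ => ∫⁻ r, ENNReal.ofReal r ∂μ

/-- A lower bound for the information gained in one step, given the history. -/
def historyGain (μ : Measure ℝ) (k : Kernel (Fin t → ℕ × 𝒴) (ℕ → ℝ)) (c : ℝ) :
    (Fin t → ℕ × 𝒴) → ℝ≥0∞ :=
  armAverage k c
    (fun h a => gain (firstMass k c (fun _ => 1) h a) (firstMass k c ENNReal.ofReal h a)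
      (armMean k h a))
    (fun h => gain (newMass μ k c (fun _ => 1) h) (newMass μ k c ENNReal.ofReal h)
      (∫⁻ r, ENNReal.ofReal r ∂μ))

theorem stepGain_eq {μ : Measure ℝ} {k : Kernel (Fin t → ℕ × 𝒴) (ℕ → ℝ)} {c : ℝ}
    {π : (Fin t → ℕ × 𝒴) × Ξ → ℕ} (q : (Fin t → ℕ × 𝒴) × Ξ) :
    stepGain μ k c π q = byArm π
      (fun h a => gain (firstMass k c (fun _ => 1) h a) (firstMass k c ENNReal.ofReal h a)
        (armMean k h a))
      (fun h => gain (newMass μ k c (fun _ => 1) h) (newMass μ k c ENNReal.ofReal h)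
        (∫⁻ r, ENNReal.ofReal r ∂μ)) q := by
  simp only [stepGain, hitMass, playMean, byArm]
  split_ifs <;> rfl

theorem firstGood_eq_empty {c : ℝ} {h : Fin t → ℕ × 𝒴} {a : ℕ} (ha : a ∉ arms h) :
    firstGood c h a = ∅ :=
  Set.eq_empty_iff_forall_notMem.2 fun _ hx => ha (mem_arms_of_mem_firstGood hx)

variable {μ : Measure ℝ} [IsProbabilityMeasure μ] {k : Kernel (Fin t → ℕ × 𝒴) (ℕ → ℝ)}
  [IsMarkovKernel k] {c : ℝ}

theorem measurable_armAverage {Φ : (Fin t → ℕ × 𝒴) → ℕ → ℝ≥0∞} {φ : (Fin t → ℕ × 𝒴) → ℝ≥0∞}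
    (hΦ : Measurable fun q : (Fin t → ℕ × 𝒴) × ℕ => Φ q.1 q.2) (hφ : Measurable φ) :
    Measurable (armAverage k c Φ φ) :=
  (Measurable.tsum fun a => (measurable_kernel_firstGood k c a).mul
    (hΦ.comp (measurable_id.prodMk measurable_const))).add
    ((measurable_kernel_allBad k c).mul hφ)

theorem measurable_rewardMean : Measurable (rewardMean μ k c) :=
  measurable_armAverage measurable_armMean measurable_const

theorem measurable_gain_old : Measurable fun q : (Fin t → ℕ × 𝒴) × ℕ =>
    gain (firstMass k c (fun _ => 1) q.1 q.2) (firstMass k c ENNReal.ofReal q.1 q.2)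
      (armMean k q.1 q.2) :=
  measurable_gain (measurable_firstMass measurable_const)
    (measurable_firstMass ENNReal.measurable_ofReal) measurable_armMean

theorem measurable_gain_new : Measurable fun h : Fin t → ℕ × 𝒴 =>
    gain (newMass μ k c (fun _ => 1) h) (newMass μ k c ENNReal.ofReal h)
      (∫⁻ r, ENNReal.ofReal r ∂μ) :=
  measurable_gain measurable_newMass measurable_newMass measurable_const

theorem measurable_historyGain : Measurable (historyGain μ k c) :=
  measurable_armAverage measurable_gain_old measurable_gain_new

theorem measurable_benchmarkMean : Measurable (benchmarkMean μ k c) := by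
  have h1 : ∀ a, Measurable fun h => firstMass k c ENNReal.ofReal h a := fun a =>
    (measurable_firstMass ENNReal.measurable_ofReal).comp (measurable_id.prodMk measurable_const)
  exact (Measurable.tsum h1).add ((measurable_kernel_allBad k c).mul_const _)

theorem firstMass_one (h : Fin t → ℕ × 𝒴) (a : ℕ) :
    firstMass k c (fun _ => 1) h a = k h (firstGood c h a) := by
  have hs : MeasurableSet (firstGood c h a) := measurable_prodMk_left (measurableSet_firstGood c a)
  rw [← lintegral_indicator_one hs]; rfl

/-- The squared posterior shortfall is controlled by the information gain. -/
theorem sq_shortfall_le (hp : 0 < μ (Set.Ici c)) (hμ : ∀ᵐ r ∂μ, r ∈ Set.Icc (0 : ℝ) 1)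
    {h : Fin t → ℕ × 𝒴} (hk : ∀ᵐ x ∂(k h), ∀ a, x a ∈ Set.Icc (0 : ℝ) 1) :
    ENNReal.ofReal (((benchmarkMean μ k c h).toReal - (rewardMean μ k c h).toReal) ^ 2)
      ≤ ((arms h).card + ENNReal.ofReal (1 / μ.real (Set.Ici c))) * historyGain μ k c h := by
  have hfirst_le : ∀ a, firstMass k c ENNReal.ofReal h a ≤ k h (firstGood c h a) := by
    intro a
    rw [← firstMass_one]
    refine lintegral_mono_ae ?_
    filter_upwards [hk] with x hx
    refine Set.indicator_le_indicator ?_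
    exact ENNReal.ofReal_le_one.2 (hx a).2
  have hmean_le : ∀ a, armMean k h a ≤ 1 := by
    intro a
    calc armMean k h a ≤ ∫⁻ _, 1 ∂(k h) := by
          refine lintegral_mono_ae ?_
          filter_upwards [hk] with x hx using ENNReal.ofReal_le_one.2 (hx a).2
      _ = 1 := by simp
  have hm_le : ∫⁻ r, ENNReal.ofReal r ∂μ ≤ 1 := by
    calc ∫⁻ r, ENNReal.ofReal r ∂μ ≤ ∫⁻ _, 1 ∂μ := by
          refine lintegral_mono_ae ?_
          filter_upwards [hμ] with x hx using ENNReal.ofReal_le_one.2 hx.2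
      _ = 1 := by simp
  have hcp_le : ∫⁻ r in Set.Ici c, ENNReal.ofReal r ∂μ ≤ 1 :=
    (setLIntegral_le_lintegral _ _).trans hm_le
  set p := μ.real (Set.Ici c) with hpdef
  have hp0 : 0 < p := ENNReal.toReal_pos hp.ne' (measure_ne_top _ _)
  set m := (∫⁻ r, ENNReal.ofReal r ∂μ).toReal with hm
  set cp := (∫⁻ r in Set.Ici c, ENNReal.ofReal r ∂μ).toReal with hcp
  set q := (k h (allBad c h)).toReal with hq
  set v : ℕ → ℝ := fun a => (k h (firstGood c h a)).toReal with hv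
  set u : ℕ → ℝ := fun a => (firstMass k c ENNReal.ofReal h a).toReal with hu
  set r : ℕ → ℝ := fun a => (armMean k h a).toReal with hr
  have hone : ∀ {x : ℝ≥0∞}, x ≤ 1 → x ≠ ∞ := fun hx => (hx.trans_lt ENNReal.one_lt_top).ne
  have hfirst_ne : ∀ a, firstMass k c ENNReal.ofReal h a ≠ ∞ := fun a =>
    hone ((hfirst_le a).trans prob_le_one)
  have e1 : (benchmarkMean μ k c h).toReal = ∑ a ∈ arms h, u a + q * (cp / p) := by
    rw [benchmarkMean, tsum_eq_sum (s := arms h), ENNReal.toReal_add, ENNReal.toReal_sum,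
      ENNReal.toReal_mul, ENNReal.toReal_div]
    · rfl
    · exact fun a _ => hfirst_ne a
    · exact ENNReal.sum_ne_top.2 fun a _ => hfirst_ne a
    · exact ENNReal.mul_ne_top (measure_ne_top _ _) (ENNReal.div_ne_top (hone hcp_le) hp.ne')
    · intro a ha
      have := hfirst_le a
      rw [firstGood_eq_empty ha, measure_empty] at this
      exact le_antisymm this zero_le
  have e2 : (rewardMean μ k c h).toReal = ∑ a ∈ arms h, v a * r a + q * m := by
    rw [rewardMean, armAverage, tsum_eq_sum (s := arms h), ENNReal.toReal_add, ENNReal.toReal_sum,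
      ENNReal.toReal_mul]
    · simp only [ENNReal.toReal_mul]; rfl
    · exact fun a _ => ENNReal.mul_ne_top (measure_ne_top _ _) (hone (hmean_le a))
    · exact ENNReal.sum_ne_top.2 fun a _ =>
        ENNReal.mul_ne_top (measure_ne_top _ _) (hone (hmean_le a))
    · exact ENNReal.mul_ne_top (measure_ne_top _ _) (hone hm_le)
    · intro a ha
      rw [firstGood_eq_empty ha, measure_empty, zero_mul]
  set B : ℕ → ℝ := fun a => u a - v a * r a with hBdef
  set D := q * (cp / p - m) with hD
  -- Benchmark and played arm give each old arm `a` the same mass `v a`, so the difference of means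
  -- pairs up into the covariances `B a`. In `D`, of mass `q`, a fresh arm conditioned to reach the
  -- level is compared with an unconditioned one.
  have e3 : (benchmarkMean μ k c h).toReal - (rewardMean μ k c h).toReal
      = ∑ a ∈ arms h, B a + D := by
    rw [e1, e2, hBdef, Finset.sum_sub_distrib, hD]
    ring
  -- Arm `a` is played with probability `v a` and yields `B a ^ 2 / v a`, so averaging removes the
  -- denominator. A fresh arm is played with probability `q`, is the benchmark with probability `q
  -- p`, and has covariance `p D`; its average is `p D ^ 2`. When `v a` or `q` vanishes, so do both
  -- sides.
  have e4 : ENNReal.ofReal (∑ a ∈ arms h, B a ^ 2 + p * D ^ 2) ≤ historyGain μ k c h := by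
    rw [historyGain, armAverage, tsum_eq_sum (s := arms h)]
    · rw [ENNReal.ofReal_add (Finset.sum_nonneg fun a _ => sq_nonneg _) (by positivity),
        ENNReal.ofReal_sum_of_nonneg fun a _ => sq_nonneg _]
      refine add_le_add (Finset.sum_le_sum fun a _ => ?_) ?_
      · rw [firstMass_one, gain, ← ENNReal.ofReal_toReal (measure_ne_top (k h) (firstGood c h a)),
          ENNReal.toReal_ofReal ENNReal.toReal_nonneg, ← ENNReal.ofReal_mul ENNReal.toReal_nonneg]
        refine ENNReal.ofReal_le_ofReal (le_of_eq ?_)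
        change B a ^ 2 = v a * (B a ^ 2 / v a)
        by_cases h0 : v a = 0
        · have hu0 : u a = 0 := by
            have h1 : k h (firstGood c h a) = 0 :=
              ((ENNReal.toReal_eq_zero_iff _).1 h0).resolve_right (measure_ne_top _ _)
            have h2 := hfirst_le a
            rw [h1] at h2
            rw [hu]
            simp only [le_antisymm h2 zero_le, ENNReal.toReal_zero]
          simp [hBdef, h0, hu0]
        · field_simp
      · rw [newMass, newMass, gain, setLIntegral_one, ENNReal.toReal_mul, ENNReal.toReal_mul,
          ← ENNReal.ofReal_toReal (measure_ne_top (k h) (allBad c h)),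
          ENNReal.toReal_ofReal ENNReal.toReal_nonneg, ← ENNReal.ofReal_mul ENNReal.toReal_nonneg]
        refine ENNReal.ofReal_le_ofReal (le_of_eq ?_)
        change p * D ^ 2 = q * ((q * cp - q * p * m) ^ 2 / (q * p))
        by_cases h0 : q = 0
        · simp [hD, h0]
        · rw [hD]
          field_simp
    · intro a ha
      rw [firstGood_eq_empty ha, measure_empty, zero_mul]
  calc ENNReal.ofReal (((benchmarkMean μ k c h).toReal - (rewardMean μ k c h).toReal) ^ 2)
      ≤ ENNReal.ofReal (((arms h).card + 1 / p) * (∑ a ∈ arms h, B a ^ 2 + p * D ^ 2)) := by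
        rw [e3]
        exact ENNReal.ofReal_le_ofReal (sq_sum_add_le hp0)
    _ = ((arms h).card + ENNReal.ofReal (1 / p))
          * ENNReal.ofReal (∑ a ∈ arms h, B a ^ 2 + p * D ^ 2) := by
        rw [ENNReal.ofReal_mul (by positivity), ENNReal.ofReal_add (by positivity) (by positivity),
          ENNReal.ofReal_natCast]
    _ ≤ _ := by gcongr

end ShortfallBound

/-! ### The information ratio. -/

section InformationRatio

variable {Ω 𝒴 Ξ : Type*} [MeasurableSpace Ω] [MeasurableSpace 𝒴] [MeasurableSpace Ξ]
  {P : Measure Ω} {μ : Measure ℝ} {K : Kernel (ℕ → ℝ) (ℕ → 𝒴)} {R : 𝒴 → ℝ} {θ : Ω → ℕ → ℝ}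
  {Y : ℕ∞ → Ω → ℕ → 𝒴} {ξ : Ω → Ξ} {ε : ℝ} {σ : Ξ → ℕ → ℕ}
  {g : (t : ℕ) → (Fin t → ℕ × 𝒴) × Ξ → ℕ → ℝ} {A : ℕ → Ω → ℕ} {t : ℕ}
  {k : Kernel (Fin t → ℕ × 𝒴) (ℕ → ℝ)} {π : (Fin t → ℕ × 𝒴) × Ξ → ℕ}
  [StandardBorelSpace 𝒴] [Nonempty 𝒴] [IsProbabilityMeasure P] [IsProbabilityMeasure μ]
  [IsMarkovKernel K] [IsMarkovKernel k]

theorem ae_posterior_mem_Icc (hB : IsNoisyBandit P μ K R θ Y) (hA : IsSTS P K R θ Y ξ ε σ g A)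
    (hk : IsPosterior P Y A ξ θ t k) :
    ∀ᵐ ω ∂P, ∀ᵐ x ∂(k (history Y A t ω)), ∀ a, x a ∈ Set.Icc (0 : ℝ) 1 := by
  have hS : MeasurableSet {x : ℕ → ℝ | ∀ a, x a ∈ Set.Icc (0 : ℝ) 1} := by
    have : {x : ℕ → ℝ | ∀ a, x a ∈ Set.Icc (0 : ℝ) 1}
        = ⋂ a, (fun x : ℕ → ℝ => x a) ⁻¹' Set.Icc 0 1 := by ext; simp
    rw [this]
    exact MeasurableSet.iInter fun a => measurable_pi_apply a measurableSet_Icc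
  have h1 := hk (fun p => {x : ℕ → ℝ | ∀ a, x a ∈ Set.Icc (0 : ℝ) 1}ᶜ.indicator (fun _ => 1) p.2)
    ((measurable_const.indicator hS.compl).comp measurable_snd)
  have h2 : ∫⁻ ω, {x : ℕ → ℝ | ∀ a, x a ∈ Set.Icc (0 : ℝ) 1}ᶜ.indicator (fun _ => (1 : ℝ≥0∞))
      (fullState Y A ξ θ t ω).2 ∂P = 0 := by
    rw [← lintegral_zero (μ := P)]
    refine lintegral_congr_ae ?_
    filter_upwards [ae_param_reward hB] with ω hω
    exact Set.indicator_of_notMem (s := {x : ℕ → ℝ | ∀ a, x a ∈ Set.Icc (0 : ℝ) 1}ᶜ)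
      (fun hc => hc hω.2.2) _
  have h3 : ∀ ω, ∫⁻ x, {x : ℕ → ℝ | ∀ a, x a ∈ Set.Icc (0 : ℝ) 1}ᶜ.indicator
      (fun _ => (1 : ℝ≥0∞)) x ∂(k (history Y A t ω))
      = k (history Y A t ω) {x : ℕ → ℝ | ∀ a, x a ∈ Set.Icc (0 : ℝ) 1}ᶜ := fun ω =>
    lintegral_indicator_one hS.compl
  rw [h2] at h1
  simp only [h3] at h1
  rw [eq_comm, lintegral_eq_zero_iff (show Measurable fun ω => k (history Y A t ω)
    {x : ℕ → ℝ | ∀ a, x a ∈ Set.Icc (0 : ℝ) 1}ᶜ from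
      (k.measurable_coe hS.compl).comp (measurable_history hB hA t))] at h1
  filter_upwards [h1] with ω hω
  exact hω

/-- The two rewards are bounded, so each conditional expectation is determined by its integrals over
history events, computed in `setLIntegral_benchmark` and through `lintegral_byArm`. -/
theorem posteriorShortfall_ae_eq (hB : IsNoisyBandit P μ K R θ Y)
    (hA : IsSTS P K R θ Y ξ ε σ g A) (hε : 0 < ε) (hk : IsPosterior P Y A ξ θ t k) :
    posteriorShortfall P R Y A (satisficingArm θ A ε) t =ᵐ[P] fun ω =>
      (benchmarkMean μ k (1 - ε) (history Y A t ω)).toReal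
        - (rewardMean μ k (1 - ε) (history Y A t ω)).toReal := by
  obtain ⟨π, hπ, hAπ⟩ := exists_policy hB.measurable_reward hA t
  have hF := measurable_history hB hA t
  have hobs : Measurable (observed Y A t) :=
    measurable_observed hB.measurable_outcome (measurable_action hB hA t)
  have hf1 : Measurable fun ω => R (Y ⊤ ω (satisficingArm θ A ε ω)) :=
    hB.measurable_reward.comp ((hB.measurable_outcome ⊤).eval_nat (measurable_satisficingArm hB hA))
  have hf2 : Measurable fun ω => R (observed Y A t ω) := hB.measurable_reward.comp hobs
  have h01 : ∀ᵐ ω ∂P, R (Y ⊤ ω (satisficingArm θ A ε ω)) ∈ Set.Icc (0 : ℝ) 1 := by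
    filter_upwards [ae_reward_mem hB ⊤] with ω hω using hω _
  have h02 : ∀ᵐ ω ∂P, R (observed Y A t ω) ∈ Set.Icc (0 : ℝ) 1 := by
    filter_upwards [ae_reward_mem hB t] with ω hω using hω _
  have c1 := condExp_comap_ae_eq hF hf1 h01 (w := benchmarkMean μ k (1 - ε))
    measurable_benchmarkMean fun D hD => setLIntegral_benchmark hB hA hε hk hD
  have c2 := condExp_comap_ae_eq hF hf2 h02 (w := rewardMean μ k (1 - ε)) measurable_rewardMean
    fun D hD => by
      have h1 := setLIntegral_reward hB hA hk hπ hAπ (D := Prod.fst ⁻¹' D) (measurable_fst hD)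
      have h2 := lintegral_byArm hB hA hk hAπ (Φ := armMean k)
        (φ := fun _ => ∫⁻ r, ENNReal.ofReal r ∂μ) measurable_armMean measurable_const hD
      refine Eq.trans (lintegral_congr_ae (ae_restrict_of_ae ?_)) (h1.trans h2)
      filter_upwards [h02] with ω hω
      rw [clip_eq hω]
  have hi1 : Integrable (fun ω => R (Y ⊤ ω (satisficingArm θ A ε ω))) P :=
    Integrable.of_mem_Icc 0 1 hf1.aemeasurable h01
  have hi2 : Integrable (fun ω => R (observed Y A t ω)) P :=
    Integrable.of_mem_Icc 0 1 hf2.aemeasurable h02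
  have c3 := condExp_sub hi1 hi2 (MeasurableSpace.comap (history Y A t) inferInstance)
  filter_upwards [c1, c2, c3] with ω h1 h2 h3
  rw [← h1, ← h2]
  exact h3

theorem ae_sq_posteriorShortfall_le (hB : IsNoisyBandit P μ K R θ Y)
    (hA : IsSTS P K R θ Y ξ ε σ g A) (hε : 0 < ε) (hk : IsPosterior P Y A ξ θ t k) :
    ∀ᵐ ω ∂P, ENNReal.ofReal (posteriorShortfall P R Y A (satisficingArm θ A ε) t ω ^ 2)
      ≤ ((arms (history Y A t ω)).card + ENNReal.ofReal (1 / μ.real (Set.Ici (1 - ε))))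
        * historyGain μ k (1 - ε) (history Y A t ω) := by
  filter_upwards [posteriorShortfall_ae_eq hB hA hε hk, ae_posterior_mem_Icc hB hA hk] with ω h1 h2
  rw [h1]
  exact sq_shortfall_le ((measure_Ioi_pos_of_support hB.support_prior (by linarith)).trans_le
    (measure_mono Set.Ioi_subset_Ici_self)) (ae_mem_Icc_of_support hB.support_prior) h2

theorem setLIntegral_stepGain (hB : IsNoisyBandit P μ K R θ Y)
    (hA : IsSTS P K R θ Y ξ ε σ g A) (hk : IsPosterior P Y A ξ θ t k)
    (hAπ : ∀ ω, A t ω = π (history Y A t ω, ξ ω))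
    {D : Set (Fin t → ℕ × 𝒴)} (hD : MeasurableSet D) :
    ∫⁻ ω in history Y A t ⁻¹' D, stepGain μ k (1 - ε) π (history Y A t ω, ξ ω) ∂P
      = ∫⁻ ω in history Y A t ⁻¹' D, historyGain μ k (1 - ε) (history Y A t ω) ∂P := by
  simp only [stepGain_eq]
  exact lintegral_byArm hB hA hk hAπ measurable_gain_old measurable_gain_new hD

/-- Averaging the bound for a fixed state over the conditional law of `ξ` given the history: the
left side averages to `historyGain` because the played arm follows the posterior, the right side to
the conditional mutual information by definition. -/
theorem ae_historyGain_le [StandardBorelSpace Ξ] [Nonempty Ξ] (hB : IsNoisyBandit P μ K R θ Y)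
    (hA : IsSTS P K R θ Y ξ ε σ g A) (hε : 0 < ε) (hk : IsPosterior P Y A ξ θ t k) :
    ∀ᵐ ω ∂P, historyGain μ k (1 - ε) (history Y A t ω)
      ≤ posteriorCondMutualInfo P (history Y A t) (satisficingArm θ A ε) (observed Y A t) ξ
        (history Y A t ω) := by
  obtain ⟨π, hπ, hAπ⟩ := exists_policy hB.measurable_reward hA t
  have hF := measurable_history hB hA t
  have h1 := ae_lintegral_condDistrib_eq (P := P) hF hA.measurable_exo
    (measurable_stepGain (μ := μ) (k := k) (c := 1 - ε) hπ) measurable_historyGain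
    fun D hD => setLIntegral_stepGain hB hA hk hAπ hD
  have h2 := ae_stepGain_le_mutualInfo hB hA hε hk hπ hAπ
  rw [← compProd_map_condDistrib hA.measurable_exo.aemeasurable] at h2
  have h3 := ae_of_ae_map hF.aemeasurable (Measure.ae_ae_of_ae_compProd h2)
  filter_upwards [h1, h3] with ω e1 e3
  rw [← e1]
  exact lintegral_mono_ae e3

/-- The bound on the information ratio. -/
theorem lintegral_ratio_le [StandardBorelSpace Ξ] [Nonempty Ξ] (hB : IsNoisyBandit P μ K R θ Y)
    (hA : IsSTS P K R θ Y ξ ε σ g A) (hε : 0 < ε) (t : ℕ) :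
    ∫⁻ ω, ENNReal.ofReal (posteriorShortfall P R Y A (satisficingArm θ A ε) t ω ^ 2) /
      posteriorCondMutualInfo P (history Y A t) (satisficingArm θ A ε) (observed Y A t) ξ
        (history Y A t ω) ∂P
      ≤ ∫⁻ ω, ((arms (history Y A t ω)).card + ENNReal.ofReal (1 / μ.real (Set.Ici (1 - ε)))) ∂P := by
  obtain ⟨k, hkM, hk⟩ := exists_posterior hB hA t
  refine lintegral_mono_ae ?_
  filter_upwards [ae_sq_posteriorShortfall_le hB hA hε hk, ae_historyGain_le hB hA hε hk]
    with ω h1 h2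
  -- The product form also covers vanishing information: the shortfall is then 0 and the convention
  -- `0 / 0 = 0` applies.
  exact ENNReal.div_le_of_le_mul (h1.trans (by gcongr))

/-- The discounted bound on the number of played arms. -/
theorem tsum_lintegral_card_le (hB : IsNoisyBandit P μ K R θ Y)
    (hA : IsSTS P K R θ Y ξ ε σ g A) (hε : 0 < ε) {α : ℝ} (hα : α ∈ Set.Ico (0 : ℝ) 1) :
    ENNReal.ofReal (1 - α ^ 2) * ∑' t : ℕ, ENNReal.ofReal (α ^ (2 * t)) *
      ∫⁻ ω, ((arms (history Y A t ω)).card + ENNReal.ofReal (1 / μ.real (Set.Ici (1 - ε)))) ∂P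
      ≤ ENNReal.ofReal (ratioBound (μ.real (Set.Ioi (1 - ε))) α) := by
  set c := 1 - ε
  set δ := μ.real (Set.Ioi c)
  set p := μ.real (Set.Ici c)
  have hδ0 : 0 < δ :=
    ENNReal.toReal_pos (measure_Ioi_pos_of_support hB.support_prior (by linarith)).ne'
      (measure_ne_top _ _)
  have hδ1 : δ ≤ 1 := measureReal_le_one
  have hδp : δ ≤ p := measureReal_mono Set.Ioi_subset_Ici_self
  have hb0 : 0 ≤ α ^ 2 := sq_nonneg α
  have hb1 : α ^ 2 < 1 := by nlinarith [hα.1, hα.2]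
  have hm : ∀ t, Measurable fun ω => ((arms (history Y A t ω)).card : ℝ≥0∞) := fun t =>
    (measurable_of_arms fun s => (s.card : ℝ≥0∞)).comp (measurable_history hB hA t)
  have e : ∀ t, ∫⁻ ω, ((arms (history Y A t ω)).card + ENNReal.ofReal (1 / p)) ∂P
      = ∑ s ∈ Finset.range t, P {ω | θ ω ∈ allBad c (history Y A s ω)} + ENNReal.ofReal (1 / p) := by
    intro t
    rw [lintegral_add_left (hm t), lintegral_card_arms hB hA t]
    simp
    rfl
  simp_rw [e, mul_add, pow_mul]
  rw [ENNReal.tsum_add, mul_add, tsum_pow_mul_sum_range_eq hb0 hb1, ENNReal.tsum_mul_right,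
    ← ENNReal.ofReal_tsum_of_nonneg (fun n => by positivity) (summable_geometric_of_lt_one hb0 hb1),
    tsum_geometric_of_lt_one hb0 hb1, ← mul_assoc, ← ENNReal.ofReal_mul (by linarith),
    mul_inv_cancel₀ (by linarith), ENNReal.ofReal_one, one_mul]
  have hsum := tsum_pow_mul_harmonic_le hb0 hb1 hδ0
    (y := fun s => P {ω | θ ω ∈ allBad c (history Y A s ω)}) (by
      intro s
      rw [← ENNReal.ofReal_toReal (measure_ne_top P _)]
      exact ENNReal.ofReal_le_ofReal ((measureReal_allBad_le hB hA s).trans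
        (one_div_one_add_mul_le hδ0 hδ1 hδp s)))
  have hlog : 0 ≤ Real.log (1 / (1 - α ^ 2)) :=
    Real.log_nonneg ((one_le_div (by linarith)).2 (by linarith))
  have hd : 0 < 1 / δ := by positivity
  -- The estimate reached is `(1 / δ)(1 + log (1 / (1 - α²)))`; what `ratioBound` has beyond that is
  -- slack.
  calc _ ≤ ENNReal.ofReal (1 / δ * Real.log (1 / (1 - α ^ 2))) + ENNReal.ofReal (1 / p) := by gcongr
    _ ≤ ENNReal.ofReal (1 / δ * Real.log (1 / (1 - α ^ 2))) + ENNReal.ofReal (1 / δ) := by gcongr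
    _ = ENNReal.ofReal (1 / δ * Real.log (1 / (1 - α ^ 2)) + 1 / δ) :=
        (ENNReal.ofReal_add (by positivity) (by positivity)).symm
    _ ≤ _ := by
        apply ENNReal.ofReal_le_ofReal
        rw [ratioBound]
        have e1 : 4 / δ = 4 * (1 / δ) := by ring
        have e2 : 2 / δ = 2 * (1 / δ) := by ring
        rw [e1, e2]
        nlinarith [mul_nonneg hd.le hlog]

theorem informationRatio_le [StandardBorelSpace Ξ] [Nonempty Ξ] (hB : IsNoisyBandit P μ K R θ Y)
    (hA : IsSTS P K R θ Y ξ ε σ g A) (hε : 0 < ε) {α : ℝ} (hα : α ∈ Set.Ico (0 : ℝ) 1) :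
    informationRatio P R Y ξ α (satisficingArm θ A ε) A
      ≤ ENNReal.ofReal (ratioBound (μ.real (Set.Ioi (1 - ε))) α) := by
  refine le_trans ?_ (tsum_lintegral_card_le hB hA hε hα)
  rw [informationRatio]
  refine mul_le_mul_right (ENNReal.tsum_le_tsum fun t => mul_le_mul_right ?_ _) _
  exact lintegral_ratio_le hB hA hε t

end InformationRatio

/-- Disintegration tested on the graph of `b`. Letting `b` depend on the conditioning variable is
what makes it applicable to the played arm. -/
theorem lintegral_mul_condDistrib_singleton {Ω E : Type*} [MeasurableSpace Ω] [MeasurableSpace E]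
    {P : Measure Ω} [IsFiniteMeasure P] {U : Ω → E} {X : Ω → ℕ} (hU : Measurable U)
    (hX : Measurable X) {f : E → ℝ≥0∞} (hf : Measurable f) {b : E → ℕ} (hb : Measurable b) :
    ∫⁻ ω, f (U ω) * {ω | X ω = b (U ω)}.indicator (fun _ => 1) ω ∂P
      = ∫⁻ ω, f (U ω) * condDistrib X U P (U ω) {b (U ω)} ∂P := by
  have hS : MeasurableSet {p : E × ℕ | p.2 = b p.1} :=
    measurableSet_eq_fun measurable_snd (hb.comp measurable_fst)
  have h := lintegral_condDistrib (P := P) hU hX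
    (f := fun p => f p.1 * {p : E × ℕ | p.2 = b p.1}.indicator (fun _ => 1) p)
    ((hf.comp measurable_fst).mul (measurable_const.indicator hS))
  refine Eq.trans ?_ (h.trans (lintegral_congr fun ω => ?_))
  · rfl
  · dsimp only
    rw [lintegral_const_mul _ (show Measurable fun z =>
      {p : E × ℕ | p.2 = b p.1}.indicator (fun _ => (1 : ℝ≥0∞)) (U ω, z) from
        (measurable_const.indicator hS).comp measurable_prodMk_left),
      ← lintegral_indicator_one (measurableSet_singleton (b (U ω)))]
    rfl

/-- Conditional entropy as an integral over the sample space. -/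
theorem condEntropy_eq {Ω E : Type*} [MeasurableSpace Ω] [MeasurableSpace E]
    {P : Measure Ω} [IsFiniteMeasure P] {U : Ω → E} {X : Ω → ℕ} (hU : Measurable U) :
    condEntropy P X U
      = ∫⁻ ω, ∑' a, ENNReal.ofReal (Real.negMulLog ((condDistrib X U P (U ω)).real {a})) ∂P := by
  rw [condEntropy, lintegral_map _ hU]
  exact Measurable.tsum fun a => ENNReal.measurable_ofReal.comp
    (Real.continuous_negMulLog.measurable.comp
      (Kernel.measurable_coe _ (measurableSet_singleton a)).ennreal_toReal)

/-- Conditioning on an additional constant does not change the conditional entropy. -/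
theorem condEntropy_unique_prod {Ω E F : Type*} [MeasurableSpace Ω] [MeasurableSpace E]
    [MeasurableSpace F] [Unique E] {P : Measure Ω} [IsFiniteMeasure P] {V : Ω → E} {Z : Ω → F}
    {X : Ω → ℕ} (hV : Measurable V) (hZ : Measurable Z) (hX : Measurable X) :
    condEntropy P X (fun ω => (V ω, Z ω)) = condEntropy P X Z := by
  have hU : Measurable fun ω => (V ω, Z ω) := hV.prodMk hZ
  rw [condEntropy_eq hU, condEntropy_eq hZ]
  have h : ∀ a, ∀ᵐ ω ∂P, condDistrib X (fun ω => (V ω, Z ω)) P (V ω, Z ω) {a}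
      = condDistrib X Z P (Z ω) {a} := by
    intro a
    have hS : MeasurableSet {p : (E × F) × ℕ | p.2 = a} :=
      measurable_snd (measurableSet_singleton a)
    have key := ae_lintegral_condDistrib_eq (P := P) hU hX
      (f := {p : (E × F) × ℕ | p.2 = a}.indicator fun _ => 1) (measurable_const.indicator hS)
      (w := fun u => condDistrib X Z P u.2 {a})
      ((Kernel.measurable_coe _ (measurableSet_singleton a)).comp measurable_snd) (by
        intro D hD
        have h1 := lintegral_mul_condDistrib_singleton (P := P) hZ hX
          (f := (Prod.mk (default : E) ⁻¹' D).indicator fun _ => 1)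
          (measurable_const.indicator (measurable_prodMk_left hD)) (b := fun _ => a)
          measurable_const
        rw [← lintegral_indicator (hU hD), ← lintegral_indicator (hU hD)]
        refine Eq.trans (lintegral_congr fun ω => ?_) (h1.trans (lintegral_congr fun ω => ?_))
        · by_cases hω : (V ω, Z ω) ∈ D
          · rw [Set.indicator_of_mem (by exact hω), Set.indicator_of_mem (s := Prod.mk default ⁻¹' D)
              (by rw [Unique.eq_default (V ω)] at hω; exact hω), one_mul]
            rfl
          · rw [Set.indicator_of_notMem (by exact hω), Set.indicator_of_notMem
              (by rw [Unique.eq_default (V ω)] at hω; exact hω), zero_mul]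
        · by_cases hω : (V ω, Z ω) ∈ D
          · rw [Set.indicator_of_mem (s := _ ⁻¹' D) (f := fun ω => condDistrib X Z P (Z ω) {a})
              (by exact hω), Set.indicator_of_mem
              (by rw [Unique.eq_default (V ω)] at hω; exact hω), one_mul]
          · rw [Set.indicator_of_notMem (s := (fun ω => (V ω, Z ω)) ⁻¹' D) (by exact hω),
              Set.indicator_of_notMem
              (by rw [Unique.eq_default (V ω)] at hω; exact hω), zero_mul])
    filter_upwards [key] with ω hω
    rw [← hω, ← lintegral_indicator_one (measurableSet_singleton a)]
    rfl
  refine lintegral_congr_ae ?_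
  filter_upwards [ae_all_iff.2 h] with ω hω
  simp only [measureReal_def, hω]

/-- The concavity bound for entropy, in extended nonnegative form. -/
theorem gain_add_lintegral_negMulLog_le {β : Type*} [MeasurableSpace β] (m : Measure β)
    [IsProbabilityMeasure m] {v : β → ℝ≥0∞} {f : β → ℝ} (hv : Measurable v) (hf : Measurable f)
    (hv1 : ∀ y, v y ≤ 1) (hf01 : ∀ y, f y ∈ Set.Icc (0 : ℝ) 1) :
    gain (∫⁻ y, v y ∂m) (∫⁻ y, v y * ENNReal.ofReal (f y) ∂m) (∫⁻ y, ENNReal.ofReal (f y) ∂m)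
      + ∫⁻ y, ENNReal.ofReal (Real.negMulLog (v y).toReal) ∂m
      ≤ ENNReal.ofReal (Real.negMulLog (∫⁻ y, v y ∂m).toReal) := by
  have hne : ∀ y, v y ≠ ∞ := fun y => ((hv1 y).trans_lt ENNReal.one_lt_top).ne
  have h01 : ∀ y, (v y).toReal ∈ Set.Icc (0 : ℝ) 1 := fun y =>
    ⟨ENNReal.toReal_nonneg, ENNReal.toReal_le_of_le_ofReal zero_le_one (by simpa using hv1 y)⟩
  have hvm := hv.ennreal_toReal
  have key := sq_cov_div_add_integral_negMulLog_le m hvm hf h01 hf01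
  have i1 : ∫ y, (v y).toReal ∂m = (∫⁻ y, v y ∂m).toReal :=
    integral_toReal hv.aemeasurable (Filter.Eventually.of_forall fun y => (hne y).lt_top)
  have i2 : ∫ y, (v y).toReal * f y ∂m = (∫⁻ y, v y * ENNReal.ofReal (f y) ∂m).toReal := by
    rw [← integral_toReal (show Measurable fun y => v y * ENNReal.ofReal (f y) from
      hv.mul hf.ennreal_ofReal).aemeasurable
      (Filter.Eventually.of_forall fun y => (ENNReal.mul_ne_top (hne y) ENNReal.ofReal_ne_top).lt_top)]
    refine integral_congr_ae (Filter.Eventually.of_forall fun y => ?_)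
    dsimp only
    rw [ENNReal.toReal_mul, ENNReal.toReal_ofReal (hf01 y).1]
  have i3 : ∫ y, f y ∂m = (∫⁻ y, ENNReal.ofReal (f y) ∂m).toReal :=
    integral_eq_lintegral_of_nonneg_ae (Filter.Eventually.of_forall fun y => (hf01 y).1)
      hf.aestronglyMeasurable
  have hnn : ∀ y, 0 ≤ Real.negMulLog (v y).toReal := fun y =>
    Real.negMulLog_nonneg (h01 y).1 (h01 y).2
  have i4 : ∫⁻ y, ENNReal.ofReal (Real.negMulLog (v y).toReal) ∂m
      = ENNReal.ofReal (∫ y, Real.negMulLog (v y).toReal ∂m) := by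
    rw [ofReal_integral_eq_lintegral_ofReal _ (Filter.Eventually.of_forall hnn)]
    refine Integrable.of_mem_Icc 0 1 (Real.continuous_negMulLog.measurable.comp hvm).aemeasurable
      (Filter.Eventually.of_forall fun y => ⟨hnn y, ?_⟩)
    have := Real.negMulLog_le_one_sub_self (h01 y).1
    linarith [(h01 y).1]
  rw [i1, i2, i3] at key
  rw [gain, i4, ← ENNReal.ofReal_add (by positivity) (integral_nonneg hnn)]
  exact ENNReal.ofReal_le_ofReal key

/-! ### Decrease of the conditional entropy of the benchmark. -/

section EntropyDecrease

variable {Ω 𝒴 Ξ : Type*} [MeasurableSpace Ω] [MeasurableSpace 𝒴] [MeasurableSpace Ξ]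
  {P : Measure Ω} {μ : Measure ℝ} {K : Kernel (ℕ → ℝ) (ℕ → 𝒴)} {R : 𝒴 → ℝ} {θ : Ω → ℕ → ℝ}
  {Y : ℕ∞ → Ω → ℕ → 𝒴} {ξ : Ω → Ξ} {ε : ℝ} {σ : Ξ → ℕ → ℕ}
  {g : (t : ℕ) → (Fin t → ℕ × 𝒴) × Ξ → ℕ → ℝ} {A : ℕ → Ω → ℕ} {t : ℕ}
  {k : Kernel (Fin t → ℕ × 𝒴) (ℕ → ℝ)} {π : (Fin t → ℕ × 𝒴) × Ξ → ℕ}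
  [StandardBorelSpace 𝒴] [Nonempty 𝒴] [IsProbabilityMeasure P] [IsProbabilityMeasure μ]
  [IsMarkovKernel K] [IsMarkovKernel k]

/-- One step of the process reduces the conditional entropy of the satisficing arm at least by the
expected gain. -/
theorem lintegral_stepGain_add_condEntropy_le (hB : IsNoisyBandit P μ K R θ Y)
    (hA : IsSTS P K R θ Y ξ ε σ g A) (hε : 0 < ε) (hk : IsPosterior P Y A ξ θ t k)
    (hπ : Measurable π) (hAπ : ∀ ω, A t ω = π (history Y A t ω, ξ ω)) :
    ∫⁻ ω, stepGain μ k (1 - ε) π (history Y A t ω, ξ ω) ∂P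
        + condEntropy P (satisficingArm θ A ε) (fun ω => (history Y A (t + 1) ω, ξ ω))
      ≤ condEntropy P (satisficingArm θ A ε) (fun ω => (history Y A t ω, ξ ω)) := by
  classical
  have hU := measurable_state hB hA t
  have hU' := measurable_state hB hA (t + 1)
  have hX := measurable_satisficingArm hB hA
  have hobs : Measurable (observed Y A t) :=
    measurable_observed hB.measurable_outcome (measurable_action hB hA t)
  have hclip := measurable_clip hB.measurable_reward
  set X := satisficingArm θ A ε with hXdef
  set U := fun ω => (history Y A t ω, ξ ω) with hUdef
  set U' := fun ω => (history Y A (t + 1) ω, ξ ω) with hU'def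
  set ψ : ((Fin t → ℕ × 𝒴) × Ξ) × 𝒴 → (Fin (t + 1) → ℕ × 𝒴) × Ξ := fun p =>
    (Fin.snoc (α := fun _ => ℕ × 𝒴) p.1.1 (π p.1, p.2), p.1.2) with hψ
  have hψm : Measurable ψ :=
    (measurable_snoc.comp (show Measurable fun p : ((Fin t → ℕ × 𝒴) × Ξ) × 𝒴 =>
      (p.1.1, (π p.1, p.2)) by fun_prop)).prodMk (by fun_prop)
  have hψU : ∀ ω, ψ (U ω, observed Y A t ω) = U' ω := by
    intro ω
    simp only [hψ, hU'def, hUdef, history_succ, hAπ]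
  set ι : (Fin (t + 1) → ℕ × 𝒴) × Ξ → (Fin t → ℕ × 𝒴) × Ξ := fun p =>
    (fun i => p.1 i.castSucc, p.2) with hι
  have hιm : Measurable ι := by fun_prop
  have hιU : ∀ ω, ι (U' ω) = U ω := fun ω => rfl
  -- The probability that the benchmark is `a` after the next observation, as a function of the
  -- present state and that observation.
  set v : ℕ → ((Fin t → ℕ × 𝒴) × Ξ) × 𝒴 → ℝ≥0∞ := fun a p => condDistrib X U' P (ψ p) {a} with hv
  have hvm : ∀ a, Measurable (v a) := fun a =>
    (Kernel.measurable_coe _ (measurableSet_singleton a)).comp hψm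
  have hvπm : Measurable fun p => v (π p.1) p := by
    have h1 : Measurable fun p : ℕ × (((Fin t → ℕ × 𝒴) × Ξ) × 𝒴) => v p.1 p.2 :=
      measurable_from_prod_countable_right hvm
    exact h1.comp ((hπ.comp measurable_fst).prodMk measurable_id)
  -- Tower property: the updated probabilities average to the present ones, since the present state
  -- is a function of the next one.
  have ha : ∀ a, ∀ᵐ ω ∂P, ∫⁻ y, v a (U ω, y) ∂(condDistrib (observed Y A t) U P (U ω))
      = condDistrib X U P (U ω) {a} := by
    intro a
    refine ae_lintegral_condDistrib_eq hU hobs (hvm a)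
      (w := fun u => condDistrib X U P u {a})
      (Kernel.measurable_coe _ (measurableSet_singleton a)) fun D hD => ?_
    have h1 := lintegral_mul_condDistrib_singleton (P := P) hU hX (f := D.indicator fun _ => 1)
      (measurable_const.indicator hD) (b := fun _ => a) measurable_const
    have h2 := lintegral_mul_condDistrib_singleton (P := P) hU' hX
      (f := (ι ⁻¹' D).indicator fun _ => 1)
      (measurable_const.indicator (hιm hD)) (b := fun _ => a) measurable_const
    have hD' := hU hD
    rw [← lintegral_indicator hD', ← lintegral_indicator hD']
    refine Eq.trans (lintegral_congr fun ω => ?_)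
      ((h2.symm.trans h1).trans (lintegral_congr fun ω => ?_))
    · by_cases hω : U ω ∈ D
      · rw [Set.indicator_of_mem (by exact hω), Set.indicator_of_mem (by exact hω), one_mul]
        simp only [hv, hψU]
      · rw [Set.indicator_of_notMem (by exact hω), Set.indicator_of_notMem (by exact hω), zero_mul]
    · by_cases hω : U ω ∈ D
      · rw [Set.indicator_of_mem (by exact hω), Set.indicator_of_mem (by exact hω), one_mul]
      · rw [Set.indicator_of_notMem (by exact hω), Set.indicator_of_notMem (by exact hω), zero_mul]
  -- The same for the joint moment of hit event and reward: the reward is known from the next state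
  -- and can be taken out of the conditioning.
  have hb : ∀ᵐ ω ∂P, ∫⁻ y, v (π (U ω)) (U ω, y) * ENNReal.ofReal (clip R y)
      ∂(condDistrib (observed Y A t) U P (U ω)) = hitMass μ k (1 - ε) π ENNReal.ofReal (U ω) := by
    refine ae_lintegral_condDistrib_eq hU hobs
      (f := fun p => v (π p.1) p * ENNReal.ofReal (clip R p.2))
      (hvπm.mul (by fun_prop)) (measurable_hitMass hπ ENNReal.measurable_ofReal) fun D hD => ?_
    have hlm : Measurable fun p : (Fin (t + 1) → ℕ × 𝒴) × Ξ =>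
        ENNReal.ofReal (clip R (p.1 (Fin.last t)).2) := by fun_prop
    have h2 := lintegral_mul_condDistrib_singleton (P := P) hU' hX
      (f := (ι ⁻¹' D).indicator fun p => ENNReal.ofReal (clip R (p.1 (Fin.last t)).2))
      (hlm.indicator (hιm hD)) (b := fun p => π (ι p)) (hπ.comp hιm)
    have h3 := setLIntegral_hit_reward hB hA hε hk hπ hAπ hD
    have hD' := hU hD
    rw [← lintegral_indicator hD'] at h3
    refine Eq.trans ?_ h3
    rw [← lintegral_indicator hD']
    refine Eq.trans (lintegral_congr fun ω => ?_)
      (h2.symm.trans (lintegral_congr fun ω => ?_))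
    · by_cases hω : U ω ∈ D
      · rw [Set.indicator_of_mem (by exact hω), Set.indicator_of_mem (by exact hω), mul_comm]
        simp only [hv, hψU, hιU]
        rfl
      · rw [Set.indicator_of_notMem (by exact hω), Set.indicator_of_notMem (by exact hω), zero_mul]
    · by_cases hω : U ω ∈ D
      · rw [Set.indicator_of_mem (s := ι ⁻¹' D) (by exact hω),
          Set.indicator_of_mem (s := U ⁻¹' D) (by exact hω)]
        by_cases hx : X ω = A t ω
        · rw [Set.indicator_of_mem (by exact hx.trans (hAπ ω)), Set.indicator_of_mem (by exact hx),
            mul_one]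
          rfl
        · rw [Set.indicator_of_notMem (s := {ω | X ω = π (ι (U' ω))})
              (fun hc => hx (Eq.trans (by exact hc) (hAπ ω).symm)),
            Set.indicator_of_notMem (by exact hx), mul_zero]
      · rw [Set.indicator_of_notMem (s := ι ⁻¹' D) (by exact hω),
          Set.indicator_of_notMem (s := U ⁻¹' D) (by exact hω), zero_mul]
  have hc : ∀ᵐ ω ∂P, ∫⁻ y, ENNReal.ofReal (clip R y)
      ∂(condDistrib (observed Y A t) U P (U ω)) = playMean μ k π (U ω) :=
    ae_lintegral_condDistrib_eq hU hobs (f := fun p => ENNReal.ofReal (clip R p.2))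
      (by fun_prop) (measurable_playMean hπ) fun D hD => setLIntegral_reward hB hA hk hπ hAπ hD
  have hd : ∀ᵐ ω ∂P, condDistrib X U P (U ω) {π (U ω)}
      = hitMass μ k (1 - ε) π (fun _ => 1) (U ω) := by
    have hS : MeasurableSet {p : ((Fin t → ℕ × 𝒴) × Ξ) × ℕ | p.2 = π p.1} :=
      measurableSet_eq_fun measurable_snd (hπ.comp measurable_fst)
    have := ae_lintegral_condDistrib_eq (P := P) hU hX
      (f := {p : ((Fin t → ℕ × 𝒴) × Ξ) × ℕ | p.2 = π p.1}.indicator fun _ => 1)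
      (measurable_const.indicator hS)
      (measurable_hitMass (μ := μ) (k := k) (c := 1 - ε) hπ measurable_const) fun D hD => by
        rw [← setLIntegral_hit_one hB hA hε hk hπ hAπ hD]
        refine lintegral_congr fun ω => ?_
        by_cases hx : X ω = A t ω
        · rw [Set.indicator_of_mem (by exact hx.trans (hAπ ω)), Set.indicator_of_mem (by exact hx)]
        · rw [Set.indicator_of_notMem (fun hc => hx (hc.trans (hAπ ω).symm)),
            Set.indicator_of_notMem (by exact hx)]
    filter_upwards [this] with ω hω
    rw [← hω, ← lintegral_indicator_one (measurableSet_singleton _)]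
    rfl
  set φ : ((Fin t → ℕ × 𝒴) × Ξ) × 𝒴 → ℝ≥0∞ := fun p =>
    ∑' a, ENNReal.ofReal (Real.negMulLog (v a p).toReal) with hφ
  have hφam : ∀ a, Measurable fun p => ENNReal.ofReal (Real.negMulLog (v a p).toReal) := fun a =>
    ENNReal.measurable_ofReal.comp
      (Real.continuous_negMulLog.measurable.comp (hvm a).ennreal_toReal)
  have hφm : Measurable φ := Measurable.tsum hφam
  have hent : condEntropy P X U'
      = ∫⁻ ω, ∫⁻ y, φ (U ω, y) ∂(condDistrib (observed Y A t) U P (U ω)) ∂P := by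
    rw [← lintegral_condDistrib hU hobs hφm, condEntropy_eq hU']
    refine lintegral_congr fun ω => ?_
    simp only [hφ, hv, hψU]
    rfl
  rw [hent, condEntropy_eq hU, ← lintegral_add_left (show Measurable fun ω =>
    stepGain μ k (1 - ε) π (history Y A t ω, ξ ω) from (measurable_stepGain hπ).comp hU)]
  refine lintegral_mono_ae ?_
  filter_upwards [ae_all_iff.2 ha, hb, hc, hd] with ω h1 h2 h3 h4
  have hv1 : ∀ a y, v a (U ω, y) ≤ 1 := fun a y => prob_le_one
  have hvy : ∀ a, Measurable fun y => v a (U ω, y) := fun a => (hvm a).comp measurable_prodMk_left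
  have hφy : ∀ a, Measurable fun y => ENNReal.ofReal (Real.negMulLog (v a (U ω, y)).toReal) :=
    fun a => (hφam a).comp measurable_prodMk_left
  simp only [hφ]
  -- The comparison is made arm by arm. The quantitative gain is kept only for the played arm; for
  -- all other arms plain concavity of `negMulLog` is enough.
  rw [lintegral_tsum fun a => (hφy a).aemeasurable,
    ← tsum_ite_eq (π (U ω)) (fun _ => stepGain μ k (1 - ε) π (U ω)), ← ENNReal.tsum_add]
  refine ENNReal.tsum_le_tsum fun a => ?_
  rw [measureReal_def, ← h1 a]
  split_ifs with haπ
  · subst haπ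
    have := gain_add_lintegral_negMulLog_le (condDistrib (observed Y A t) U P (U ω))
      (hvy (π (U ω))) hclip (hv1 _) (clip_mem R)
    rw [h2, h3, h1, h4] at this
    rw [h1, h4]
    exact this
  · have := gain_add_lintegral_negMulLog_le (condDistrib (observed Y A t) U P (U ω))
      (hvy a) hclip (hv1 _) (clip_mem R)
    rw [zero_add]
    exact le_add_self.trans this

/-- The total expected gain is at most the conditional entropy of the satisficing arm. -/
theorem tsum_lintegral_historyGain_le (hB : IsNoisyBandit P μ K R θ Y)
    (hA : IsSTS P K R θ Y ξ ε σ g A) (hε : 0 < ε)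
    {k : (t : ℕ) → Kernel (Fin t → ℕ × 𝒴) (ℕ → ℝ)} [∀ t, IsMarkovKernel (k t)]
    (hk : ∀ t, IsPosterior P Y A ξ θ t (k t)) :
    ∑' t, ∫⁻ ω, historyGain μ (k t) (1 - ε) (history Y A t ω) ∂P
      ≤ condEntropy P (satisficingArm θ A ε) ξ := by
  have hstep : ∀ t, ∫⁻ ω, historyGain μ (k t) (1 - ε) (history Y A t ω) ∂P
      + condEntropy P (satisficingArm θ A ε) (fun ω => (history Y A (t + 1) ω, ξ ω))
      ≤ condEntropy P (satisficingArm θ A ε) (fun ω => (history Y A t ω, ξ ω)) := by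
    intro t
    obtain ⟨π, hπ, hAπ⟩ := exists_policy hB.measurable_reward hA t
    have h1 := setLIntegral_stepGain hB hA (hk t) hAπ MeasurableSet.univ
    simp only [Set.preimage_univ, Measure.restrict_univ] at h1
    rw [← h1]
    exact lintegral_stepGain_add_condEntropy_le hB hA hε (hk t) hπ hAπ
  rw [← condEntropy_unique_prod (measurable_history hB hA 0) hA.measurable_exo
    (measurable_satisficingArm hB hA)]
  -- Telescoping in additive form, which avoids subtracting entropies in `ℝ≥0∞`.
  have hpart : ∀ n, ∑ t ∈ Finset.range n, ∫⁻ ω, historyGain μ (k t) (1 - ε) (history Y A t ω) ∂P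
      + condEntropy P (satisficingArm θ A ε) (fun ω => (history Y A n ω, ξ ω))
      ≤ condEntropy P (satisficingArm θ A ε) (fun ω => (history Y A 0 ω, ξ ω)) := by
    intro n
    induction n with
    | zero => simp
    | succ n ih =>
      rw [Finset.sum_range_succ, add_assoc]
      exact le_trans (by gcongr; exact hstep n) ih
  rw [ENNReal.tsum_eq_iSup_nat]
  exact iSup_le fun n => le_self_add.trans (hpart n)

end EntropyDecrease

/-- Weighted AM–GM: `a |s| ≤ √(a² C J) ≤ (l / 2) a² C + J / (2 l)`. With `l` common to all times and
outcomes, optimizing it after summation replaces Cauchy–Schwarz in expectation and in time at once.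
-/
theorem ofReal_mul_abs_le_of_sq_le {a s l : ℝ} (hl : 0 < l) {C J : ℝ≥0∞}
    (hC : C ≠ ∞) (h : ENNReal.ofReal (s ^ 2) ≤ C * J) :
    ENNReal.ofReal (a * |s|)
      ≤ ENNReal.ofReal (l / 2) * (ENNReal.ofReal (a ^ 2) * C) + ENNReal.ofReal (1 / (2 * l)) * J := by
  by_cases hJ : J = ∞
  · have : ENNReal.ofReal (1 / (2 * l)) * J = ∞ := by
      rw [hJ]
      exact ENNReal.mul_top (by simpa using hl)
    rw [this]
    simp
  lift C to NNReal using hC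
  lift J to NNReal using hJ
  have h1 : s ^ 2 ≤ C * J := by
    rw [← ENNReal.coe_mul, ← ENNReal.ofReal_coe_nnreal,
      ENNReal.ofReal_le_ofReal_iff NNReal.zero_le_coe] at h
    simpa using h
  rw [← ENNReal.ofReal_coe_nnreal, ← ENNReal.ofReal_coe_nnreal,
    ← ENNReal.ofReal_mul (by positivity), ← ENNReal.ofReal_mul (by positivity),
    ← ENNReal.ofReal_mul (by positivity), ← ENNReal.ofReal_add (by positivity) (by positivity)]
  apply ENNReal.ofReal_le_ofReal
  refine le_of_sq_le_sq ?_ (by positivity)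
  have hx : (0 : ℝ) ≤ C := C.2
  have hj : (0 : ℝ) ≤ J := J.2
  have e : (l / 2 * (a ^ 2 * C) + 1 / (2 * l) * J) ^ 2
      = (l / 2 * (a ^ 2 * C) - 1 / (2 * l) * J) ^ 2 + a ^ 2 * (C * J) := by
    field_simp
    ring
  rw [e, mul_pow, sq_abs]
  nlinarith [sq_nonneg (l / 2 * (a ^ 2 * (C : ℝ)) - 1 / (2 * l) * J),
    mul_le_mul_of_nonneg_left h1 (sq_nonneg a)]

/-! ### Discounted regret. -/

section Regret

variable {Ω 𝒴 Ξ : Type*} [MeasurableSpace Ω] [MeasurableSpace 𝒴] [MeasurableSpace Ξ]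
  {P : Measure Ω} {μ : Measure ℝ} {K : Kernel (ℕ → ℝ) (ℕ → 𝒴)} {R : 𝒴 → ℝ} {θ : Ω → ℕ → ℝ}
  {Y : ℕ∞ → Ω → ℕ → 𝒴} {ξ : Ω → Ξ} {ε : ℝ} {σ : Ξ → ℕ → ℕ}
  {g : (t : ℕ) → (Fin t → ℕ × 𝒴) × Ξ → ℕ → ℝ} {A : ℕ → Ω → ℕ} {α : ℝ}
  [StandardBorelSpace 𝒴] [Nonempty 𝒴] [IsProbabilityMeasure P] [IsProbabilityMeasure μ]
  [IsMarkovKernel K]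

/-- At time 0 nothing has been found, so the mean benchmark reward times `p` equals the integral of
`r` over `[1-ε, ∞)`, which is at least `(1 - ε) p`. -/
theorem one_sub_le_integral_benchmark (hB : IsNoisyBandit P μ K R θ Y)
    (hA : IsSTS P K R θ Y ξ ε σ g A) (hε : 0 < ε) :
    1 - ε ≤ ∫ ω, R (Y ⊤ ω (satisficingArm θ A ε ω)) ∂P := by
  set c := 1 - ε with hc
  have hm : Measurable fun ω => R (Y ⊤ ω (satisficingArm θ A ε ω)) :=
    hB.measurable_reward.comp ((hB.measurable_outcome ⊤).eval_nat (measurable_satisficingArm hB hA))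
  have hp : 0 < μ (Set.Ici c) :=
    (measure_Ioi_pos_of_support hB.support_prior (by linarith)).trans_le
      (measure_mono Set.Ioi_subset_Ici_self)
  have h01 : ∀ᵐ ω ∂P, R (Y ⊤ ω (satisficingArm θ A ε ω)) ∈ Set.Icc (0 : ℝ) 1 := by
    filter_upwards [ae_reward_mem hB ⊤] with ω hω using hω _
  have h1 := setLIntegral_allBad_reward hB hA hε (t := 0) MeasurableSet.univ
  have huniv : (history Y A 0 ⁻¹' Set.univ ∩ {ω | θ ω ∈ allBad c (history Y A 0 ω)} : Set Ω)
      = Set.univ := by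
    ext ω
    simp only [Set.preimage_univ, Set.univ_inter, Set.mem_ofPred_eq, Set.mem_univ, iff_true]
    exact fun i => i.elim0
  rw [huniv, Measure.restrict_univ, measure_univ, one_mul] at h1
  have h2 : ENNReal.ofReal c * μ (Set.Ici c) ≤ ∫⁻ r in Set.Ici c, ENNReal.ofReal r ∂μ := by
    rw [← setLIntegral_const]
    exact setLIntegral_mono ENNReal.measurable_ofReal fun r hr => ENNReal.ofReal_le_ofReal hr
  rw [← h1] at h2
  have h3 := (ENNReal.mul_le_mul_iff_left hp.ne' (measure_ne_top _ _)).1 h2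
  rw [integral_eq_lintegral_of_nonneg_ae (by filter_upwards [h01] with ω hω using hω.1)
    hm.aestronglyMeasurable]
  have hfin := (Integrable.of_mem_Icc 0 1 hm.aemeasurable h01).lintegral_lt_top
  exact (ENNReal.ofReal_le_iff_le_toReal hfin.ne).1 h3

/-- The expected gap of one step. -/
theorem integral_gap_le (hB : IsNoisyBandit P μ K R θ Y) (hA : IsSTS P K R θ Y ξ ε σ g A)
    (hε : 0 < ε) (t : ℕ) :
    ∫ ω, (1 - R (observed Y A t ω)) ∂P
      ≤ ε + ∫ ω, |posteriorShortfall P R Y A (satisficingArm θ A ε) t ω| ∂P := by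
  have hm1 : Measurable fun ω => R (Y ⊤ ω (satisficingArm θ A ε ω)) :=
    hB.measurable_reward.comp ((hB.measurable_outcome ⊤).eval_nat (measurable_satisficingArm hB hA))
  have hm2 : Measurable fun ω => R (observed Y A t ω) := hB.measurable_reward.comp
    (measurable_observed hB.measurable_outcome (measurable_action hB hA t))
  have hi1 : Integrable (fun ω => R (Y ⊤ ω (satisficingArm θ A ε ω))) P :=
    Integrable.of_mem_Icc 0 1 hm1.aemeasurable (by
      filter_upwards [ae_reward_mem hB ⊤] with ω hω using hω _)
  have hi2 : Integrable (fun ω => R (observed Y A t ω)) P :=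
    Integrable.of_mem_Icc 0 1 hm2.aemeasurable (by
      filter_upwards [ae_reward_mem hB t] with ω hω using hω _)
  have h1 : ∫ ω, posteriorShortfall P R Y A (satisficingArm θ A ε) t ω ∂P
      = ∫ ω, R (Y ⊤ ω (satisficingArm θ A ε ω)) ∂P - ∫ ω, R (observed Y A t ω) ∂P := by
    rw [← integral_sub hi1 hi2]
    exact integral_condExp (measurable_history hB hA t).comap_le
  have h2 : ∫ ω, posteriorShortfall P R Y A (satisficingArm θ A ε) t ω ∂P
      ≤ ∫ ω, |posteriorShortfall P R Y A (satisficingArm θ A ε) t ω| ∂P :=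
    (le_abs_self _).trans abs_integral_le_integral_abs
  have h3 := one_sub_le_integral_benchmark hB hA hε
  rw [integral_sub (integrable_const _) hi2]
  simp only [integral_const, probReal_univ, smul_eq_mul, mul_one]
  linarith

/-- After summing over time, the terms with the number of arms are bounded by `X` through the
discounted count, and the gains by `H` through the entropy of the benchmark. The choice `l = √(H /
X)` balances the two and gives `√(X H)`. -/
theorem tsum_shortfall_le (hB : IsNoisyBandit P μ K R θ Y) (hA : IsSTS P K R θ Y ξ ε σ g A)
    (hε : 0 < ε) (hα : α ∈ Set.Ico (0 : ℝ) 1) :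
    ∑' t : ℕ, ∫⁻ ω, ENNReal.ofReal
        (α ^ t * |posteriorShortfall P R Y A (satisficingArm θ A ε) t ω|) ∂P
      ≤ ENNReal.ofReal (Real.sqrt (ratioBound (μ.real (Set.Ioi (1 - ε))) α
          * (1 + Real.log (1 / μ.real (Set.Ioi (1 - ε)))) / (1 - α ^ 2))) := by
  choose k hkM hk using fun t => exists_posterior hB hA t
  set δ := μ.real (Set.Ioi (1 - ε)) with hδ
  have hδ0 : 0 < δ :=
    ENNReal.toReal_pos (measure_Ioi_pos_of_support hB.support_prior (by linarith)).ne'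
      (measure_ne_top _ _)
  have hδ1 : δ ≤ 1 := measureReal_le_one
  have hb1 : 0 < 1 - α ^ 2 := by nlinarith [hα.1, hα.2]
  set H := 1 + Real.log (1 / δ) with hH
  have hH0 : 0 < H := by
    have := Real.log_nonneg ((one_le_div hδ0).2 hδ1)
    linarith
  have hr0 : 0 < ratioBound δ α := by
    have h1 : 0 ≤ Real.log (1 / (1 - α ^ 2)) :=
      Real.log_nonneg ((one_le_div hb1).2 (by nlinarith [sq_nonneg α]))
    rw [ratioBound]
    positivity
  set X := ratioBound δ α / (1 - α ^ 2) with hX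
  have hX0 : 0 < X := div_pos hr0 hb1
  set l := Real.sqrt (H / X) with hl
  have hl0 : 0 < l := Real.sqrt_pos.2 (div_pos hH0 hX0)
  set C : ℕ → Ω → ℝ≥0∞ := fun t ω =>
    (arms (history Y A t ω)).card + ENNReal.ofReal (1 / μ.real (Set.Ici (1 - ε))) with hC
  have hCm : ∀ t, Measurable (C t) := fun t =>
    ((measurable_of_arms fun s => (s.card : ℝ≥0∞)).comp (measurable_history hB hA t)).add_const _
  have hJm : ∀ t, Measurable fun ω => historyGain μ (k t) (1 - ε) (history Y A t ω) := fun t =>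
    measurable_historyGain.comp (measurable_history hB hA t)
  have hstep : ∀ t, ∫⁻ ω, ENNReal.ofReal
      (α ^ t * |posteriorShortfall P R Y A (satisficingArm θ A ε) t ω|) ∂P
      ≤ ENNReal.ofReal (l / 2) * (ENNReal.ofReal (α ^ (2 * t)) * ∫⁻ ω, C t ω ∂P)
        + ENNReal.ofReal (1 / (2 * l))
          * ∫⁻ ω, historyGain μ (k t) (1 - ε) (history Y A t ω) ∂P := by
    intro t
    rw [← lintegral_const_mul _ (hCm t), ← lintegral_const_mul _ ((hCm t).const_mul _),
      ← lintegral_const_mul _ (hJm t), ← lintegral_add_left (((hCm t).const_mul _).const_mul _)]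
    refine lintegral_mono_ae ?_
    filter_upwards [ae_sq_posteriorShortfall_le hB hA hε (hk t)] with ω hω
    have := ofReal_mul_abs_le_of_sq_le (a := α ^ t) hl0 (by simp) hω
    rw [← pow_mul, mul_comm t 2] at this
    exact this
  have hsumC : ∑' t : ℕ, ENNReal.ofReal (α ^ (2 * t)) * ∫⁻ ω, C t ω ∂P ≤ ENNReal.ofReal X := by
    rw [hX, ENNReal.ofReal_div_of_pos hb1, ENNReal.le_div_iff_mul_le
      (Or.inl (by simpa using hb1)) (Or.inl ENNReal.ofReal_ne_top), mul_comm]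
    exact tsum_lintegral_card_le hB hA hε hα
  have hsumJ : ∑' t, ∫⁻ ω, historyGain μ (k t) (1 - ε) (history Y A t ω) ∂P ≤ ENNReal.ofReal H :=
    (tsum_lintegral_historyGain_le hB hA hε hk).trans (condEntropy_satisficingArm_le hB hA hε)
  calc _ ≤ _ := ENNReal.tsum_le_tsum hstep
    _ = ENNReal.ofReal (l / 2) * (∑' t : ℕ, ENNReal.ofReal (α ^ (2 * t)) * ∫⁻ ω, C t ω ∂P)
        + ENNReal.ofReal (1 / (2 * l))
          * ∑' t, ∫⁻ ω, historyGain μ (k t) (1 - ε) (history Y A t ω) ∂P := by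
        rw [ENNReal.tsum_add, ENNReal.tsum_mul_left, ENNReal.tsum_mul_left]
    _ ≤ ENNReal.ofReal (l / 2) * ENNReal.ofReal X
        + ENNReal.ofReal (1 / (2 * l)) * ENNReal.ofReal H := by gcongr
    _ = ENNReal.ofReal (l / 2 * X + 1 / (2 * l) * H) := by
        rw [← ENNReal.ofReal_mul (by positivity), ← ENNReal.ofReal_mul (by positivity),
          ← ENNReal.ofReal_add (by positivity) (by positivity)]
    _ ≤ _ := by
        apply ENNReal.ofReal_le_ofReal
        have e1 : ratioBound δ α * H / (1 - α ^ 2) = X * H := by rw [hX]; ring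
        have hl2 : l ^ 2 * X = H := by
          rw [hl, Real.sq_sqrt (div_pos hH0 hX0).le]
          field_simp
        have e2 : l / 2 * X + 1 / (2 * l) * H = l * X := by
          rw [← hl2]
          field_simp
          ring
        rw [e1, e2]
        refine Real.le_sqrt_of_sq_le (le_of_eq ?_)
        rw [mul_pow, ← hl2]
        ring

theorem ae_discountedGap (hB : IsNoisyBandit P μ K R θ Y) (hα : 0 ≤ α) :
    ∀ᵐ ω ∂P, ∀ t, discountedGap K R θ Y α A ω t = α ^ t * (1 - R (observed Y A t ω)) ∧
      discountedGap K R θ Y α A ω t ∈ Set.Icc 0 (α ^ t) := by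
  have h := ae_all_iff.2 fun t : ℕ => ae_reward_mem hB (t : ℕ∞)
  filter_upwards [h, ae_param_reward hB] with ω h1 h2 t
  have h3 : R (observed Y A t ω) ∈ Set.Icc (0 : ℝ) 1 := h1 t _
  have e : discountedGap K R θ Y α A ω t = α ^ t * (1 - R (observed Y A t ω)) := by
    rw [discountedGap, h2.2.1]
  refine ⟨e, ?_⟩
  rw [e]
  have := pow_nonneg hα t
  exact ⟨mul_nonneg this (by linarith [h3.2]), mul_le_of_le_one_right this (by linarith [h3.1])⟩

theorem ae_summable_discountedGap (hB : IsNoisyBandit P μ K R θ Y) (hα : α ∈ Set.Ico (0 : ℝ) 1) :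
    ∀ᵐ ω ∂P, Summable (discountedGap K R θ Y α A ω) := by
  filter_upwards [ae_discountedGap (A := A) hB hα.1] with ω hω
  exact Summable.of_nonneg_of_le (fun t => (hω t).2.1) (fun t => (hω t).2.2)
    (summable_geometric_of_lt_one hα.1 hα.2)

theorem measurable_discountedGap (hB : IsNoisyBandit P μ K R θ Y)
    (hA : IsSTS P K R θ Y ξ ε σ g A) (t : ℕ) :
    Measurable fun ω => discountedGap K R θ Y α A ω t :=
  (((measurable_optReward hB.measurable_reward).comp hB.measurable_param).sub
    (hB.measurable_reward.comp (measurable_observed hB.measurable_outcome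
      (measurable_action hB hA t)))).const_mul _

theorem integrable_tsum_discountedGap (hB : IsNoisyBandit P μ K R θ Y)
    (hA : IsSTS P K R θ Y ξ ε σ g A) (hα : α ∈ Set.Ico (0 : ℝ) 1) :
    Integrable (fun ω => ∑' t : ℕ, discountedGap K R θ Y α A ω t) P := by
  have hgeo := summable_geometric_of_lt_one hα.1 hα.2
  have hmeas : AEStronglyMeasurable (fun ω => ∑' t : ℕ, discountedGap K R θ Y α A ω t) P := by
    refine aestronglyMeasurable_of_tendsto_ae Filter.atTop
      (f := fun n ω => ∑ t ∈ Finset.range n, discountedGap K R θ Y α A ω t)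
      (fun n => (Finset.measurable_fun_sum _ fun t _ =>
        measurable_discountedGap hB hA t).aestronglyMeasurable) ?_
    filter_upwards [ae_summable_discountedGap (A := A) hB hα] with ω hω
    exact hω.hasSum.tendsto_sum_nat
  refine Integrable.of_mem_Icc 0 (∑' t : ℕ, α ^ t) hmeas.aemeasurable ?_
  filter_upwards [ae_discountedGap (A := A) hB hα.1, ae_summable_discountedGap (A := A) hB hα]
    with ω h1 h2
  exact ⟨tsum_nonneg fun t => (h1 t).2.1, h2.tsum_le_tsum (fun t => (h1 t).2.2) hgeo⟩

/-- The bound on the expected discounted regret. -/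
theorem integral_tsum_discountedGap_le (hB : IsNoisyBandit P μ K R θ Y)
    (hA : IsSTS P K R θ Y ξ ε σ g A) (hε : 0 < ε) (hα : α ∈ Set.Ico (0 : ℝ) 1) :
    ∫ ω, ∑' t : ℕ, discountedGap K R θ Y α A ω t ∂P
      ≤ regretBound ε (μ.real (Set.Ioi (1 - ε))) α := by
  have hgeo := summable_geometric_of_lt_one hα.1 hα.2
  have hae := ae_discountedGap (A := A) hB hα.1
  have hInt : ∀ t, Integrable (fun ω => discountedGap K R θ Y α A ω t) P := fun t =>
    Integrable.of_mem_Icc 0 (α ^ t) (measurable_discountedGap hB hA t).aemeasurable (by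
      filter_upwards [hae] with ω hω using (hω t).2)
  have hnorm : Summable fun t => ∫ ω, ‖discountedGap K R θ Y α A ω t‖ ∂P := by
    refine Summable.of_nonneg_of_le (fun t => integral_nonneg fun ω => norm_nonneg _)
      (fun t => ?_) hgeo
    calc ∫ ω, ‖discountedGap K R θ Y α A ω t‖ ∂P ≤ ∫ _, α ^ t ∂P := by
          refine integral_mono_ae (hInt t).norm (integrable_const _) ?_
          filter_upwards [hae] with ω hω
          rw [Real.norm_of_nonneg (hω t).2.1]
          exact (hω t).2.2
      _ = α ^ t := by simp
  -- Each term is at most `α ^ t` in absolute value, so expectation and sum may be exchanged and the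
  -- regret estimated time by time.
  have hsum := hasSum_integral_of_summable_integral_norm hInt hnorm
  set s : ℕ → ℝ := fun t =>
    α ^ t * ∫ ω, |posteriorShortfall P R Y A (satisficingArm θ A ε) t ω| ∂P with hs
  have hs0 : ∀ t, 0 ≤ s t := fun t =>
    mul_nonneg (pow_nonneg hα.1 t) (integral_nonneg fun _ => abs_nonneg _)
  have hsl : ∀ t, ENNReal.ofReal (s t) = ∫⁻ ω, ENNReal.ofReal
      (α ^ t * |posteriorShortfall P R Y A (satisficingArm θ A ε) t ω|) ∂P := by
    intro t
    rw [← ofReal_integral_eq_lintegral_ofReal, integral_const_mul]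
    · exact (integrable_condExp.abs).const_mul _
    · exact Filter.Eventually.of_forall fun ω => mul_nonneg (pow_nonneg hα.1 t) (abs_nonneg _)
  have hle := tsum_shortfall_le hB hA hε hα
  simp_rw [← hsl] at hle
  have hss : Summable s := by
    have := ENNReal.summable_toReal (hle.trans_lt ENNReal.ofReal_lt_top).ne
    simpa only [ENNReal.toReal_ofReal (hs0 _)] using this
  rw [← ENNReal.ofReal_tsum_of_nonneg hs0 hss,
    ENNReal.ofReal_le_ofReal_iff (Real.sqrt_nonneg _)] at hle
  have hterm : ∀ t, ∫ ω, discountedGap K R θ Y α A ω t ∂P ≤ α ^ t * ε + s t := by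
    intro t
    have e : ∫ ω, discountedGap K R θ Y α A ω t ∂P
        = α ^ t * ∫ ω, (1 - R (observed Y A t ω)) ∂P := by
      rw [← integral_const_mul]
      refine integral_congr_ae ?_
      filter_upwards [hae] with ω hω using (hω t).1
    rw [e, hs, ← mul_add]
    exact mul_le_mul_of_nonneg_left (integral_gap_le hB hA hε t) (pow_nonneg hα.1 t)
  rw [← hsum.tsum_eq]
  calc ∑' t, ∫ ω, discountedGap K R θ Y α A ω t ∂P ≤ ∑' t, (α ^ t * ε + s t) :=
        hsum.summable.tsum_le_tsum hterm ((hgeo.mul_right ε).add hss)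
    _ = ε / (1 - α) + ∑' t, s t := by
        rw [(hgeo.mul_right ε).tsum_add hss, tsum_mul_right, tsum_geometric_of_lt_one hα.1 hα.2]
        ring
    _ ≤ _ := by
        rw [regretBound]
        gcongr

end Regret

end STSBandit

end

theorem mainTheorem2 {Ω 𝒴 Ξ : Type*} [MeasurableSpace Ω]
    [MeasurableSpace 𝒴] [StandardBorelSpace 𝒴] [Nonempty 𝒴]
    [MeasurableSpace Ξ] [StandardBorelSpace Ξ] [Nonempty Ξ]
    (P : Measure Ω) [IsProbabilityMeasure P]
    (μ : Measure ℝ) [IsProbabilityMeasure μ]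
    (K : Kernel (ℕ → ℝ) (ℕ → 𝒴)) [IsMarkovKernel K]
    (R : 𝒴 → ℝ) (θ : Ω → ℕ → ℝ) (Y : ℕ∞ → Ω → ℕ → 𝒴)
    (hB : STSBandit.IsNoisyBandit P μ K R θ Y)
    (ε : ℝ) (hε : ε ∈ Set.Ioo (0 : ℝ) 1)
    (ξ : Ω → Ξ) (σ : Ξ → ℕ → ℕ) (g : (t : ℕ) → (Fin t → ℕ × 𝒴) × Ξ → ℕ → ℝ)
    (A : ℕ → Ω → ℕ) (hA : STSBandit.IsSTS P K R θ Y ξ ε σ g A)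
    (δ : ℝ) (hδ : δ = μ.real (Set.Ioi (1 - ε)))
    (α : ℝ) (hα : α ∈ Set.Ico (0 : ℝ) 1) :
    -- almost surely an `ε`-optimal arm is eventually sampled
    (∀ᵐ ω ∂P, ∃ t : ℕ, 1 - ε ≤ θ ω (A t ω)) ∧
    -- the entropy bound
    STSBandit.condEntropy P (STSBandit.satisficingArm θ A ε) ξ
      ≤ ENNReal.ofReal (1 + Real.log (1 / δ)) ∧
    -- the information ratio bound
    STSBandit.informationRatio P R Y ξ α (STSBandit.satisficingArm θ A ε) A
      ≤ ENNReal.ofReal (STSBandit.ratioBound δ α) ∧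
    -- the regret is well defined and satisfies the explicit bound
    (∀ᵐ ω ∂P, Summable (STSBandit.discountedGap K R θ Y α A ω)) ∧
    Integrable (fun ω => ∑' t : ℕ, STSBandit.discountedGap K R θ Y α A ω t) P ∧
    ∫ ω, ∑' t : ℕ, STSBandit.discountedGap K R θ Y α A ω t ∂P
      ≤ STSBandit.regretBound ε δ α ∧
    -- the explicit bound is `Õ(ε/(1-α) + sqrt((1/δ)/(1-α²)))`, uniformly in `(ε, δ, α)`
    STSBandit.IsSoftO
      {p : ℝ × ℝ × ℝ | p.1 ∈ Set.Ioo (0 : ℝ) 1 ∧ p.2.1 ∈ Set.Ioc (0 : ℝ) 1 ∧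
        p.2.2 ∈ Set.Ico (0 : ℝ) 1}
      (fun p => STSBandit.regretBound p.1 p.2.1 p.2.2)
      (fun p => p.1 / (1 - p.2.2) + Real.sqrt ((1 / p.2.1) / (1 - p.2.2 ^ 2))) := by
  subst hδ
  exact ⟨STSBandit.ae_exists_satisficing hB hA hε.1,
    STSBandit.condEntropy_satisficingArm_le hB hA hε.1,
    STSBandit.informationRatio_le hB hA hε.1 hα,
    STSBandit.ae_summable_discountedGap hB hα,
    STSBandit.integrable_tsum_discountedGap hB hA hα,
    STSBandit.integral_tsum_discountedGap_le hB hA hε.1 hα,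
    STSBandit.isSoftO_regretBound⟩
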